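/- **Theorem (Boundedness of gravity vertex functions).** *Setting.* Let $K$ be smooth with $K=1$ on $[0,1]$ and $K=0$ on $[4,\infty)$, and let $0<\Lambda_R\le\Lambda_0$, $|A|\le\Lambda_R^3$, $|B_1|,|B_2|\le\Lambda_R^2$. The fields on $\mathbb R^4$ are $\Phi=(h_{\mu\nu},C^\mu,\overline C_\mu)$ with $h$ symmetric and bosonic and the ghosts $C,\overline C$ Grassmann; the regularized propagators are $$\Delta^\Lambda_{\mu\nu\rho\sigma}(k)=\tfrac12K\!\left(\tfrac{k^2}{\Lambda^2}\right)\frac{\delta_{\mu\rho}\delta_{\nu\sigma}+\delta_{\mu\sigma}\delta_{\nu\rho}-\delta_{\mu\nu}\delta_{\rho\sigma}}{k^2+B_1},\qquad \Delta^\Lambda_{GH\,\mu\nu}(k)=-K\!\left(\tfrac{k^2}{\Lambda^2}\right)\frac{\delta_{\mu\nu}}{k^2+B_2}.$$ Let $L(\Phi,\Lambda)$, $\Lambda_R\le\Lambda\le\Lambda_0$, be an effective potential with vertex functions $L_n^{a_1\dots a_n}(k_1,\dots,k_n,\Lambda)$, $n\ge1$, $\sum_ik_i=0$, defined by $$\delta^4\Big(\sum_i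 k_i\Big)L_n=(2\pi)^{4n-4}\frac{\delta}{\delta\phi_{a_1}(k_1)}\cdots\frac{\delta}{\delta\phi_{a_n}(k_n)}L\Big|_{\Phi=0},$$ which are formal power series in coupling tuples $\rho_4^R,\rho_5^R,\rho_6^0,\rho_7^0,\rho_8^0$, with coefficients $L_n^{(r)}$, $r=(r_1,\dots,r_5)$, each $r_i$ a multi-index of total order $|r_i|$; put $r_{NR}=|r_3|+|r_4|+|r_5|$. Assume that each $L_n^{(r)}$ is smooth in the momenta, with momentum derivatives jointly continuous in $(\Lambda,k)$, is symmetric (antisymmetric) under exchange of graviton (ghost) legs, has ghost number $0$ and is $O(4)$-covariant; that $L_n^{(0)}=0$; that each order of $L$ is a polynomial in the fields, of degree at most $N(r)$ at $\Lambda=\Lambda_0$; and that $L$ solves, order by order, Polchinski's equation $$-\frac{d L}{d\Lambda}=\int d^4k\,\frac{(2\pi)^4}{2}\,\frac{d\Delta^\Lambda_{\mu\nu\rho\sigma}}{d\Lambda}\Big(\frac{\delta L}{\delta h_{\mu\nu}}\frac{\delta L}{\delta h_{\rho\sigma}}+\frac{\delta^2L}{\delta h_{\mu\nu}\delta h_{\rho\sigma}}+A\,\delta(k)\,\delta^{\mu\nu}\frac{\delta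 L}{\delta h_{\rho\sigma}}\Big)+\int d^4k\,(2\pi)^4\,\frac{d\Delta^\Lambda_{GH\,\mu\nu}}{d\Lambda}\Big(\frac{\delta L}{\delta\overline C_\mu}\frac{\delta L}{\delta C_\nu}+\frac{\delta^2L}{\delta\overline C_\mu\,\delta C_\nu}\Big)$$ (the two derivatives in each product taken at $k$ and $-k$). The running couplings are the coordinates, with respect to fixed bases of the tensor structures allowed by these symmetries, of the following values at zero momentum: $\rho_1$ of $L_1$, $\rho_2$ of $L_2$, $\rho_3$ of the second momentum derivatives of $L_2$, $\rho_4$ of $L_3$, $\rho_5$ of $L_4$, $(\rho_6,\rho_7)$ of the second momentum derivatives of $L_3$, and $\rho_8$ of $L_5$. Impose the renormalization conditions $\rho_1(\Lambda_R)=\rho_2(\Lambda_R)=\rho_3(\Lambda_R)=0$, $\rho_4(\Lambda_R)=\rho_4^R$, $\rho_5(\Lambda_R)=\rho_5^R$ and the initial conditions $\rho_{\tilde a}(\Lambda_0)=\rho_{\tilde a}^0$, $\tilde a=6,7,8$. Put $A_n^{(r)}=\Lambda^{n-4+|r_1|-r_{NR}}L_n^{(r)}$, let $\partial^p$ be any product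 of $p$ operators $\partial/\partial k_i^\mu-\partial/\partial k_j^\mu$, and let $\|\cdot\|$ at scale $\Lambda$ be the maximum over all field components, all such $\partial^p$ and all momenta with $k_i^2\le4\Lambda^2$. $Pln(z)$ denotes a polynomial in $\ln z$ with nonnegative coefficients, which may depend on $n,p,r$. *Statement.* Assume that for all $n\ge1$, $p\ge0$ with $n+p\ge6$ and all $r$ $$\|\partial^pA_n^{(r)}(\Lambda_0)\|\le\Lambda_0^{-p}\Big(\frac{\Lambda_0}{\Lambda_R}\Big)^{|r_1|}Pln\Big(\frac{\Lambda_0}{\Lambda_R}\Big).$$ Then for all $n\ge1$, $p\ge0$, all $r$ and all $\Lambda_R\le\Lambda\le\Lambda_0$ $$\|\partial^pA_n^{(r)}(\Lambda)\|\le\Lambda^{-p}\Big(\frac{\Lambda}{\Lambda_R}\Big)^{|r_1|}\Big(\frac{\Lambda_0}{\Lambda}\Big)^{r_{NR}}\Big(\delta_{r_{NR},0}\,Pln\Big(\frac{\Lambda}{\Lambda_R}\Big)+\frac{\Lambda}{\Lambda_0}\,Pln\Big(\frac{\Lambda_0}{\Lambda_R}\Big)\Big),$$ where the polynomials in the conclusion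 depend only on $n,p,r$, on $K$, on the chosen tensor bases, on $N$ and on the polynomials in the assumption; they do not depend on $\Lambda$, $\Lambda_0$, $\Lambda_R$, $A$, $B_1$, $B_2$ or $L$. -/

import Mathlib

open scoped ContDiff

noncomputable section

namespace EffGravity

/-- Euclidean four-dimensional momentum space. -/
abbrev E4 := EuclideanSpace ℝ (Fin 4)

/-- Momenta `(k₁, …, kₙ)` obeying momentum conservation `k₁ + … + kₙ = 0`; the vertex functions
only make sense on this space. -/
def Momenta (n : ℕ) : Submodule ℝ (Fin n → E4) where
  carrier := {k | ∑ i, k i = 0}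
  zero_mem' := by simp
  add_mem' := by
    intro a b ha hb
    simp only [Set.mem_ofPred_eq] at ha hb ⊢
    simp [Finset.sum_add_distrib, ha, hb]
  smul_mem' := by
    intro c a ha
    simp only [Set.mem_ofPred_eq] at ha ⊢
    simp [← Finset.smul_sum, ha]

/-- `(q₁, …, qₘ) ↦ (q₁, …, qₘ, -(q₁ + … + qₘ))`: one more leg, whose momentum is fixed by
momentum conservation. -/
def attach {m : ℕ} (q : Fin m → E4) : Momenta (m + 1) :=
  ⟨Fin.snoc (α := fun _ => E4) q (-∑ i, q i), by
    change ∑ i, Fin.snoc (α := fun _ => E4) q (-∑ i, q i) i = 0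
    rw [Fin.sum_univ_castSucc]
    simp⟩

/-- Permutation of the momenta. -/
def permute {n : ℕ} (σ : Equiv.Perm (Fin n)) (k : Momenta n) : Momenta n :=
  ⟨fun i => k.1 (σ i), by
    change ∑ i, k.1 (σ i) = 0
    rw [Equiv.sum_comp σ k.1]
    exact k.2⟩

/-- Simultaneous orthogonal transformation of all momenta. -/
def rotate {n : ℕ} (R : E4 ≃ₗᵢ[ℝ] E4) (k : Momenta n) : Momenta n :=
  ⟨fun i => R (k.1 i), by
    change ∑ i, R (k.1 i) = 0
    rw [← map_sum]
    have h : ∑ i, k.1 i = 0 := k.2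
    rw [h, map_zero]⟩

/-- The direction of the derivative `∂^μ_{i,j} = ∂/∂k_i^μ - ∂/∂k_j^μ`, for `v = (μ, i, j)`. -/
def direction {n : ℕ} (v : Fin 4 × Fin n × Fin n) : Momenta n :=
  ⟨Pi.single v.2.1 (EuclideanSpace.single v.1 (1 : ℝ))
      - Pi.single v.2.2 (EuclideanSpace.single v.1 (1 : ℝ)), by
    change ∑ i, (Pi.single v.2.1 (EuclideanSpace.single v.1 (1 : ℝ))
      - Pi.single v.2.2 (EuclideanSpace.single v.1 (1 : ℝ)) : Fin n → E4) i = 0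
    simp⟩

/-- `∂^p F (k)` with `∂^p = ∂^{μ₁}_{i₁,j₁} ⋯ ∂^{μ_p}_{i_p,j_p}`, where `v q = (μ_q, i_q, j_q)`. -/
def momDeriv {n : ℕ} (p : ℕ) (F : Momenta n → ℂ) (v : Fin p → Fin 4 × Fin n × Fin n)
    (k : Momenta n) : ℂ :=
  iteratedFDeriv ℝ p F k (fun q => direction (v q))

/-- `‖∂^p F‖ ≤ c`, where `‖·‖` is the maximum over all momenta with `k_i² ≤ 4Λ²` (and over all
choices of the `p` derivatives). -/
def NormLE {n : ℕ} (Λ : ℝ) (p : ℕ) (F : Momenta n → ℂ) (c : ℝ) : Prop :=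
  ∀ (v : Fin p → Fin 4 × Fin n × Fin n) (k : Momenta n),
    (∀ i, ‖k.1 i‖ ^ 2 ≤ 4 * Λ ^ 2) → ‖momDeriv p F v k‖ ≤ c

/-! ### Fields -/

/-- Components of `Φ = (h_{μν}, C^μ, C̄_μ)`: `inl (μ, ν)` is the graviton `h_{μν}`,
`inr (inl μ)` the ghost `C^μ`, `inr (inr μ)` the antighost `C̄_μ`. -/
abbrev FieldIndex := (Fin 4 × Fin 4) ⊕ (Fin 4 ⊕ Fin 4)

/-- Grassmann parity. -/
def parity : FieldIndex → ℕ
  | .inl _ => 0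
  | .inr _ => 1

def ghostNumber : FieldIndex → ℤ
  | .inl _ => 0
  | .inr (.inl _) => 1
  | .inr (.inr _) => -1

/-- `h_{μν} ↦ h_{νμ}`. -/
def transposeIndex : FieldIndex → FieldIndex
  | .inl (μ, ν) => .inl (ν, μ)
  | x => x

/-- Matrix entries `R^{μν}` of an orthogonal transformation. -/
def entry (R : E4 ≃ₗᵢ[ℝ] E4) (μ ν : Fin 4) : ℝ := R (EuclideanSpace.single ν (1 : ℝ)) μ

/-- The representation of `O(4)` on the field components. -/
def rep (R : E4 ≃ₗᵢ[ℝ] E4) : FieldIndex → FieldIndex → ℝ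
  | .inl (μ, ν), .inl (ρ, σ) => entry R μ ρ * entry R ν σ
  | .inr (.inl μ), .inr (.inl ν) => entry R μ ν
  | .inr (.inr μ), .inr (.inr ν) => entry R μ ν
  | _, _ => 0

/-- `n`-point functions with the symmetries of the gravity vertex functions: smooth in the
momenta, (anti)symmetric under exchange of neighbouring (hence of any) legs, symmetric in the
two indices of every graviton, of total ghost number zero, and covariant under `O(4)`. -/
structure IsVertex {n : ℕ} (F : (Fin n → FieldIndex) → Momenta n → ℂ) : Prop where
  smooth : ∀ a, ContDiff ℝ ∞ (F a)
  exchange : ∀ (i j : Fin n), (i : ℕ) + 1 = j → ∀ a k,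
    F (fun m => a (Equiv.swap i j m)) (permute (Equiv.swap i j) k)
      = (-1) ^ (parity (a i) * parity (a j)) * F a k
  graviton : ∀ (i : Fin n) a k, F (Function.update a i (transposeIndex (a i))) k = F a k
  ghost : ∀ a, ∑ i, ghostNumber (a i) ≠ 0 → ∀ k, F a k = 0
  covariant : ∀ (R : E4 ≃ₗᵢ[ℝ] E4) a k,
    F a (rotate R k) = ∑ b : Fin n → FieldIndex, ((∏ i, rep R (a i) (b i) : ℝ) : ℂ) * F b k

/-! ### Regularized propagators -/

/-- Momentum cutoff functions. -/
structure IsCutoff (K : ℝ → ℝ) : Prop where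
  smooth : ContDiff ℝ ∞ K
  eq_one : ∀ z, 0 ≤ z → z ≤ 1 → K z = 1
  eq_zero : ∀ z, 4 ≤ z → K z = 0

/-- Kronecker symbol. -/
def kd (μ ν : Fin 4) : ℝ := if μ = ν then 1 else 0

/-- The regularized graviton propagator `Δ^Λ_{μνρσ}(k²)` and ghost propagator
`Δ^Λ_{GH μν}(k²)`, the latter in the component (antighost, ghost). -/
def propagator (K : ℝ → ℝ) (B₁ B₂ : ℝ) (Λ : ℝ) (k : E4) : FieldIndex → FieldIndex → ℝ
  | .inl (μ, ν), .inl (ρ, σ) =>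
      1 / 2 * K (‖k‖ ^ 2 / Λ ^ 2)
        * ((kd μ ρ * kd ν σ + kd μ σ * kd ν ρ - kd μ ν * kd ρ σ) / (‖k‖ ^ 2 + B₁))
  | .inr (.inr μ), .inr (.inl ν) => -K (‖k‖ ^ 2 / Λ ^ 2) * (kd μ ν / (‖k‖ ^ 2 + B₂))
  | _, _ => 0

/-- Weight of a contraction in Polchinski's equation: `1/2` for gravitons, `1` for a
ghost-antighost pair. -/
def weight : FieldIndex → ℝ
  | .inl _ => 1 / 2
  | .inr _ => 1

/-- `w · d/dΛ Δ^Λ(k)`, including the weight of the contraction. -/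
def propagatorDot (K : ℝ → ℝ) (B₁ B₂ : ℝ) (Λ : ℝ) (k : E4) (b c : FieldIndex) : ℝ :=
  weight b * deriv (fun s => propagator K B₁ B₂ s k b c) Λ

/-- The trace `δ^{μν}` on graviton components (the term linear in `h` in the action is
proportional to `A h^μ_μ`). -/
def traceIndex : FieldIndex → ℝ
  | .inl (μ, ν) => kd μ ν
  | .inr _ => 0

/-! ### Polchinski's equation for the vertex functions -/

/-- The couplings used as expansion parameters. For `i = 0, 1` these are the components of the
tuples `ρ₄^R, ρ₅^R`, for `i = 2, 3, 4` those of `ρ₆⁰, ρ₇⁰, ρ₈⁰`; the `i`-th tuple has `d i`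
components. -/
abbrev Coupling (d : Fin 5 → ℕ) := Σ i : Fin 5, Fin (d i)

/-- Formal power series in the couplings. -/
abbrev Series (d : Fin 5 → ℕ) := MvPowerSeries (Coupling d) ℂ

/-- An effective potential depending on the scale, given by its vertex functions
`L_n^{a₁…aₙ}(k₁, …, kₙ, Λ)`, which are the `n`-fold (left) functional derivatives
`δ/δφ_{a₁}(k₁) ⋯ δ/δφ_{aₙ}(kₙ)` at `Φ = 0` (up to `δ⁴(∑ kᵢ)` and powers of `2π`).
Only `n ≥ 1` is relevant. -/
abbrev Potential (d : Fin 5 → ℕ) :=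
  ℝ → (n : ℕ) → (Fin n → FieldIndex) → Momenta n → Series d

/-- The legs in `S`, in increasing order. -/
def sublegs {n : ℕ} {α : Type} (S : Finset (Fin n)) (x : Fin n → α) : Fin S.card → α :=
  fun i => x (S.orderEmbOfFin rfl i)

/-- Add a leg at the end. -/
def addLeg {m : ℕ} (a : Fin m → FieldIndex) (b : FieldIndex) : Fin (m + 1) → FieldIndex :=
  Fin.snoc (α := fun _ => FieldIndex) a b

/-- Sign in the graded Leibniz rule
`δ_{a₁} ⋯ δ_{aₙ} (X Y) = ∑_S ± (δ_{a_S} X) (δ_{a_{Sᶜ}} Y)` for `X` of the parity of `b`. -/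
def leibnizSign {n : ℕ} (a : Fin n → FieldIndex) (S : Finset (Fin n)) (b : FieldIndex) : ℂ :=
  (-1) ^ (∑ i ∈ Sᶜ, parity (a i) * (parity b + ∑ j ∈ S.filter (fun j => i < j), parity (a j)))

variable {d : Fin 5 → ℕ}

/-- The contribution of `(δL/δφ_b)(δL/δφ_c)`. -/
def treeTerm (K : ℝ → ℝ) (B₁ B₂ : ℝ) (L : Potential d) (Λ : ℝ) (n : ℕ)
    (a : Fin n → FieldIndex) (k : Momenta n) : Series d :=
  ∑ S : Finset (Fin n), ∑ b : FieldIndex, ∑ c : FieldIndex,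
    (leibnizSign a S b * (propagatorDot K B₁ B₂ Λ (∑ i ∈ S, k.1 i) b c : ℂ)) •
      (L Λ (S.card + 1) (addLeg (sublegs S a) b) (attach (sublegs S k.1))
        * L Λ (Sᶜ.card + 1) (addLeg (sublegs Sᶜ a) c) (attach (sublegs Sᶜ k.1)))

/-- The contribution of `δ²L/δφ_b δφ_c`, a loop integral, to order `r`. -/
def loopTerm (K : ℝ → ℝ) (B₁ B₂ : ℝ) (L : Potential d) (Λ : ℝ) (n : ℕ)
    (a : Fin n → FieldIndex) (k : Momenta n) (r : Coupling d →₀ ℕ) : ℂ :=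
  (((2 * Real.pi) ^ 4)⁻¹ : ℝ) * ∫ q : E4, ∑ b : FieldIndex, ∑ c : FieldIndex,
    (propagatorDot K B₁ B₂ Λ q b c : ℂ) *
      MvPowerSeries.coeff r (L Λ (n + 2) (addLeg (addLeg a b) c)
        (attach (Fin.snoc (α := fun _ => E4) k.1 q)))

/-- The contribution of the term linear in `h` in the action. -/
def linearTerm (K : ℝ → ℝ) (A B₁ B₂ : ℝ) (L : Potential d) (Λ : ℝ) (n : ℕ)
    (a : Fin n → FieldIndex) (k : Momenta n) : Series d :=
  ∑ b : FieldIndex, ∑ c : FieldIndex,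
    ((A * traceIndex b * propagatorDot K B₁ B₂ Λ 0 b c : ℝ) : ℂ) •
      L Λ (n + 1) (addLeg a c) (attach k.1)

/-- `L` solves Polchinski's equation for Euclidean quantum gravity on `[Λ_R, Λ_0]` in the sense
of formal power series in the couplings, each order being a polynomial in the fields and the
zeroth order being zero. -/
structure IsSolution (K : ℝ → ℝ) (A B₁ B₂ ΛR Λ0 : ℝ) (L : Potential d) : Prop where
  vertex : ∀ Λ ∈ Set.Icc ΛR Λ0, ∀ n, 1 ≤ n → ∀ r,
    IsVertex (fun a (k : Momenta n) => MvPowerSeries.coeff r (L Λ n a k))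
  continuous : ∀ n, 1 ≤ n → ∀ a r p,
    ContinuousOn (fun x : ℝ × Momenta n =>
      iteratedFDeriv ℝ p (fun k => MvPowerSeries.coeff r (L x.1 n a k)) x.2)
      (Set.Icc ΛR Λ0 ×ˢ Set.univ)
  zeroth : ∀ Λ ∈ Set.Icc ΛR Λ0, ∀ n, 1 ≤ n → ∀ a k, MvPowerSeries.coeff 0 (L Λ n a k) = 0
  polynomial : ∀ r, ∃ m, ∀ Λ ∈ Set.Icc ΛR Λ0, ∀ n, m < n → ∀ a k,
    MvPowerSeries.coeff r (L Λ n a k) = 0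
  flow : ∀ Λ ∈ Set.Icc ΛR Λ0, ∀ n, 1 ≤ n → ∀ a k r,
    HasDerivWithinAt (fun s => MvPowerSeries.coeff r (L s n a k))
      (-(MvPowerSeries.coeff r (treeTerm K B₁ B₂ L Λ n a k)
        + loopTerm K B₁ B₂ L Λ n a k r
        + MvPowerSeries.coeff r (linearTerm K A B₁ B₂ L Λ n a k)))
      (Set.Icc ΛR Λ0) Λ

/-! ### Running couplings -/

/-- Arrays that can hold the `p`-th derivatives at zero momentum of an `n`-point function. -/
abbrev Jet (n p : ℕ) := (Fin n → FieldIndex) → (Fin p → Fin 4 × Fin n × Fin n) → ℂ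

/-- The values which the `p`-th derivatives at zero momentum of an `n`-point vertex function can
take: the tensor structures allowed by the symmetries. -/
def jets (n p : ℕ) : Set (Jet n p) :=
  {T | ∃ F : (Fin n → FieldIndex) → Momenta n → ℂ, IsVertex F ∧
    ∀ a v, T a v = momDeriv p (F a) v 0}

/-- A basis of the space of allowed tensor structures. -/
def IsJetBasis {ι : Type} {n p : ℕ} (T : ι → Jet n p) : Prop :=
  LinearIndependent ℂ T ∧ (Submodule.span ℂ (Set.range T) : Set (Jet n p)) = jets n p

/-- Bases of tensor structures with respect to which the tuples of couplings are coordinates: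
`ρ₄` for `L₃(0)`, `ρ₅` for `L₄(0)`, `ρ₆` and `ρ₇` for the second derivatives of `L₃` at zero,
and `ρ₈` for `L₅(0)`. -/
structure TensorBases (d : Fin 5 → ℕ) where
  t4 : Fin (d 0) → Jet 3 0
  t5 : Fin (d 1) → Jet 4 0
  t67 : Fin (d 2) ⊕ Fin (d 3) → Jet 3 2
  t8 : Fin (d 4) → Jet 5 0
  basis4 : IsJetBasis t4
  basis5 : IsJetBasis t5
  basis67 : IsJetBasis t67
  basis8 : IsJetBasis t8

/-- The `p`-th derivatives at zero momentum of the `n`-point function at scale `Λ`. -/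
def taylorCoeff (L : Potential d) (Λ : ℝ) (n p : ℕ) (a : Fin n → FieldIndex)
    (v : Fin p → Fin 4 × Fin n × Fin n) : Series d :=
  fun r => momDeriv p (fun k => MvPowerSeries.coeff r (L Λ n a k)) v 0

/-- Renormalization conditions `ρ₁ = ρ₂ = ρ₃ = 0`, `ρ₄ = ρ₄^R`, `ρ₅ = ρ₅^R` at `Λ_R`. -/
structure RenormalizationConditions (T : TensorBases d) (ΛR : ℝ) (L : Potential d) : Prop where
  rho1 : ∀ a v, taylorCoeff L ΛR 1 0 a v = 0
  rho2 : ∀ a v, taylorCoeff L ΛR 2 0 a v = 0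
  rho3 : ∀ a v, taylorCoeff L ΛR 2 2 a v = 0
  rho4 : ∀ a v, taylorCoeff L ΛR 3 0 a v
    = ∑ j, T.t4 j a v • (MvPowerSeries.X ⟨0, j⟩ : Series d)
  rho5 : ∀ a v, taylorCoeff L ΛR 4 0 a v
    = ∑ j, T.t5 j a v • (MvPowerSeries.X ⟨1, j⟩ : Series d)

/-- Initial conditions `ρ₆ = ρ₆⁰`, `ρ₇ = ρ₇⁰`, `ρ₈ = ρ₈⁰` at `Λ_0`. -/
structure BareConditions (T : TensorBases d) (Λ0 : ℝ) (L : Potential d) : Prop where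
  rho67 : ∀ a v, taylorCoeff L Λ0 3 2 a v
    = ∑ j, T.t67 (.inl j) a v • (MvPowerSeries.X ⟨2, j⟩ : Series d)
      + ∑ j, T.t67 (.inr j) a v • (MvPowerSeries.X ⟨3, j⟩ : Series d)
  rho8 : ∀ a v, taylorCoeff L Λ0 5 0 a v
    = ∑ j, T.t8 j a v • (MvPowerSeries.X ⟨4, j⟩ : Series d)

/-! ### Orders of perturbation theory and dimensionless vertex functions -/

/-- `|r_i|`, the total order in the `i`-th tuple of couplings. -/
def tupleOrder (i : Fin 5) (r : Coupling d →₀ ℕ) : ℕ := ∑ j, r ⟨i, j⟩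

/-- `r_NR = |r₃| + |r₄| + |r₅|`, the order in the bare nonrenormalizable couplings. -/
def orderNR (r : Coupling d →₀ ℕ) : ℕ := tupleOrder 2 r + tupleOrder 3 r + tupleOrder 4 r

/-- `A_n^{(r)} = Λ^{n - 4 + |r₁| - r_NR} L_n^{(r)}`. -/
def dimlessVertex (L : Potential d) (Λ : ℝ) (n : ℕ) (r : Coupling d →₀ ℕ)
    (a : Fin n → FieldIndex) (k : Momenta n) : ℂ :=
  ((Λ ^ ((n : ℤ) - 4 + tupleOrder 0 r - orderNR r) : ℝ) : ℂ)
    * MvPowerSeries.coeff r (L Λ n a k)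

/-- `Pln(z)`: a polynomial in `ln z`; its coefficients are required to be nonnegative. -/
def Pln (P : Polynomial ℝ) (z : ℝ) : ℝ := P.eval (Real.log z)

def NonnegCoeffs (P : Polynomial ℝ) : Prop := ∀ i, 0 ≤ P.coeff i

/-- At the bare scale each order is a polynomial in the fields of degree at most `N r`. -/
def BareDegree (N : (Coupling d →₀ ℕ) → ℕ) (Λ0 : ℝ) (L : Potential d) : Prop :=
  ∀ r n, N r < n → ∀ a k, MvPowerSeries.coeff r (L Λ0 n a k) = 0

/-- Smallness of the bare vertex functions for `n + p ≥ 6`. -/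
def SmallBare (P : ℕ → ℕ → (Coupling d →₀ ℕ) → Polynomial ℝ) (ΛR Λ0 : ℝ) (L : Potential d) :
    Prop :=
  ∀ r n p, 1 ≤ n → 6 ≤ n + p → ∀ a,
    NormLE Λ0 p (dimlessVertex L Λ0 n r a)
      ((Λ0 ^ p)⁻¹ * (Λ0 / ΛR) ^ tupleOrder 0 r * Pln (P n p r) (Λ0 / ΛR))

end EffGravity

end

/-! The flow equation is integrated from whichever end of the scale interval carries boundary data.
The quantities estimated are the dimensionful vertex functions: the `p`-th derivatives of
`L_n^{(r)}` should be of size `Λ^(4-n-p) Λ_R^(-|r₁|) Λ_0^(r_NR)` up to logarithms, as long as all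
momenta have norm at most `2Λ`. The factor `FlowData.unit` is multiplicative in `r`, and
`logEnvelope` is stable under sums and products at the price of raising one integer, so bounds of
this shape can be multiplied (`LogBound.mul`).

The induction runs over the order `r` and, for fixed `r`, downward over the number of legs. Since
`L^{(0)} = 0`, the tree term contains only strictly smaller orders, with any number of legs; the
loop term contains the same order with `n + 2` legs. A bound on the degree that is uniform in the
solution (`exists_uniform_degree`) starts the downward induction. The term linear in the field drops
out because the scale derivative of the propagator vanishes at zero momentum.

The analytic input is `exists_propagatorDot_bound`: `p`-th derivatives of the single-scale
propagator are `O(Λ^(-3-p))`, uniformly in the masses, although `k² + B` may vanish on the sphere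
`k² = Λ²`. There `K'` vanishes to infinite order and absorbs the denominator. The support `‖k‖ ≤ 2Λ`
keeps all internal momenta in the region of the induction hypothesis. Power counting then gives a
right-hand side of size `Λ^(3-n-p)` (`treeTerm_bound`, `loopTerm_bound`).

Integration depends on `n + p`. For `n + p ≥ 6` it goes down from `Λ_0` at all momenta, by the
smallness assumption. For `n + p = 5` it goes down from `Λ_0`, and for `n + p ≤ 4` up from `Λ_R`,
both at zero momentum only; the missing momentum dependence comes from the bound on `p + 1`
derivatives by the mean value inequality (`VertexBound.of_zeroBound`). At zero momentum the boundary
conditions determine every derivative with `n + p ≤ 5`: the reflection in `O(4)` kills odd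
derivatives, and a one-point function has no momentum to depend on.

The flow equation is given pointwise in the momenta, not for momentum derivatives. Its right-hand
side is therefore estimated through iterated finite differences, which commute with `d/dΛ` and with
the loop integral by linearity; derivative bounds are recovered in the limit of small steps. -/

noncomputable section

namespace EffGravity

/-! ### Finite differences as a substitute for momentum derivatives of the flow equation -/

section FiniteDifferences

variable {E F : Type*} [NormedAddCommGroup E] [NormedSpace ℝ E]
  [NormedAddCommGroup F] [NormedSpace ℝ F]

/-- Iterated finite differences in the directions `v`. -/
def fdiff : (p : ℕ) → (Fin p → E) → (E → F) → E → F
  | 0, _, f => f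
  | p + 1, v, f => fdiff p (Fin.init v) (fun x => f (x + v (Fin.last p)) - f x)

omit [NormedSpace ℝ E] in
lemma sum_norm_init {p : ℕ} (v : Fin (p + 1) → E) :
    ∑ i, ‖v i‖ = ∑ i, ‖Fin.init v i‖ + ‖v (Fin.last p)‖ := by
  rw [Fin.sum_univ_castSucc]; rfl

omit [NormedSpace ℝ E] in
lemma prod_norm_init {p : ℕ} (v : Fin (p + 1) → E) :
    ∏ i, ‖v i‖ = (∏ i, ‖Fin.init v i‖) * ‖v (Fin.last p)‖ := by
  rw [Fin.prod_univ_castSucc]; rfl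

/-- The mean value inequality, applied once per direction. The closed ball of radius `∑ ‖v i‖`
contains every point that the steps can reach. -/
lemma norm_fdiff_le {p : ℕ} {f : E → F} (hf : ContDiff ℝ ∞ f) (v : Fin p → E) (x : E) {c : ℝ}
    (h : ∀ y ∈ Metric.closedBall x (∑ i, ‖v i‖), ‖iteratedFDeriv ℝ p f y‖ ≤ c) :
    ‖fdiff p v f x‖ ≤ c * ∏ i, ‖v i‖ := by
  induction p generalizing f c with
  | zero =>
    have := h x (by simp)
    simpa [fdiff] using this
  | succ p ih =>
    rw [fdiff, prod_norm_init, mul_comm (∏ i, _), ← mul_assoc]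
    have hs : ContDiff ℝ ∞ (fun x => f (x + v (Fin.last p))) :=
      hf.comp (contDiff_id.add contDiff_const)
    refine ih (hs.sub hf) (Fin.init v) fun y hy => ?_
    have e : iteratedFDeriv ℝ p (fun x => f (x + v (Fin.last p)) - f x) y
        = iteratedFDeriv ℝ p f (y + v (Fin.last p)) - iteratedFDeriv ℝ p f y := by
      have := iteratedFDeriv_sub_apply (𝕜 := ℝ) (i := p) (x := y)
        (f := fun x => f (x + v (Fin.last p))) (g := f)
        (hs.of_le (by exact_mod_cast le_top)).contDiffAt
        (hf.of_le (by exact_mod_cast le_top)).contDiffAt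
      rw [← iteratedFDeriv_comp_add_right]
      exact this
    rw [e]
    have hball : segment ℝ y (y + v (Fin.last p)) ⊆ Metric.closedBall x (∑ i, ‖v i‖) := by
      apply (convex_closedBall x _).segment_subset
      · refine Metric.closedBall_subset_closedBall ?_ hy
        rw [sum_norm_init]; linarith [norm_nonneg (v (Fin.last p))]
      · rw [sum_norm_init, mem_closedBall_iff_norm]
        rw [mem_closedBall_iff_norm] at hy
        calc ‖y + v (Fin.last p) - x‖ = ‖(y - x) + v (Fin.last p)‖ := by congr 1; abel
          _ ≤ _ := (norm_add_le _ _).trans (by linarith)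
    have := Convex.norm_image_sub_le_of_norm_fderiv_le (𝕜 := ℝ) (f := iteratedFDeriv ℝ p f)
      (C := c) (s := segment ℝ y (y + v (Fin.last p))) (x := y) (y := y + v (Fin.last p))
      (fun z _ => (hf.differentiable_iteratedFDeriv (by exact_mod_cast ENat.natCast_lt_top p)) z)
      (fun z hz => by rw [norm_fderiv_iteratedFDeriv]; exact h z (hball hz))
      (convex_segment _ _) (left_mem_segment _ _ _) (right_mem_segment _ _ _)
    simpa using this

lemma fdiff_smul_lim {p : ℕ} {f : E → F} (v : Fin p → E) (x w : E) (hf : Differentiable ℝ f) :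
    Filter.Tendsto (fun h : ℝ => h⁻¹ • fdiff p v (fun y => f (y + h • w) - f y) x)
      (nhdsWithin 0 (Set.Ioi 0)) (nhds (fdiff p v (fun y => fderiv ℝ f y w) x)) := by
  induction p generalizing f with
  | zero =>
    have h1 := (hf x).hasFDerivAt.hasLineDerivAt w
    have := h1.tendsto_slope_zero_right
    simpa [fdiff] using this
  | succ p ih =>
    have hd : Differentiable ℝ (fun y => f (y + v (Fin.last p)) - f y) :=
      (hf.comp (differentiable_id.add_const _)).sub hf
    have := ih (Fin.init v) hd
    simp only [fdiff]
    refine (this.congr fun h => ?_).trans_eq ?_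
    · congr 2; funext y
      simp only [add_right_comm]; abel
    · congr 2; funext y
      have h1 : DifferentiableAt ℝ (fun y => f (y + v (Fin.last p))) y :=
        (hf.comp (differentiable_id.add_const _)) y
      rw [fderiv_fun_sub h1 (hf y), fderiv_comp_add_right]; rfl

/-- Converse of `norm_fdiff_le`: one difference at a time becomes a derivative by scaling its step
to zero, and the bound, linear in that step, survives the division. -/
lemma norm_iteratedFDeriv_apply_le_of_fdiff {p : ℕ} {f : E → F} (hf : ContDiff ℝ ∞ f)
    {R c : ℝ}
    (h : ∀ (v : Fin p → E) x, ‖x‖ + ∑ i, ‖v i‖ < R →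
      ‖fdiff p v f x‖ ≤ c * ∏ i, ‖v i‖) {x : E} (hx : ‖x‖ < R) (v : Fin p → E) :
    ‖iteratedFDeriv ℝ p f x v‖ ≤ c * ∏ i, ‖v i‖ := by
  induction p generalizing f c with
  | zero =>
    have := h v x (by simpa using hx)
    simpa [fdiff] using this
  | succ p ih =>
    have hf' : ContDiff ℝ ∞ (fun y => fderiv ℝ f y (v (Fin.last p))) :=
      (hf.fderiv_right (m := ∞) (by simp)).clm_apply contDiff_const
    have key := ih (f := fun y => fderiv ℝ f y (v (Fin.last p))) hf'
      (c := c * ‖v (Fin.last p)‖) ?_ (Fin.init v)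
    · rw [iteratedFDeriv_succ_apply_right, prod_norm_init, mul_comm (∏ i, _), ← mul_assoc]
      refine le_trans (le_of_eq ?_) key
      congr 1
      have hfd : ContDiffAt ℝ p (fderiv ℝ f) x :=
        ((hf.fderiv_right (m := ∞) (by simp)).of_le (by exact_mod_cast le_top)).contDiffAt
      have := ((ContinuousLinearMap.apply ℝ F
        (v (Fin.last p))).iteratedFDeriv_comp_left hfd (i := p) le_rfl)
      exact (congrArg (fun T => T (Fin.init v)) this).symm
    · intro u y hy
      have hlim := (fdiff_smul_lim u y (v (Fin.last p)) (hf.differentiable (by simp))).norm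
      refine le_of_tendsto hlim ?_
      -- The strict inequality in the hypothesis leaves room for one further step of small length.
      have hev : ∀ᶠ t : ℝ in nhdsWithin 0 (Set.Ioi 0),
          ‖y‖ + (∑ i, ‖u i‖ + ‖t • v (Fin.last p)‖) < R := by
        have hc : Continuous fun t : ℝ => ‖y‖ + (∑ i, ‖u i‖ + ‖t • v (Fin.last p)‖) := by fun_prop
        refine nhdsWithin_le_nhds (hc.continuousAt.eventually_lt_const ?_)
        simpa using hy
      filter_upwards [hev, self_mem_nhdsWithin] with t ht htpos
      have htpos : 0 < t := htpos
      have h2 := h (Fin.snoc (α := fun _ => E) u (t • v (Fin.last p))) y (by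
        rw [sum_norm_init]; simpa using ht)
      rw [prod_norm_init, fdiff] at h2
      simp only [Fin.init_snoc, Fin.snoc_last] at h2
      rw [norm_smul, norm_inv, Real.norm_of_nonneg htpos.le, inv_mul_le_iff₀ htpos]
      refine h2.trans (le_of_eq ?_)
      rw [norm_smul, Real.norm_of_nonneg htpos.le]; ring

/-- Finite differences only see the open ball; continuity of the derivative extends the bound to its
closure, which is what the norm with `k² ≤ 4Λ²` requires. -/
lemma norm_iteratedFDeriv_le_of_fdiff {p : ℕ} {f : E → F} (hf : ContDiff ℝ ∞ f)
    {R c : ℝ} (hR : 0 < R) (hc : 0 ≤ c)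
    (h : ∀ (v : Fin p → E) x, ‖x‖ + ∑ i, ‖v i‖ < R →
      ‖fdiff p v f x‖ ≤ c * ∏ i, ‖v i‖) {x : E} (hx : ‖x‖ ≤ R) :
    ‖iteratedFDeriv ℝ p f x‖ ≤ c := by
  have hcont : Continuous fun y => ‖iteratedFDeriv ℝ p f y‖ :=
    (hf.continuous_iteratedFDeriv (by exact_mod_cast le_top)).norm
  have hcl : IsClosed {y | ‖iteratedFDeriv ℝ p f y‖ ≤ c} := isClosed_le hcont continuous_const
  have hsub : Metric.ball (0 : E) R ⊆ {y | ‖iteratedFDeriv ℝ p f y‖ ≤ c} := fun y hy =>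
    ContinuousMultilinearMap.opNorm_le_bound hc
      (norm_iteratedFDeriv_apply_le_of_fdiff hf h (by simpa using hy))
  have := closure_minimal hsub hcl
  rw [closure_ball _ hR.ne'] at this
  exact this (by simpa using hx)

omit [NormedSpace ℝ E] in
lemma hasDerivWithinAt_fdiff {p : ℕ} {f : ℝ → E → F} {g : E → F} {S : Set ℝ} {s : ℝ}
    (h : ∀ x, HasDerivWithinAt (fun t => f t x) (g x) S s) (v : Fin p → E) (x : E) :
    HasDerivWithinAt (fun t => fdiff p v (f t) x) (fdiff p v g x) S s := by
  induction p generalizing f g with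
  | zero => exact h x
  | succ p ih => exact ih (fun y => (h _).sub (h y)) _

omit [NormedSpace ℝ E] [NormedSpace ℝ F] in
lemma fdiff_sub {p : ℕ} (f g : E → F) (v : Fin p → E) (x : E) :
    fdiff p v (fun y => f y - g y) x = fdiff p v f x - fdiff p v g x := by
  induction p generalizing f g with
  | zero => rfl
  | succ p ih =>
    simp only [fdiff]
    rw [← ih]
    congr 1; funext y; abel

omit [NormedSpace ℝ E] [NormedSpace ℝ F] in
lemma fdiff_add {p : ℕ} (f g : E → F) (v : Fin p → E) (x : E) :
    fdiff p v (fun y => f y + g y) x = fdiff p v f x + fdiff p v g x := by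
  induction p generalizing f g with
  | zero => rfl
  | succ p ih =>
    simp only [fdiff]
    rw [← ih]
    congr 1; funext y; abel

omit [NormedSpace ℝ E] in
lemma fdiff_clm {G : Type*} [NormedAddCommGroup G] [NormedSpace ℝ G] {p : ℕ} (T : F →L[ℝ] G)
    (f : E → F) (v : Fin p → E) (x : E) :
    fdiff p v (fun y => T (f y)) x = T (fdiff p v f x) := by
  induction p generalizing f with
  | zero => rfl
  | succ p ih =>
    simp only [fdiff]
    rw [← ih]
    congr 1; funext y; simp

omit [NormedSpace ℝ E] in
lemma fdiff_integral {α : Type*} [MeasurableSpace α] {μ : MeasureTheory.Measure α} {p : ℕ}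
    {f : α → E → F} (h : ∀ x, MeasureTheory.Integrable (fun q => f q x) μ)
    (v : Fin p → E) (x : E) :
    fdiff p v (fun y => ∫ q, f q y ∂μ) x = ∫ q, fdiff p v (f q) x ∂μ := by
  induction p generalizing f with
  | zero => rfl
  | succ p ih =>
    simp only [fdiff]
    rw [← ih (f := fun q x => f q (x + v (Fin.last p)) - f q x) (fun y => (h _).sub (h y))]
    congr 1; funext y
    exact (MeasureTheory.integral_sub (h _) (h y)).symm

/-- The integral of the flow in the form of a comparison with a primitive `B` of the majorant, so
that no integrability in the scale has to be checked. -/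
lemma norm_sub_le_of_hasDerivWithinAt {f f' : ℝ → F} {B B' : ℝ → ℝ} {a b : ℝ} (hab : a ≤ b)
    (hf : ∀ s ∈ Set.Icc a b, HasDerivWithinAt f (f' s) (Set.Icc a b) s)
    (hB : ∀ s ∈ Set.Icc a b, HasDerivWithinAt B (B' s) (Set.Icc a b) s)
    (h : ∀ s ∈ Set.Icc a b, ‖f' s‖ ≤ B' s) : ‖f b - f a‖ ≤ B b - B a := by
  have hIci : ∀ s ∈ Set.Ico a b, Set.Icc a b ∈ nhdsWithin s (Set.Ici s) := fun s hs =>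
    Filter.mem_of_superset (Icc_mem_nhdsGE hs.2) (Set.Icc_subset_Icc_left hs.1)
  refine image_norm_le_of_norm_deriv_right_le_deriv_boundary' (f := fun s => f s - f a)
    (f' := f') (B := fun s => B s - B a) (B' := B') (a := a) (b := b) ?_ ?_ (by simp) ?_ ?_ ?_
    (Set.right_mem_Icc.2 hab)
  · exact fun s hs => ((hf s hs).sub_const _).continuousWithinAt
  · exact fun s hs => ((hf s ⟨hs.1, hs.2.le⟩).mono_of_mem_nhdsWithin (hIci s hs)).sub_const _
  · exact fun s hs => ((hB s hs).sub_const _).continuousWithinAt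
  · exact fun s hs => ((hB s ⟨hs.1, hs.2.le⟩).mono_of_mem_nhdsWithin (hIci s hs)).sub_const _
  · exact fun s hs => h s ⟨hs.1, hs.2.le⟩

/-- Integration of a flow equation whose right-hand side is controlled through its finite
differences. -/
lemma norm_iteratedFDeriv_sub_le_of_flow {p : ℕ} {f g : ℝ → E → F} {B B' : ℝ → ℝ} {a b R : ℝ}
    (hab : a ≤ b) (hR : 0 < R) (hfs : ∀ s ∈ Set.Icc a b, ContDiff ℝ ∞ (f s))
    (hf : ∀ s ∈ Set.Icc a b, ∀ x, HasDerivWithinAt (fun t => f t x) (g s x) (Set.Icc a b) s)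
    (hB : ∀ s ∈ Set.Icc a b, HasDerivWithinAt B (B' s) (Set.Icc a b) s)
    (hB' : ∀ s ∈ Set.Icc a b, 0 ≤ B' s)
    (h : ∀ s ∈ Set.Icc a b, ∀ (v : Fin p → E) x, ‖x‖ + ∑ i, ‖v i‖ < R →
      ‖fdiff p v (g s) x‖ ≤ B' s * ∏ i, ‖v i‖) {x : E} (hx : ‖x‖ ≤ R) :
    ‖iteratedFDeriv ℝ p (f b) x - iteratedFDeriv ℝ p (f a) x‖ ≤ B b - B a := by
  have hb := hfs b (Set.right_mem_Icc.2 hab)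
  have ha := hfs a (Set.left_mem_Icc.2 hab)
  have key : ∀ (v : Fin p → E) x, ‖x‖ + ∑ i, ‖v i‖ < R →
      ‖fdiff p v (fun y => f b y - f a y) x‖ ≤ (B b - B a) * ∏ i, ‖v i‖ := by
    intro v x hx
    rw [fdiff_sub, sub_mul]
    exact norm_sub_le_of_hasDerivWithinAt (f := fun s => fdiff p v (f s) x)
      (B := fun s => B s * ∏ i, ‖v i‖) hab
      (fun s hs => hasDerivWithinAt_fdiff (hf s hs) v x)
      (fun s hs => (hB s hs).mul_const _) (fun s hs => h s hs v x hx)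
  have hmono : 0 ≤ B b - B a := by
    refine (norm_nonneg _).trans (norm_sub_le_of_hasDerivWithinAt (f := fun _ => (0 : ℝ))
      (f' := fun _ => 0) hab (fun s _ => hasDerivWithinAt_const _ _ _) hB fun s hs => ?_)
    simpa using hB' s hs
  rw [← iteratedFDeriv_sub_apply (hb.of_le (by exact_mod_cast le_top)).contDiffAt
        (ha.of_le (by exact_mod_cast le_top)).contDiffAt]
  exact norm_iteratedFDeriv_le_of_fdiff (hb.sub ha) hR hmono key hx

end FiniteDifferences

/-! ### Flat functions divided by possibly vanishing denominators -/

/-- Smooth functions supported in `[0, 3]`. -/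
structure IsFlat (χ : ℝ → ℝ) : Prop where
  smooth : ContDiff ℝ ∞ χ
  left : ∀ u ≤ 0, χ u = 0
  right : ∀ u, 3 ≤ u → χ u = 0

namespace IsFlat

variable {χ : ℝ → ℝ}

lemma deriv (h : IsFlat χ) : IsFlat (deriv χ) := by
  have hs : ContDiff ℝ ∞ (_root_.deriv χ) := (contDiff_infty_iff_deriv.1 h.smooth).2
  have hcl : IsClosed {u | _root_.deriv χ u = 0} := isClosed_eq hs.continuous continuous_const
  refine ⟨hs, fun u hu => ?_, fun u hu => ?_⟩
  · have hsub : Set.Iio (0 : ℝ) ⊆ {u | _root_.deriv χ u = 0} := fun u hu => by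
      have : χ =ᶠ[nhds u] fun _ => 0 := by
        filter_upwards [Iio_mem_nhds hu] with y hy using h.left y (le_of_lt hy)
      simpa using this.deriv_eq
    have := closure_minimal hsub hcl
    rw [closure_Iio] at this
    exact this hu
  · have hsub : Set.Ioi (3 : ℝ) ⊆ {u | _root_.deriv χ u = 0} := fun u hu => by
      have : χ =ᶠ[nhds u] fun _ => 0 := by
        filter_upwards [Ioi_mem_nhds hu] with y hy using h.right y (le_of_lt hy)
      simpa using this.deriv_eq
    have := closure_minimal hsub hcl
    rw [closure_Ioi] at this
    exact this hu

lemma exists_bound (h : IsFlat χ) : ∃ C, 0 ≤ C ∧ ∀ u, |χ u| ≤ C := by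
  obtain ⟨C, hC⟩ := (isCompact_Icc (a := (0 : ℝ)) (b := 3)).exists_bound_of_continuousOn
    h.smooth.continuous.continuousOn
  have h0 : 0 ≤ C := (norm_nonneg _).trans (hC 0 (by norm_num))
  refine ⟨C, h0, fun u => ?_⟩
  rcases le_total u 0 with hu | hu
  · simpa [h.left u hu] using h0
  rcases le_total 3 u with hu' | hu'
  · simpa [h.right u hu'] using h0
  · exact hC u ⟨hu, hu'⟩

/-- All derivatives of `χ` are again flat and vanish at `0`, so each integration from `0` gains one
power of `u`. -/
lemma exists_bound_pow (h : IsFlat χ) (m : ℕ) : ∃ C, 0 ≤ C ∧ ∀ u, 0 ≤ u → |χ u| ≤ C * u ^ m := by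
  induction m generalizing χ with
  | zero =>
    obtain ⟨C, h0, hC⟩ := h.exists_bound
    exact ⟨C, h0, fun u _ => by simpa using hC u⟩
  | succ m ih =>
    obtain ⟨C, h0, hC⟩ := ih h.deriv
    refine ⟨C, h0, fun u hu => ?_⟩
    have := (convex_Icc 0 u).norm_image_sub_le_of_norm_deriv_le (f := χ) (C := C * u ^ m)
      (x := 0) (y := u) (fun y _ => (h.smooth.differentiable (by simp)) y)
      (fun y hy => (hC y hy.1).trans
        (mul_le_mul_of_nonneg_left (pow_le_pow_left₀ hy.1 hy.2 m) h0))
      (Set.left_mem_Icc.2 hu) (Set.right_mem_Icc.2 hu)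
    rw [h.left 0 le_rfl, sub_zero, sub_zero, Real.norm_eq_abs, Real.norm_of_nonneg hu] at this
    rw [pow_succ, ← mul_assoc]
    exact this

end IsFlat

/-- `χ(u) / (u + ε)^m`. -/
def flatQuot (χ : ℝ → ℝ) (m : ℕ) (ε u : ℝ) : ℝ := χ u / (u + ε) ^ m

lemma flatQuot_left {χ : ℝ → ℝ} (h : IsFlat χ) (m : ℕ) (ε : ℝ) {u : ℝ} (hu : u ≤ 0) :
    flatQuot χ m ε u = 0 := by simp [flatQuot, h.left u hu]

lemma flatQuot_right {χ : ℝ → ℝ} (h : IsFlat χ) (m : ℕ) (ε : ℝ) {u : ℝ} (hu : 3 ≤ u) :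
    flatQuot χ m ε u = 0 := by simp [flatQuot, h.right u hu]

/-- `χ` is `O(u^(l+m))` and `u + ε ≥ u`, so the denominator costs only `m` powers, with a constant
independent of `ε ≥ 0`. -/
lemma exists_flatQuot_bound_pow {χ : ℝ → ℝ} (h : IsFlat χ) (m l : ℕ) :
    ∃ C, 0 ≤ C ∧ ∀ ε, 0 ≤ ε → ∀ u, |flatQuot χ m ε u| ≤ C * |u| ^ l := by
  obtain ⟨C, h0, hC⟩ := h.exists_bound_pow (l + m)
  refine ⟨C, h0, fun ε hε u => ?_⟩
  rcases le_or_gt u 0 with hu | hu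
  · rw [flatQuot_left h m ε hu, abs_zero]; positivity
  · rw [flatQuot, abs_div, abs_of_pos (by positivity : 0 < (u + ε) ^ m),
      div_le_iff₀ (by positivity), abs_of_pos hu]
    refine (hC u hu.le).trans ?_
    rw [pow_add, ← mul_assoc]
    gcongr
    linarith

lemma hasDerivAt_flatQuot {χ : ℝ → ℝ} (h : IsFlat χ) (m : ℕ) {ε : ℝ} (hε : 0 ≤ ε) (u : ℝ) :
    HasDerivAt (flatQuot χ m ε)
      (flatQuot (deriv χ) m ε u - m * flatQuot χ (m + 1) ε u) u := by
  rcases lt_trichotomy u 0 with hu | hu | hu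
  · rw [flatQuot_left h.deriv m ε hu.le, flatQuot_left h _ ε hu.le]
    refine (hasDerivAt_const u (0 : ℝ)).congr_of_eventuallyEq ?_ |>.congr_deriv (by simp)
    filter_upwards [Iio_mem_nhds hu] with y hy using flatQuot_left h m ε (le_of_lt hy)
  · subst hu
    rw [flatQuot_left h.deriv m ε le_rfl, flatQuot_left h _ ε le_rfl]
    obtain ⟨C, h0, hC⟩ := exists_flatQuot_bound_pow h m 2
    have : HasFDerivAt (flatQuot χ m ε) (0 : ℝ →L[ℝ] ℝ) 0 := by
      -- A function that is `O(y²)` has derivative zero at the origin. This covers `ε = 0`, where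
      -- the quotient rule is not available.
      refine Asymptotics.IsBigO.hasFDerivAt (n := 2) ?_ (by norm_num)
      refine Asymptotics.IsBigO.of_bound C (Filter.Eventually.of_forall fun y => ?_)
      simpa using hC ε hε y
    simpa using this.hasDerivAt
  · have hpos : 0 < u + ε := by linarith
    have h1 : HasDerivAt χ (deriv χ u) u := ((h.smooth.differentiable (by simp)) u).hasDerivAt
    have h2 : HasDerivAt (fun u => (u + ε) ^ m) (m * (u + ε) ^ (m - 1)) u := by
      have := HasDerivAt.fun_pow ((hasDerivAt_id u).add_const ε) m
      simpa using this
    refine (h1.div h2 (by positivity)).congr_deriv ?_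
    simp only [flatQuot]
    rcases m with _ | m
    · simp
    · simp only [Nat.add_sub_cancel]
      field_simp
      ring

/-- The derivative of a flat quotient is a combination of two flat quotients, so induction on `j`
over all `χ` and `m` closes. The constant precedes `ε`: this is the uniformity in the masses. -/
lemma exists_flatQuot_bound {χ : ℝ → ℝ} (h : IsFlat χ) (m j : ℕ) :
    ∃ C, ∀ ε, 0 ≤ ε → ContDiff ℝ j (flatQuot χ m ε) ∧
      ∀ u, |iteratedDeriv j (flatQuot χ m ε) u| ≤ C := by
  induction j generalizing χ m with
  | zero =>
    obtain ⟨C, h0, hC⟩ := exists_flatQuot_bound_pow h m 0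
    refine ⟨C, fun ε hε => ⟨?_, fun u => by simpa using hC ε hε u⟩⟩
    exact contDiff_zero.2
      (continuous_iff_continuousAt.2 fun u => (hasDerivAt_flatQuot h m hε u).continuousAt)
  | succ j ih =>
    obtain ⟨C₁, h₁⟩ := ih h.deriv m
    obtain ⟨C₂, h₂⟩ := ih h (m + 1)
    refine ⟨C₁ + m * C₂, fun ε hε => ?_⟩
    have e : deriv (flatQuot χ m ε)
        = fun u => flatQuot (deriv χ) m ε u - m * flatQuot χ (m + 1) ε u :=
      funext fun u => (hasDerivAt_flatQuot h m hε u).deriv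
    have c1 := (h₁ ε hε).1
    have c2 : ContDiff ℝ j fun u => (m : ℝ) * flatQuot χ (m + 1) ε u :=
      contDiff_const.mul (h₂ ε hε).1
    constructor
    · push_cast
      refine contDiff_succ_iff_deriv.2 ⟨fun u => (hasDerivAt_flatQuot h m hε u).differentiableAt,
        by simp, ?_⟩
      rw [e]
      exact c1.sub c2
    · intro u
      rw [iteratedDeriv_succ', e, iteratedDeriv_fun_sub c1.contDiffAt c2.contDiffAt,
        iteratedDeriv_const_mul_field]
      refine (abs_sub _ _).trans (add_le_add ((h₁ ε hε).2 u) ?_)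
      rw [abs_mul, Nat.abs_cast]
      exact mul_le_mul_of_nonneg_left ((h₂ ε hε).2 u) (Nat.cast_nonneg m)

/-! ### The single-scale propagator and its uniform bounds -/

/-- The radial profile of the scale derivative of the cutoff. -/
def cutoffProfile (K : ℝ → ℝ) (u : ℝ) : ℝ := if u ≤ 0 then 0 else -2 * (1 + u) * deriv K (1 + u)

namespace IsCutoff

variable {K : ℝ → ℝ}

lemma deriv_eq_zero_left (hK : IsCutoff K) {z : ℝ} (h0 : 0 ≤ z) (h1 : z ≤ 1) :
    deriv K z = 0 := by
  have hcl : IsClosed {u | deriv K u = 0} :=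
    isClosed_eq (contDiff_infty_iff_deriv.1 hK.smooth).2.continuous continuous_const
  have hsub : Set.Ioo (0 : ℝ) 1 ⊆ {u | deriv K u = 0} := fun u hu => by
    have : K =ᶠ[nhds u] fun _ => 1 := by
      filter_upwards [Ioo_mem_nhds hu.1 hu.2] with y hy using hK.eq_one y hy.1.le hy.2.le
    simpa using this.deriv_eq
  have := closure_minimal hsub hcl
  rw [closure_Ioo zero_ne_one] at this
  exact this ⟨h0, h1⟩

lemma deriv_eq_zero_right (hK : IsCutoff K) {z : ℝ} (h : 4 ≤ z) : deriv K z = 0 := by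
  have hcl : IsClosed {u | deriv K u = 0} :=
    isClosed_eq (contDiff_infty_iff_deriv.1 hK.smooth).2.continuous continuous_const
  have hsub : Set.Ioi (4 : ℝ) ⊆ {u | deriv K u = 0} := fun u hu => by
    have : K =ᶠ[nhds u] fun _ => 0 := by
      filter_upwards [Ioi_mem_nhds hu] with y hy using hK.eq_zero y (le_of_lt hy)
    simpa using this.deriv_eq
  have := closure_minimal hsub hcl
  rw [closure_Ioi] at this
  exact this h

/-- The truncation in `cutoffProfile` changes nothing for `u = z - 1` with `z ≥ 0`, because `K' = 0`
on `[0, 1]`. It is needed for flatness, as `K` is unconstrained at negative arguments. -/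
lemma profile_eq (hK : IsCutoff K) {u : ℝ} (hu : -1 ≤ u) :
    cutoffProfile K u = -2 * (1 + u) * deriv K (1 + u) := by
  unfold cutoffProfile
  split_ifs with h
  · rw [hK.deriv_eq_zero_left (by linarith) (by linarith), mul_zero]
  · rfl

lemma isFlat (hK : IsCutoff K) : IsFlat (cutoffProfile K) := by
  refine ⟨contDiff_iff_contDiffAt.2 fun u => ?_, fun u hu => if_pos hu, fun u hu => ?_⟩
  · rcases lt_or_ge u 0 with hu | hu
    · refine (contDiffAt_const (c := (0 : ℝ))).congr_of_eventuallyEq ?_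
      filter_upwards [Iio_mem_nhds hu] with y hy using if_pos (le_of_lt hy)
    · have hd : ContDiff ℝ ∞ (deriv K) := (contDiff_infty_iff_deriv.1 hK.smooth).2
      have : ContDiff ℝ ∞ fun u => -2 * (1 + u) * deriv K (1 + u) :=
        (contDiff_const.mul (contDiff_const.add contDiff_id)).mul
          (hd.comp (contDiff_const.add contDiff_id))
      refine this.contDiffAt.congr_of_eventuallyEq ?_
      filter_upwards [Ioi_mem_nhds (show (-1 : ℝ) < u by linarith)] with y hy
        using hK.profile_eq (le_of_lt hy)
  · rw [hK.profile_eq (by linarith), hK.deriv_eq_zero_right (by linarith), mul_zero]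

end IsCutoff

/-- The dimensionless single-scale propagator. -/
def radialQuot (χ : ℝ → ℝ) (ε : ℝ) (x : E4) : ℝ := flatQuot χ 1 ε (‖x‖ ^ 2 - 1)

lemma contDiff_radialQuot {χ : ℝ → ℝ} (h : IsFlat χ) {ε : ℝ} (hε : 0 ≤ ε) :
    ContDiff ℝ ∞ (radialQuot χ ε) := by
  have h1 : ContDiff ℝ ∞ (flatQuot χ 1 ε) := contDiff_infty.2 fun j =>
    ((exists_flatQuot_bound h 1 j).choose_spec ε hε).1
  exact h1.comp ((contDiff_norm_sq ℝ).sub contDiff_const)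

lemma radialQuot_eq_zero {χ : ℝ → ℝ} (h : IsFlat χ) (ε : ℝ) {x : E4} (hx : 2 ≤ ‖x‖) :
    radialQuot χ ε x = 0 := flatQuot_right h _ _ (by nlinarith)

/-- Faà di Bruno's bound for the composition with `‖x‖² - 1`, whose derivatives are bounded on the
ball of radius `2` by compactness; outside, the function vanishes identically. -/
lemma exists_radialQuot_bound {χ : ℝ → ℝ} (h : IsFlat χ) (p : ℕ) :
    ∃ C, 0 ≤ C ∧ ∀ ε, 0 ≤ ε → ∀ x, ‖iteratedFDeriv ℝ p (radialQuot χ ε) x‖ ≤ C := by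
  choose C hC using exists_flatQuot_bound h 1
  have hN : ContDiff ℝ ∞ fun x : E4 => ‖x‖ ^ 2 - 1 := (contDiff_norm_sq ℝ).sub contDiff_const
  have hM : ∀ i, ∃ M, ∀ x ∈ Metric.closedBall (0 : E4) 2,
      ‖iteratedFDeriv ℝ i (fun x : E4 => ‖x‖ ^ 2 - 1) x‖ ≤ M := fun i =>
    (isCompact_closedBall (0 : E4) 2).exists_bound_of_continuousOn
      (hN.continuous_iteratedFDeriv (by exact_mod_cast le_top)).continuousOn
  choose M hM using hM
  have hM0 : ∀ i, 0 ≤ M i := fun i => (norm_nonneg _).trans (hM i 0 (by simp))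
  have hC0 : ∀ i, 0 ≤ C i := fun i => (abs_nonneg _).trans ((hC i 0 le_rfl).2 0)
  set D : ℝ := 1 + ∑ i ∈ Finset.range (p + 1), M i
  set C' : ℝ := ∑ i ∈ Finset.range (p + 1), C i
  have hD : 1 ≤ D := by
    have := Finset.sum_nonneg (s := Finset.range (p + 1)) fun i _ => hM0 i
    linarith
  have hC' : 0 ≤ C' := Finset.sum_nonneg fun i _ => hC0 i
  refine ⟨p.factorial * C' * D ^ p, by positivity, fun ε hε x => ?_⟩
  rcases le_or_gt ‖x‖ 2 with hx | hx
  · have hsm : ContDiff ℝ ∞ (flatQuot χ 1 ε) := contDiff_infty.2 fun j => (hC j ε hε).1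
    refine norm_iteratedFDeriv_comp_le hsm hN (by exact_mod_cast le_top) x (fun i hi => ?_)
      (fun i h1 hi => ?_)
    · rw [norm_iteratedFDeriv_eq_norm_iteratedDeriv]
      exact ((hC i ε hε).2 _).trans
        (Finset.single_le_sum (fun i _ => hC0 i) (Finset.mem_range.2 (by omega)))
    -- The composition bound wants the `i`-th derivative below `D ^ i`; as `D ≥ 1` and `i ≥ 1`, it
    -- suffices that `D` dominates every `M i`.
    · refine (hM i x (by simpa using hx)).trans ?_
      refine le_trans ?_ (le_self_pow₀ hD (by omega))
      have := Finset.single_le_sum (f := M) (fun i _ => hM0 i)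
        (Finset.mem_range.2 (by omega : i < p + 1))
      linarith
  · have hev : radialQuot χ ε =ᶠ[nhds x] fun _ => 0 := by
      filter_upwards [(isOpen_lt continuous_const continuous_norm).mem_nhds hx] with y hy
        using radialQuot_eq_zero h ε (le_of_lt hy)
    rw [(hev.iteratedFDeriv ℝ p).eq_of_nhds]
    have : iteratedFDeriv ℝ p (fun _ : E4 => (0 : ℝ)) x = 0 := by
      simp
    rw [this, norm_zero]
    positivity

/-- Tensor structure of the propagators, with the weight of the contraction. -/
def propTensor : FieldIndex → FieldIndex → ℝ
  | .inl (μ, ν), .inl (ρ, σ) => 1 / 4 * (kd μ ρ * kd ν σ + kd μ σ * kd ν ρ - kd μ ν * kd ρ σ)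
  | .inr (.inr μ), .inr (.inl ν) => -kd μ ν
  | _, _ => 0

/-- The mass term in the propagator of a field. -/
def massTerm (B₁ B₂ : ℝ) : FieldIndex → ℝ
  | .inl _ => B₁
  | .inr _ => B₂

lemma abs_kd_le (μ ν : Fin 4) : |kd μ ν| ≤ 1 := by unfold kd; split_ifs <;> simp

lemma abs_propTensor_le (b c : FieldIndex) : |propTensor b c| ≤ 1 := by
  rcases b with ⟨μ, ν⟩ | μ | μ <;> rcases c with ⟨ρ, σ⟩ | ρ | ρ <;>
    simp only [propTensor, abs_zero, zero_le_one, abs_neg, abs_kd_le]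
  simp only [kd]
  split_ifs <;> norm_num

/-- With `z = k²/Λ²` and `u = z - 1`, the chain rule gives `Λ⁻¹ (-2 z K'(z))`, and the denominator
is `Λ² (u + ε)` with `ε = 1 + B/Λ²`. Hence the power `Λ⁻³` and a dimensionless profile. -/
lemma deriv_cutoff {K : ℝ → ℝ} (hK : IsCutoff K) {Λ : ℝ} (hΛ : 0 < Λ) (B : ℝ) (k : E4) (t : ℝ) :
    deriv (fun s => K (‖k‖ ^ 2 / s ^ 2)) Λ * (t / (‖k‖ ^ 2 + B))
      = t * ((Λ ^ 3)⁻¹ * radialQuot (cutoffProfile K) (1 + B / Λ ^ 2) (Λ⁻¹ • k)) := by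
  have h1 : HasDerivAt (fun s : ℝ => ‖k‖ ^ 2 / s ^ 2) (-2 * ‖k‖ ^ 2 / Λ ^ 3) Λ := by
    have := ((hasDerivAt_pow 2 Λ).inv (by positivity)).const_mul (‖k‖ ^ 2)
    refine (this.congr_deriv ?_)
    push_cast
    rw [pow_one]
    field_simp
  have h2 : HasDerivAt K (deriv K (‖k‖ ^ 2 / Λ ^ 2)) (‖k‖ ^ 2 / Λ ^ 2) :=
    ((hK.smooth.differentiable (by simp)) _).hasDerivAt
  rw [show (fun s => K (‖k‖ ^ 2 / s ^ 2)) = K ∘ fun s : ℝ => ‖k‖ ^ 2 / s ^ 2 from rfl,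
    (h2.comp Λ h1).deriv, radialQuot, flatQuot, norm_smul, norm_inv, Real.norm_of_nonneg hΛ.le,
    hK.profile_eq (by nlinarith [sq_nonneg (Λ⁻¹ * ‖k‖)])]
  have e1 : (Λ⁻¹ * ‖k‖) ^ 2 = ‖k‖ ^ 2 / Λ ^ 2 := by field_simp
  rw [e1, pow_one, show (1 : ℝ) + (‖k‖ ^ 2 / Λ ^ 2 - 1) = ‖k‖ ^ 2 / Λ ^ 2 by ring,
    show ‖k‖ ^ 2 / Λ ^ 2 - 1 + (1 + B / Λ ^ 2) = (‖k‖ ^ 2 + B) / Λ ^ 2 by field_simp; ring]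
  -- On the sphere where the denominator vanishes both sides are zero by the convention for division
  -- by zero.
  rcases eq_or_ne (‖k‖ ^ 2 + B) 0 with h0 | h0
  · simp [h0]
  · field_simp

lemma propagatorDot_eq {K : ℝ → ℝ} (hK : IsCutoff K) {Λ : ℝ} (hΛ : 0 < Λ) (B₁ B₂ : ℝ) (k : E4)
    (b c : FieldIndex) :
    propagatorDot K B₁ B₂ Λ k b c = propTensor b c *
      ((Λ ^ 3)⁻¹ * radialQuot (cutoffProfile K) (1 + massTerm B₁ B₂ b / Λ ^ 2) (Λ⁻¹ • k)) := by
  unfold propagatorDot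
  rcases b with ⟨μ, ν⟩ | μ | μ <;> rcases c with ⟨ρ, σ⟩ | ρ | ρ <;>
    simp only [propagator, propTensor, weight, deriv_const, mul_zero, zero_mul, massTerm]
  · rw [deriv_mul_const_field, deriv_const_mul_field, mul_assoc (1 / 2 : ℝ), deriv_cutoff hK hΛ]
    ring
  · rw [deriv_mul_const_field, deriv.fun_neg, neg_mul, deriv_cutoff hK hΛ]
    ring

lemma propagatorDot_eq_zero {K : ℝ → ℝ} (hK : IsCutoff K) {Λ : ℝ} (hΛ : 0 < Λ) (B₁ B₂ : ℝ)
    {k : E4} (hk : 2 * Λ ≤ ‖k‖) (b c : FieldIndex) : propagatorDot K B₁ B₂ Λ k b c = 0 := by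
  rw [propagatorDot_eq hK hΛ, radialQuot_eq_zero hK.isFlat, mul_zero, mul_zero]
  rw [norm_smul, norm_inv, Real.norm_of_nonneg hΛ.le, le_inv_mul_iff₀ hΛ]
  linarith

lemma propagatorDot_zero {K : ℝ → ℝ} (hK : IsCutoff K) {Λ : ℝ} (hΛ : 0 < Λ) (B₁ B₂ : ℝ)
    (b c : FieldIndex) : propagatorDot K B₁ B₂ Λ 0 b c = 0 := by
  rw [propagatorDot_eq hK hΛ, radialQuot, flatQuot_left hK.isFlat, mul_zero, mul_zero]
  simp

lemma mass_shift_nonneg {Λ B : ℝ} (hΛ : 0 < Λ) (hB : |B| ≤ Λ ^ 2) : 0 ≤ 1 + B / Λ ^ 2 := by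
  have : -1 ≤ B / Λ ^ 2 := by
    rw [le_div_iff₀ (by positivity)]
    linarith [neg_abs_le B]
  linarith

lemma contDiff_propagatorDot {K : ℝ → ℝ} (hK : IsCutoff K) {Λ B₁ B₂ : ℝ} (hΛ : 0 < Λ)
    (h₁ : |B₁| ≤ Λ ^ 2) (h₂ : |B₂| ≤ Λ ^ 2) (b c : FieldIndex) :
    ContDiff ℝ ∞ fun k => (propagatorDot K B₁ B₂ Λ k b c : ℂ) := by
  have hm : 0 ≤ 1 + massTerm B₁ B₂ b / Λ ^ 2 := by
    rcases b with b | b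
    exacts [mass_shift_nonneg hΛ h₁, mass_shift_nonneg hΛ h₂]
  refine Complex.ofRealCLM.contDiff.comp ?_
  change ContDiff ℝ ∞ fun k => propagatorDot K B₁ B₂ Λ k b c
  simp only [propagatorDot_eq hK hΛ]
  exact contDiff_const.mul (contDiff_const.mul
    ((contDiff_radialQuot hK.isFlat hm).comp (contDiff_const_smul _)))

/-- Scaling `k = Λ x` reduces the claim to `exists_radialQuot_bound`; each derivative contributes
`Λ⁻¹`, and the masses enter only through a shift `ε ≥ 0`. -/
lemma exists_propagatorDot_bound {K : ℝ → ℝ} (hK : IsCutoff K) (p : ℕ) :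
    ∃ C, 0 ≤ C ∧ ∀ Λ B₁ B₂ : ℝ, 0 < Λ → |B₁| ≤ Λ ^ 2 → |B₂| ≤ Λ ^ 2 → ∀ b c k,
      ‖iteratedFDeriv ℝ p (fun k => (propagatorDot K B₁ B₂ Λ k b c : ℂ)) k‖
        ≤ C * Λ ^ (-3 - p : ℤ) := by
  obtain ⟨C, h0, hC⟩ := exists_radialQuot_bound hK.isFlat p
  refine ⟨C, h0, fun Λ B₁ B₂ hΛ h₁ h₂ b c k => ?_⟩
  have hm : 0 ≤ 1 + massTerm B₁ B₂ b / Λ ^ 2 := by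
    rcases b with b | b
    exacts [mass_shift_nonneg hΛ h₁, mass_shift_nonneg hΛ h₂]
  set ε := 1 + massTerm B₁ B₂ b / Λ ^ 2
  have hsm := contDiff_radialQuot hK.isFlat hm
  let T : E4 →L[ℝ] E4 := Λ⁻¹ • ContinuousLinearMap.id ℝ E4
  have e : (fun k => (propagatorDot K B₁ B₂ Λ k b c : ℂ))
      = (((propTensor b c * (Λ ^ 3)⁻¹ : ℝ)) • Complex.ofRealCLM) ∘
        (radialQuot (cutoffProfile K) ε ∘ T) := by
    funext k
    simp only [propagatorDot_eq hK hΛ, Function.comp, smul_apply, T,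
      ContinuousLinearMap.id_apply, Complex.ofRealCLM_apply, Complex.real_smul]
    push_cast
    ring
  rw [e, ContinuousLinearMap.iteratedFDeriv_comp_left _ (i := p) (n := ∞)
    (hsm.comp T.contDiff).contDiffAt (by exact_mod_cast le_top),
    ContinuousLinearMap.iteratedFDeriv_comp_right T hsm k (i := p) (by exact_mod_cast le_top)]
  refine (ContinuousLinearMap.norm_compContinuousMultilinearMap_le _ _).trans ?_
  have n1 : ‖((propTensor b c * (Λ ^ 3)⁻¹ : ℝ)) • Complex.ofRealCLM‖ ≤ (Λ ^ 3)⁻¹ := by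
    rw [norm_smul, Complex.ofRealCLM_norm, mul_one, Real.norm_eq_abs, abs_mul,
      abs_of_pos (show 0 < (Λ ^ 3)⁻¹ by positivity)]
    exact mul_le_of_le_one_left (by positivity) (abs_propTensor_le b c)
  have n2 : ‖T‖ ≤ Λ⁻¹ := by
    refine (norm_smul_le (Λ⁻¹) (ContinuousLinearMap.id ℝ E4)).trans ?_
    rw [norm_inv, Real.norm_of_nonneg hΛ.le]
    exact mul_le_of_le_one_right (by positivity) ContinuousLinearMap.norm_id_le
  have n3 : ‖(iteratedFDeriv ℝ p (radialQuot (cutoffProfile K) ε) (T k)).compContinuousLinearMap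
      fun _ => T‖ ≤ C * Λ⁻¹ ^ p := by
    refine (ContinuousMultilinearMap.norm_compContinuousLinearMap_le _ _).trans ?_
    rw [Finset.prod_const, Finset.card_univ, Fintype.card_fin]
    gcongr
    exact hC ε hm _
  calc _ ≤ (Λ ^ 3)⁻¹ * (C * Λ⁻¹ ^ p) := by gcongr
    _ = C * Λ ^ (-3 - p : ℤ) := by
      rw [zpow_sub₀ hΛ.ne', zpow_neg]
      norm_cast
      rw [inv_pow]
      field_simp

/-! ### Conserved momenta, internal lines and loops -/

lemma norm_momenta_le_iff {n : ℕ} {k : Momenta n} {R : ℝ} (hR : 0 ≤ R) :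
    ‖k‖ ≤ R ↔ ∀ i, ‖k.1 i‖ ≤ R := pi_norm_le_iff_of_nonneg hR

lemma norm_apply_le {n : ℕ} (k : Momenta n) (i : Fin n) : ‖k.1 i‖ ≤ ‖k‖ :=
  (norm_momenta_le_iff (norm_nonneg k)).1 le_rfl i

lemma norm_momenta_le_iff_sq {n : ℕ} {k : Momenta n} {Λ : ℝ} (hΛ : 0 ≤ Λ) :
    ‖k‖ ≤ 2 * Λ ↔ ∀ i, ‖k.1 i‖ ^ 2 ≤ 4 * Λ ^ 2 := by
  rw [norm_momenta_le_iff (by positivity)]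
  refine forall_congr' fun i => ?_
  rw [← pow_le_pow_iff_left₀ (norm_nonneg _) (by positivity) two_ne_zero]
  ring_nf

lemma norm_direction_le {n : ℕ} (v : Fin 4 × Fin n × Fin n) : ‖direction v‖ ≤ 2 := by
  rw [norm_momenta_le_iff (by norm_num)]
  intro i
  have h : ∀ j : Fin n, ‖(Pi.single j (EuclideanSpace.single v.1 (1 : ℝ)) : Fin n → E4) i‖ ≤ 1 := by
    intro j
    rcases eq_or_ne i j with rfl | hij
    · simp
    · simp [Pi.single_eq_of_ne hij]
  exact (norm_sub_le _ _).trans (by linarith [h v.2.1, h v.2.2])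

/-- The contributions of the reference leg `o` add up to minus the total momentum, which is zero. -/
lemma momenta_eq_sum_direction {n : ℕ} (o : Fin n) (k : Momenta n) :
    k = ∑ x : Fin 4 × Fin n, k.1 x.2 x.1 • direction (x.1, x.2, o) := by
  apply Subtype.ext
  have h0 : ∑ x : Fin 4 × Fin n, k.1 x.2 x.1 •
      (Pi.single o (EuclideanSpace.single x.1 (1 : ℝ)) : Fin n → E4) = 0 := by
    rw [Fintype.sum_prod_type]
    simp only [← Finset.sum_smul]
    refine Finset.sum_eq_zero fun μ _ => ?_
    have : ∑ i, k.1 i μ = 0 := by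
      have h := congrArg (fun w : E4 => w μ) k.2
      simpa using h
    rw [this, zero_smul]
  have h1 : ∑ x : Fin 4 × Fin n, k.1 x.2 x.1 •
      (Pi.single x.2 (EuclideanSpace.single x.1 (1 : ℝ)) : Fin n → E4) = k.1 := by
    funext i
    ext μ
    rw [Fintype.sum_prod_type]
    simp only [Finset.sum_apply, Pi.smul_apply, WithLp.ofLp_sum, WithLp.ofLp_smul, smul_eq_mul,
      Pi.single_apply, apply_ite WithLp.ofLp, ite_apply, mul_ite]
    simp
  rw [AddSubmonoidClass.coe_finsetSum]
  simp only [Submodule.coe_smul, direction, smul_sub, Finset.sum_sub_distrib]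
  rw [h0, h1, sub_zero]

/-- The norms of the theorem test only the directions `∂_i - ∂_j`. Those with `j = o` span the
momentum space, so the full operator norm is controlled; expansion gives `4n` terms in each slot. -/
lemma norm_le_of_directions {n p : ℕ} (o : Fin n) (m : ContinuousMultilinearMap ℝ
    (fun _ : Fin p => Momenta n) ℂ) {c : ℝ}
    (h : ∀ v : Fin p → Fin 4 × Fin n × Fin n, ‖m fun q => direction (v q)‖ ≤ c) :
    ‖m‖ ≤ (4 * n) ^ p * c := by
  have hc : 0 ≤ c := (norm_nonneg _).trans (h fun _ => (0, o, o))
  refine ContinuousMultilinearMap.opNorm_le_bound (by positivity) fun w => ?_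
  have e : m w = ∑ r : Fin p → Fin 4 × Fin n, (∏ q, (w q).1 (r q).2 (r q).1) •
      m fun q => direction ((r q).1, (r q).2, o) := by
    conv_lhs => rw [show w = fun q => ∑ x : Fin 4 × Fin n, (w q).1 x.2 x.1 •
      direction (x.1, x.2, o) from funext fun q => momenta_eq_sum_direction o (w q)]
    rw [m.map_sum]
    exact Finset.sum_congr rfl fun r _ => m.map_smul_univ _ _
  rw [e]
  refine (norm_sum_le _ _).trans ?_
  calc _ ≤ ∑ r : Fin p → Fin 4 × Fin n, (∏ q, ‖w q‖) * c := by
        refine Finset.sum_le_sum fun r _ => ?_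
        rw [norm_smul, norm_prod]
        gcongr with q
        · exact (PiLp.norm_apply_le _ _).trans (norm_apply_le _ _)
        · exact h _
    _ = _ := by
        simp [mul_assoc, mul_comm, mul_left_comm]

/-- `attach` as a continuous linear map. -/
def attachL (m : ℕ) : (Fin m → E4) →L[ℝ] Momenta (m + 1) :=
  LinearMap.toContinuousLinearMap
    { toFun := attach
      map_add' := fun q q' => by
        apply Subtype.ext
        funext i
        refine Fin.lastCases ?_ (fun i => ?_) i
        · simp [attach, Finset.sum_add_distrib, add_comm]
        · simp [attach]
      map_smul' := fun c q => by
        apply Subtype.ext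
        funext i
        refine Fin.lastCases ?_ (fun i => ?_) i
        · simp [attach, Finset.smul_sum]
        · simp [attach] }

@[simp] lemma attachL_apply {m : ℕ} (q : Fin m → E4) : attachL m q = attach q := rfl

lemma norm_attach_le {m : ℕ} {q : Fin m → E4} {R : ℝ} (hR : 0 ≤ R) (h : ∀ i, ‖q i‖ ≤ R)
    (hs : ‖∑ i, q i‖ ≤ R) : ‖attach q‖ ≤ R := by
  rw [norm_momenta_le_iff hR]
  intro i
  refine Fin.lastCases ?_ (fun i => ?_) i
  · simpa [attach] using hs
  · simpa [attach] using h i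

lemma sum_sublegs {n : ℕ} (S : Finset (Fin n)) (k : Fin n → E4) :
    ∑ i, sublegs S k i = ∑ i ∈ S, k i := by
  have h := Finset.sum_map Finset.univ (S.orderEmbOfFin rfl).toEmbedding k
  rw [Finset.map_orderEmbOfFin_univ] at h
  exact h.symm

/-- The momenta on one side of an internal line, as a linear function of all momenta. -/
def subMomenta {n : ℕ} (S : Finset (Fin n)) : Momenta n →L[ℝ] Momenta (S.card + 1) :=
  (attachL S.card).comp ((ContinuousLinearMap.pi fun i =>
    ContinuousLinearMap.proj (S.orderEmbOfFin rfl i)).comp (Momenta n).subtypeL)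

@[simp] lemma subMomenta_apply {n : ℕ} (S : Finset (Fin n)) (k : Momenta n) :
    subMomenta S k = attach (sublegs S k.1) := rfl

lemma norm_sum_le_card {n : ℕ} (S : Finset (Fin n)) (k : Momenta n) :
    ‖∑ i ∈ S, k.1 i‖ ≤ n * ‖k‖ := by
  refine (norm_sum_le _ _).trans ?_
  refine (Finset.sum_le_card_nsmul S _ ‖k‖ fun i _ => norm_apply_le k i).trans ?_
  rw [nsmul_eq_mul]
  gcongr
  exact_mod_cast (Finset.card_le_univ S).trans (by simp)

lemma norm_subMomenta_le {n : ℕ} (S : Finset (Fin n)) : ‖subMomenta S‖ ≤ n + 1 := by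
  refine ContinuousLinearMap.opNorm_le_bound _ (by positivity) fun k => ?_
  rw [subMomenta_apply]
  refine norm_attach_le (by positivity) (fun i => ?_) ?_
  · refine (norm_apply_le k _).trans ?_
    nlinarith [norm_nonneg k, (Nat.cast_nonneg n : (0 : ℝ) ≤ n)]
  · rw [sum_sublegs]
    refine (norm_sum_le_card S k).trans ?_
    nlinarith [norm_nonneg k]

/-- This makes the region `‖k‖ ≤ R` stable under cutting a line: the only new momentum at a
subvertex is that of the cut line, which the propagator confines. -/
lemma norm_attach_sublegs_le {n : ℕ} (S : Finset (Fin n)) {k : Momenta n} {R : ℝ}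
    (hk : ‖k‖ ≤ R) (hs : ‖∑ i ∈ S, k.1 i‖ ≤ R) : ‖attach (sublegs S k.1)‖ ≤ R :=
  norm_attach_le ((norm_nonneg _).trans hk) (fun _ => (norm_apply_le k _).trans hk)
    (by rwa [sum_sublegs])

lemma sum_compl_eq_neg {n : ℕ} (S : Finset (Fin n)) (k : Momenta n) :
    ∑ i ∈ Sᶜ, k.1 i = -∑ i ∈ S, k.1 i := by
  rw [eq_neg_iff_add_eq_zero, Finset.sum_compl_add_sum]
  exact k.2

/-- The momentum of an internal line. -/
def lineMomentum {n : ℕ} (S : Finset (Fin n)) : Momenta n →L[ℝ] E4 :=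
  (∑ i ∈ S, ContinuousLinearMap.proj i).comp (Momenta n).subtypeL

@[simp] lemma lineMomentum_apply {n : ℕ} (S : Finset (Fin n)) (k : Momenta n) :
    lineMomentum S k = ∑ i ∈ S, k.1 i := by
  simp [lineMomentum]

lemma norm_lineMomentum_le {n : ℕ} (S : Finset (Fin n)) : ‖lineMomentum S‖ ≤ n + 1 := by
  refine ContinuousLinearMap.opNorm_le_bound _ (by positivity) fun k => ?_
  rw [lineMomentum_apply]
  refine (norm_sum_le_card S k).trans ?_
  nlinarith [norm_nonneg k]

/-- The momenta at a vertex with a loop at vanishing loop momentum. -/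
def loopMomenta (n : ℕ) : Momenta n →L[ℝ] Momenta (n + 2) :=
  (attachL (n + 1)).comp ((LinearMap.toContinuousLinearMap
    { toFun := fun k : Fin n → E4 => (Fin.snoc (α := fun _ => E4) k 0 : Fin (n + 1) → E4)
      map_add' := fun q q' => by
        funext i
        refine Fin.lastCases ?_ (fun i => ?_) i <;> simp
      map_smul' := fun c q => by
        funext i
        refine Fin.lastCases ?_ (fun i => ?_) i <;> simp }).comp (Momenta n).subtypeL)

lemma loopMomenta_apply {n : ℕ} (k : Momenta n) :
    loopMomenta n k = attach (Fin.snoc (α := fun _ => E4) k.1 0) := rfl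

/-- The dependence on `k` at fixed loop momentum is linear up to a translation, so `k`-derivatives
of the integrand are derivatives of the vertex. -/
lemma attach_snoc_eq {n : ℕ} (k : Momenta n) (q : E4) :
    attach (Fin.snoc (α := fun _ => E4) k.1 q)
      = loopMomenta n k + attach (Fin.snoc (α := fun _ => E4) 0 q) := by
  rw [loopMomenta_apply, ← attachL_apply, ← attachL_apply, ← attachL_apply, ← map_add]
  congr 1
  funext i
  refine Fin.lastCases ?_ (fun i => ?_) i <;> simp

/-- By momentum conservation the legs carry `(k, q, -q)`. -/
lemma norm_attach_snoc_le {n : ℕ} {k : Momenta n} {q : E4} {R : ℝ} (hk : ‖k‖ ≤ R)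
    (hq : ‖q‖ ≤ R) : ‖attach (Fin.snoc (α := fun _ => E4) k.1 q)‖ ≤ R := by
  refine norm_attach_le ((norm_nonneg _).trans hk) (fun i => ?_) ?_
  · refine Fin.lastCases ?_ (fun i => ?_) i
    · simpa using hq
    · simpa using (norm_apply_le k i).trans hk
  · rw [Fin.sum_univ_castSucc]
    have : ∑ i, k.1 i = 0 := k.2
    simpa [this] using hq

lemma norm_loopMomenta_le (n : ℕ) : ‖loopMomenta n‖ ≤ 1 := by
  refine ContinuousLinearMap.opNorm_le_bound _ zero_le_one fun k => ?_
  rw [one_mul, loopMomenta_apply]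
  exact norm_attach_snoc_le le_rfl (by simp)

lemma continuous_attach_snoc {n : ℕ} (k : Momenta n) :
    Continuous fun q : E4 => attach (Fin.snoc (α := fun _ => E4) k.1 q) := by
  refine (attachL (n + 1)).continuous.comp (continuous_pi fun i => ?_)
  refine Fin.lastCases ?_ (fun i => ?_) i
  · simpa using continuous_id'
  · simpa using continuous_const

/-! ### Consequences of the symmetries at zero momentum -/

lemma entry_neg (μ ν : Fin 4) :
    entry (LinearIsometryEquiv.neg ℝ) μ ν = -(if μ = ν then 1 else 0) := by
  simp [entry]

lemma rep_neg (a b : FieldIndex) :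
    rep (LinearIsometryEquiv.neg ℝ) a b = if a = b then (-1) ^ parity a else 0 := by
  rcases a with ⟨μ, ν⟩ | μ | μ <;> rcases b with ⟨ρ, σ⟩ | ρ | ρ <;>
    simp [rep, entry_neg, parity]
  all_goals split_ifs <;> simp_all

lemma even_sum_parity {n : ℕ} {a : Fin n → FieldIndex} (h : ∑ i, ghostNumber (a i) = 0) :
    Even (∑ i, parity (a i)) := by
  have h1 : ∀ x : FieldIndex, ((parity x : ℕ) : ZMod 2) = ((ghostNumber x : ℤ) : ZMod 2) := by
    rintro (x | x | x) <;> simp [parity, ghostNumber]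
  rw [← ZMod.natCast_eq_zero_iff_even]
  have := congrArg (Int.cast : ℤ → ZMod 2) h
  push_cast at this ⊢
  simpa [h1] using this

/-- The element `-1` of `O(4)` acts trivially on gravitons, which have two indices, and by a sign on
each ghost or antighost. Ghost number zero makes the number of these signs even. -/
lemma IsVertex.apply_neg {n : ℕ} {F : (Fin n → FieldIndex) → Momenta n → ℂ} (hF : IsVertex F)
    (a : Fin n → FieldIndex) (k : Momenta n) : F a (-k) = F a k := by
  by_cases hg : ∑ i, ghostNumber (a i) = 0
  · have h := hF.covariant (LinearIsometryEquiv.neg ℝ) a k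
    have e : rotate (LinearIsometryEquiv.neg ℝ) k = -k := by
      apply Subtype.ext; funext i; simp [rotate]
    rw [e, Finset.sum_eq_single a] at h
    · rw [h]
      simp only [rep_neg, if_true]
      rw [Finset.prod_pow_eq_pow_sum, (even_sum_parity hg).neg_one_pow]
      simp
    · intro b _ hb
      obtain ⟨i, hi⟩ := Function.ne_iff.1 hb
      rw [Finset.prod_eq_zero (Finset.mem_univ i)]
      · simp
      · rw [rep_neg, if_neg (Ne.symm hi)]
    · simp
  · rw [hF.ghost a hg, hF.ghost a hg]

lemma IsVertex.iteratedFDeriv_zero_of_odd {n : ℕ} {F : (Fin n → FieldIndex) → Momenta n → ℂ}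
    (hF : IsVertex F) (a : Fin n → FieldIndex) {p : ℕ} (hp : Odd p) :
    iteratedFDeriv ℝ p (F a) 0 = 0 := by
  let T : Momenta n →L[ℝ] Momenta n := -ContinuousLinearMap.id ℝ _
  have e : F a ∘ T = F a := funext fun k => hF.apply_neg a k
  have h := ContinuousLinearMap.iteratedFDeriv_comp_right T (hF.smooth a) 0 (i := p)
    (by exact_mod_cast le_top)
  rw [e, map_zero] at h
  ext v
  have hv := congrArg (fun m => m v) h
  simp only [ContinuousMultilinearMap.compContinuousLinearMap_apply] at hv
  have h2 := (iteratedFDeriv ℝ p (F a) 0).map_smul_univ (fun _ => (-1 : ℝ)) v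
  rw [Finset.prod_const, Finset.card_univ, Fintype.card_fin, hp.neg_one_pow] at h2
  have h3 : (fun i => T (v i)) = fun i => (-1 : ℝ) • v i :=
    funext fun i => (neg_one_smul ℝ (v i)).symm
  rw [h3, h2, neg_smul, one_smul] at hv
  simpa using self_eq_neg.1 hv

lemma iteratedFDeriv_momenta_one (F : Momenta 1 → ℂ) {p : ℕ} (hp : p ≠ 0) (k : Momenta 1) :
    iteratedFDeriv ℝ p F k = 0 := by
  have hz : ∀ x : Momenta 1, x = 0 := fun x => by
    apply Subtype.ext
    funext i
    have := x.2
    change ∑ i, x.1 i = 0 at this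
    rw [Fin.sum_univ_one] at this
    rw [Subsingleton.elim i 0, this]; rfl
  have : F = fun _ => F 0 := funext fun x => by rw [hz x]
  rw [this, iteratedFDeriv_const_of_ne hp]
  rfl

/-! ### Logarithmic envelopes -/

/-- `δ Pln(Λ/Λ_R) + Λ/Λ_0 Pln(Λ_0/Λ_R)` for `x = Λ/Λ_0`, `l = ln (Λ/Λ_R)`, `l₀ = ln (Λ_0/Λ_R)`. -/
def logEnvelope (M s : ℕ) (x l l₀ : ℝ) : ℝ :=
  M * ((if s = 0 then (1 + l) ^ M else 0) + x * (1 + l₀) ^ M)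

section logEnvelope

variable {x l l₀ : ℝ} (hx : 0 ≤ x) (hx' : x ≤ 1) (hl : 0 ≤ l) (hl' : l ≤ l₀)
include hx hl hl'

lemma logEnvelope_mono {M M' : ℕ} (h : M ≤ M') (s : ℕ) :
    logEnvelope M s x l l₀ ≤ logEnvelope M' s x l l₀ := by
  have hl₀ : 0 ≤ l₀ := hl.trans hl'
  unfold logEnvelope
  have h4 : (if s = 0 then (1 + l) ^ M else 0) ≤ (if s = 0 then (1 + l) ^ M' else 0) := by
    split_ifs
    · exact pow_le_pow_right₀ (by linarith) h
    · exact le_rfl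
  have h5 : (1 + l₀) ^ M ≤ (1 + l₀) ^ M' := pow_le_pow_right₀ (by linarith) h
  refine mul_le_mul (by exact_mod_cast h)
    (add_le_add h4 (mul_le_mul_of_nonneg_left h5 hx)) ?_ (Nat.cast_nonneg _)
  split_ifs <;> positivity

lemma logEnvelope_nonneg (M s : ℕ) : 0 ≤ logEnvelope M s x l l₀ := by
  have hl₀ : 0 ≤ l₀ := hl.trans hl'
  unfold logEnvelope
  split_ifs <;> positivity

lemma logEnvelope_add (M M' s : ℕ) :
    logEnvelope M s x l l₀ + logEnvelope M' s x l l₀ ≤ logEnvelope (M + M') s x l l₀ := by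
  have hl₀ : 0 ≤ l₀ := hl.trans hl'
  have key : ∀ k ≤ M + M', (k : ℝ) * ((if s = 0 then (1 + l) ^ k else 0) + x * (1 + l₀) ^ k)
      ≤ k * ((if s = 0 then (1 + l) ^ (M + M') else 0) + x * (1 + l₀) ^ (M + M')) := by
    intro k hk
    gcongr
    · split_ifs
      · exact pow_le_pow_right₀ (by linarith) hk
      · exact le_rfl
    · linarith
  have h1 := key M (by omega)
  have h2 := key M' (by omega)
  unfold logEnvelope
  push_cast
  linarith

/-- A single integer serves as prefactor and as exponent. The summand `m * M` pays for the
prefactor, and `+ M` prevents the exponent from decreasing when `m = 0`. -/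
lemma logEnvelope_const_mul {c : ℝ} {m : ℕ} (hc : c ≤ m) (M s : ℕ) :
    c * logEnvelope M s x l l₀ ≤ logEnvelope (m * M + M) s x l l₀ := by
  have hl₀ : 0 ≤ l₀ := hl.trans hl'
  have h1 : c * logEnvelope M s x l l₀ ≤ m * logEnvelope M s x l l₀ :=
    mul_le_mul_of_nonneg_right hc (logEnvelope_nonneg hx hl hl' M s)
  refine h1.trans ?_
  unfold logEnvelope
  rw [← mul_assoc]
  have h2 : ((m : ℝ) * M) ≤ ((m * M + M : ℕ) : ℝ) := by
    push_cast; linarith [(Nat.cast_nonneg M : (0 : ℝ) ≤ M)]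
  have h3 : M ≤ m * M + M := by omega
  have h4 : (if s = 0 then (1 + l) ^ M else 0) ≤ (if s = 0 then (1 + l) ^ (m * M + M) else 0) := by
    split_ifs
    · exact pow_le_pow_right₀ (by linarith) h3
    · exact le_rfl
  have h5 : (1 + l₀) ^ M ≤ (1 + l₀) ^ (m * M + M) := pow_le_pow_right₀ (by linarith) h3
  refine mul_le_mul h2 (add_le_add h4 (mul_le_mul_of_nonneg_left h5 hx)) ?_ (Nat.cast_nonneg _)
  split_ifs <;> positivity

include hx'

/-- The two indicator terms multiply to the one for `s + s'`. The three other products contain `x`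
and are at most `x (1 + l₀) ^ (M + M')`, since `x ≤ 1` and `l ≤ l₀`; this is the origin of `3 * M *
M'`. -/
lemma logEnvelope_mul (M M' s s' : ℕ) :
    logEnvelope M s x l l₀ * logEnvelope M' s' x l l₀
      ≤ logEnvelope (3 * M * M' + M + M') (s + s') x l l₀ := by
  have hl₀ : 0 ≤ l₀ := hl.trans hl'
  set m := 3 * M * M' + M + M'
  have hm : M + M' ≤ m := by simp only [m]; nlinarith [Nat.zero_le (M * M')]
  unfold logEnvelope
  set α := (if s = 0 then (1 + l) ^ M else 0)
  set β := (if s' = 0 then (1 + l) ^ M' else 0)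
  set γ := (if s + s' = 0 then (1 + l) ^ m else 0)
  have hα : 0 ≤ α := by simp only [α]; split_ifs <;> positivity
  have hβ : 0 ≤ β := by simp only [β]; split_ifs <;> positivity
  have hγ : 0 ≤ γ := by simp only [γ]; split_ifs <;> positivity
  have hα' : α ≤ (1 + l₀) ^ M := by
    simp only [α]; split_ifs
    · gcongr
    · positivity
  have hβ' : β ≤ (1 + l₀) ^ M' := by
    simp only [β]; split_ifs
    · gcongr
    · positivity
  have hαβ : α * β ≤ γ := by
    simp only [α, β, γ]
    by_cases h1 : s = 0 <;> by_cases h2 : s' = 0 <;> simp only [h1, h2, if_true, if_false,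
      zero_mul, mul_zero, add_zero, zero_add]
    · rw [← pow_add]; exact pow_le_pow_right₀ (by linarith) hm
    · exact le_rfl
    · exact le_rfl
    · split_ifs <;> positivity
  have hw : (1 + l₀) ^ M * (1 + l₀) ^ M' ≤ (1 + l₀) ^ m := by
    rw [← pow_add]; exact pow_le_pow_right₀ (by linarith) hm
  set u := (1 + l₀) ^ M
  set u' := (1 + l₀) ^ M'
  set w := (1 + l₀) ^ m
  have hu : 0 ≤ u := by positivity
  have hu' : 0 ≤ u' := by positivity
  have hw0 : 0 ≤ w := by positivity
  have e1 : α * (x * u') ≤ x * w := by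
    calc α * (x * u') = x * (α * u') := by ring
      _ ≤ x * (u * u') := by gcongr
      _ ≤ x * w := by gcongr
  have e2 : x * u * β ≤ x * w := by
    calc x * u * β = x * (u * β) := by ring
      _ ≤ x * (u * u') := by gcongr
      _ ≤ x * w := by gcongr
  have e3 : x * u * (x * u') ≤ x * w := by
    calc x * u * (x * u') = x * (x * (u * u')) := by ring
      _ ≤ x * (1 * w) := by gcongr
      _ = x * w := by ring
  have e4 : (α + x * u) * (β + x * u') ≤ γ + 3 * (x * w) := by nlinarith
  have e5 : (M : ℝ) * M' * (γ + 3 * (x * w)) ≤ m * (γ + x * w) := by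
    have h0 : 0 ≤ (M : ℝ) * M' := by positivity
    have h1 : (3 : ℝ) * (M * M') ≤ m := by
      simp only [m]; push_cast
      linarith [(Nat.cast_nonneg M : (0 : ℝ) ≤ M), (Nat.cast_nonneg M' : (0 : ℝ) ≤ M')]
    have h2 : 0 ≤ x * w := by positivity
    nlinarith
  calc _ = (M : ℝ) * M' * ((α + x * u) * (β + x * u')) := by ring
    _ ≤ (M : ℝ) * M' * (γ + 3 * (x * w)) := by gcongr
    _ ≤ _ := e5

end logEnvelope

/-! ### Solutions of the flow equation with boundary conditions -/

variable {d : Fin 5 → ℕ}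

/-- A solution of the flow equation with the renormalization and initial conditions. -/
structure FlowData (K : ℝ → ℝ) (T : TensorBases d) (N : (Coupling d →₀ ℕ) → ℕ)
    (P₀ : ℕ → ℕ → (Coupling d →₀ ℕ) → Polynomial ℝ) where
  (ΛR Λ0 A B₁ B₂ : ℝ)
  (ΛR_pos : 0 < ΛR)
  (ΛR_le : ΛR ≤ Λ0)
  (abs_B₁ : |B₁| ≤ ΛR ^ 2)
  (abs_B₂ : |B₂| ≤ ΛR ^ 2)
  L : Potential d
  sol : IsSolution K A B₁ B₂ ΛR Λ0 L
  ren : RenormalizationConditions T ΛR L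
  bare : BareConditions T Λ0 L
  degree : BareDegree N Λ0 L
  small : SmallBare P₀ ΛR Λ0 L

lemma tupleOrder_add (i : Fin 5) (r r' : Coupling d →₀ ℕ) :
    tupleOrder i (r + r') = tupleOrder i r + tupleOrder i r' := by
  simp [tupleOrder, Finset.sum_add_distrib]

lemma orderNR_add (r r' : Coupling d →₀ ℕ) : orderNR (r + r') = orderNR r + orderNR r' := by
  simp only [orderNR, tupleOrder_add]; ring

@[simp] lemma tupleOrder_zero (i : Fin 5) : tupleOrder i (0 : Coupling d →₀ ℕ) = 0 := by
  simp [tupleOrder]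

@[simp] lemma orderNR_zero : orderNR (0 : Coupling d →₀ ℕ) = 0 := by simp [orderNR]

namespace FlowData

variable {K : ℝ → ℝ} {T : TensorBases d} {N : (Coupling d →₀ ℕ) → ℕ}
  {P₀ : ℕ → ℕ → (Coupling d →₀ ℕ) → Polynomial ℝ}

/-- The vertex functions to order `r`. -/
def vertex (D : FlowData K T N P₀) (r : Coupling d →₀ ℕ) (Λ : ℝ) (n : ℕ)
    (a : Fin n → FieldIndex) (k : Momenta n) : ℂ :=
  MvPowerSeries.coeff r (D.L Λ n a k)

/-- `Λ_R^{-|r₁|} Λ_0^{r_NR}`. -/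
def unit (D : FlowData K T N P₀) (r : Coupling d →₀ ℕ) : ℝ :=
  (D.ΛR ^ tupleOrder 0 r)⁻¹ * D.Λ0 ^ orderNR r

/-- The logarithmic factor of the bounds. -/
def envelope (D : FlowData K T N P₀) (M : ℕ) (r : Coupling d →₀ ℕ) (Λ : ℝ) : ℝ :=
  logEnvelope M (orderNR r) (Λ / D.Λ0) (Real.log (Λ / D.ΛR)) (Real.log (D.Λ0 / D.ΛR))

variable (D : FlowData K T N P₀)

lemma Λ0_pos : 0 < D.Λ0 := D.ΛR_pos.trans_le D.ΛR_le

lemma unit_pos (r : Coupling d →₀ ℕ) : 0 < D.unit r := by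
  have := D.ΛR_pos; have := D.Λ0_pos
  unfold unit; positivity

lemma unit_add (r r' : Coupling d →₀ ℕ) : D.unit (r + r') = D.unit r * D.unit r' := by
  simp only [unit, tupleOrder_add, orderNR_add, pow_add, mul_inv]; ring

@[simp] lemma unit_zero : D.unit 0 = 1 := by simp [unit]

section Scale

variable {D} {Λ : ℝ} (hΛ : Λ ∈ Set.Icc D.ΛR D.Λ0)
include hΛ

lemma pos_of_mem : 0 < Λ := D.ΛR_pos.trans_le hΛ.1

lemma ratio_nonneg : 0 ≤ Λ / D.Λ0 := (div_pos (pos_of_mem hΛ) D.Λ0_pos).le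

lemma ratio_le_one : Λ / D.Λ0 ≤ 1 := (div_le_one D.Λ0_pos).2 hΛ.2

lemma log_nonneg : 0 ≤ Real.log (Λ / D.ΛR) := Real.log_nonneg ((one_le_div D.ΛR_pos).2 hΛ.1)

lemma log_le : Real.log (Λ / D.ΛR) ≤ Real.log (D.Λ0 / D.ΛR) :=
  Real.log_le_log (div_pos (pos_of_mem hΛ) D.ΛR_pos)
    (div_le_div_of_nonneg_right hΛ.2 D.ΛR_pos.le)

lemma envelope_mono {M M' : ℕ} (h : M ≤ M') (r : Coupling d →₀ ℕ) :
    D.envelope M r Λ ≤ D.envelope M' r Λ :=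
  logEnvelope_mono (ratio_nonneg hΛ) (log_nonneg hΛ) (log_le hΛ) h _

lemma envelope_nonneg (M : ℕ) (r : Coupling d →₀ ℕ) : 0 ≤ D.envelope M r Λ :=
  logEnvelope_nonneg (ratio_nonneg hΛ) (log_nonneg hΛ) (log_le hΛ) _ _

lemma envelope_add (M M' : ℕ) (r : Coupling d →₀ ℕ) :
    D.envelope M r Λ + D.envelope M' r Λ ≤ D.envelope (M + M') r Λ :=
  logEnvelope_add (ratio_nonneg hΛ) (log_nonneg hΛ) (log_le hΛ) _ _ _

lemma envelope_const_mul {c : ℝ} {m : ℕ} (hc : c ≤ m) (M : ℕ) (r : Coupling d →₀ ℕ) :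
    c * D.envelope M r Λ ≤ D.envelope (m * M + M) r Λ :=
  logEnvelope_const_mul (ratio_nonneg hΛ) (log_nonneg hΛ) (log_le hΛ) hc _ _

lemma envelope_mul (M M' : ℕ) (r r' : Coupling d →₀ ℕ) :
    D.envelope M r Λ * D.envelope M' r' Λ ≤ D.envelope (3 * M * M' + M + M') (r + r') Λ := by
  unfold envelope
  rw [orderNR_add]
  exact logEnvelope_mul (ratio_nonneg hΛ) (ratio_le_one hΛ) (log_nonneg hΛ) (log_le hΛ) _ _ _ _

lemma one_le_envelope_zero : 1 ≤ D.envelope 1 0 Λ := by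
  have h1 := ratio_nonneg hΛ
  have h2 := log_nonneg hΛ
  have h3 := h2.trans (log_le hΛ)
  simp only [envelope, logEnvelope, orderNR_zero, if_true, Nat.cast_one, one_mul, pow_one]
  nlinarith

lemma abs_B₁_le : |D.B₁| ≤ Λ ^ 2 := D.abs_B₁.trans (pow_le_pow_left₀ D.ΛR_pos.le hΛ.1 2)

lemma abs_B₂_le : |D.B₂| ≤ Λ ^ 2 := D.abs_B₂.trans (pow_le_pow_left₀ D.ΛR_pos.le hΛ.1 2)

lemma isVertex (r : Coupling d →₀ ℕ) {n : ℕ} (hn : 1 ≤ n) : IsVertex (D.vertex r Λ n) :=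
  D.sol.vertex Λ hΛ n hn r

lemma contDiff_vertex (r : Coupling d →₀ ℕ) {n : ℕ} (hn : 1 ≤ n) (a : Fin n → FieldIndex) :
    ContDiff ℝ ∞ (D.vertex r Λ n a) := (isVertex hΛ r hn).smooth a

end Scale

end FlowData

/-! ### Bounds that are uniform in the solutions -/

section LogBound

variable (K : ℝ → ℝ) (T : TensorBases d) (N : (Coupling d →₀ ℕ) → ℕ)
  (P₀ : ℕ → ℕ → (Coupling d →₀ ℕ) → Polynomial ℝ)

/-- A quantity depending on solution, scale and momenta is bounded by
`Λ^e Λ_R^{-|r₁|} Λ_0^{r_NR}` times logarithms. -/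
def LogBound {n : ℕ} (e : ℤ) (r : Coupling d →₀ ℕ)
    (X : FlowData K T N P₀ → ℝ → Momenta n → ℝ) : Prop :=
  ∃ M : ℕ, ∀ D : FlowData K T N P₀, ∀ Λ ∈ Set.Icc D.ΛR D.Λ0, ∀ k, ‖k‖ ≤ 2 * Λ →
    X D Λ k ≤ Λ ^ e * D.unit r * D.envelope M r Λ

/-- The bound on the `p`-th derivatives of the `n`-point function to order `r`. -/
def VertexBound (n p : ℕ) (r : Coupling d →₀ ℕ) : Prop :=
  ∀ a : Fin n → FieldIndex, LogBound K T N P₀ (4 - n - p) r fun D Λ k =>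
    ‖iteratedFDeriv ℝ p (D.vertex r Λ n a) k‖

variable {K T N P₀}

namespace LogBound

variable {n : ℕ} {e e' : ℤ} {r r' : Coupling d →₀ ℕ}
  {X Y : FlowData K T N P₀ → ℝ → Momenta n → ℝ}

lemma mono (hX : LogBound K T N P₀ e r X)
    (h : ∀ D : FlowData K T N P₀, ∀ Λ ∈ Set.Icc D.ΛR D.Λ0, ∀ k, ‖k‖ ≤ 2 * Λ →
      Y D Λ k ≤ X D Λ k) : LogBound K T N P₀ e r Y := by
  obtain ⟨M, hM⟩ := hX
  exact ⟨M, fun D Λ hΛ k hk => (h D Λ hΛ k hk).trans (hM D Λ hΛ k hk)⟩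

lemma add (hX : LogBound K T N P₀ e r X) (hY : LogBound K T N P₀ e r Y) :
    LogBound K T N P₀ e r fun D Λ k => X D Λ k + Y D Λ k := by
  obtain ⟨M, hM⟩ := hX
  obtain ⟨M', hM'⟩ := hY
  refine ⟨M + M', fun D Λ hΛ k hk => ?_⟩
  have h0 : 0 ≤ Λ ^ e * D.unit r :=
    mul_nonneg (zpow_nonneg (FlowData.pos_of_mem hΛ).le _) (D.unit_pos r).le
  calc _ ≤ _ := add_le_add (hM D Λ hΛ k hk) (hM' D Λ hΛ k hk)
    _ = Λ ^ e * D.unit r * (D.envelope M r Λ + D.envelope M' r Λ) := by ring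
    _ ≤ _ := mul_le_mul_of_nonneg_left (FlowData.envelope_add hΛ M M' r) h0

lemma of_nonpos (h : ∀ D : FlowData K T N P₀, ∀ Λ ∈ Set.Icc D.ΛR D.Λ0, ∀ k, ‖k‖ ≤ 2 * Λ →
    X D Λ k ≤ 0) : LogBound K T N P₀ e r X := by
  refine ⟨0, fun D Λ hΛ k hk => (h D Λ hΛ k hk).trans (le_of_eq ?_)⟩
  simp [FlowData.envelope, logEnvelope]

lemma sum {ι : Type*} (s : Finset ι) {X : ι → FlowData K T N P₀ → ℝ → Momenta n → ℝ}
    (h : ∀ i ∈ s, LogBound K T N P₀ e r (X i)) :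
    LogBound K T N P₀ e r fun D Λ k => ∑ i ∈ s, X i D Λ k := by
  classical
  induction s using Finset.induction_on with
  | empty => exact of_nonpos fun _ _ _ _ _ => by simp
  | insert i s hi ih =>
    simp only [Finset.sum_insert hi]
    exact (h i (Finset.mem_insert_self _ _)).add
      (ih fun j hj => h j (Finset.mem_insert_of_mem hj))

lemma const_mul (c : ℝ) (hX : LogBound K T N P₀ e r X) (hc : 0 ≤ c) :
    LogBound K T N P₀ e r fun D Λ k => c * X D Λ k := by
  obtain ⟨M, hM⟩ := hX
  refine ⟨⌈c⌉₊ * M + M, fun D Λ hΛ k hk => ?_⟩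
  have h0 : 0 ≤ Λ ^ e * D.unit r :=
    mul_nonneg (zpow_nonneg (FlowData.pos_of_mem hΛ).le _) (D.unit_pos r).le
  calc _ ≤ _ := mul_le_mul_of_nonneg_left (hM D Λ hΛ k hk) hc
    _ = Λ ^ e * D.unit r * (c * D.envelope M r Λ) := by ring
    _ ≤ _ := mul_le_mul_of_nonneg_left (FlowData.envelope_const_mul hΛ (Nat.le_ceil c) M r) h0

lemma mul (hX : LogBound K T N P₀ e r X) (hY : LogBound K T N P₀ e' r' Y)
    (hX0 : ∀ D Λ k, 0 ≤ X D Λ k) (hY0 : ∀ D Λ k, 0 ≤ Y D Λ k) :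
    LogBound K T N P₀ (e + e') (r + r') fun D Λ k => X D Λ k * Y D Λ k := by
  obtain ⟨M, hM⟩ := hX
  obtain ⟨M', hM'⟩ := hY
  refine ⟨3 * M * M' + M + M', fun D Λ hΛ k hk => ?_⟩
  have hpos := FlowData.pos_of_mem hΛ
  have h0 : 0 ≤ Λ ^ (e + e') * D.unit (r + r') :=
    mul_nonneg (zpow_nonneg hpos.le _) (D.unit_pos _).le
  calc _ ≤ _ := mul_le_mul (hM D Λ hΛ k hk) (hM' D Λ hΛ k hk) (hY0 D Λ k)
        ((hX0 D Λ k).trans (hM D Λ hΛ k hk))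
    _ = Λ ^ (e + e') * D.unit (r + r') * (D.envelope M r Λ * D.envelope M' r' Λ) := by
        rw [zpow_add₀ hpos.ne', D.unit_add]; ring
    _ ≤ _ := mul_le_mul_of_nonneg_left (FlowData.envelope_mul hΛ M M' r r') h0

lemma zpow (e : ℤ) : LogBound K T N P₀ e 0 fun _ Λ (_ : Momenta n) => Λ ^ e := by
  refine ⟨1, fun D Λ hΛ k _ => ?_⟩
  rw [D.unit_zero, mul_one]
  exact le_mul_of_one_le_right (zpow_nonneg (FlowData.pos_of_mem hΛ).le _)
    (FlowData.one_le_envelope_zero hΛ)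

-- Used with `C` saying that the line momentum lies in the support of the propagator: the bound at
-- `g k` is available only there, and elsewhere the quantity is replaced by zero.
open Classical in
lemma comp {m : ℕ} {X : FlowData K T N P₀ → ℝ → Momenta m → ℝ} (hX : LogBound K T N P₀ e r X)
    (g : Momenta n → Momenta m) (C : ℝ → Momenta n → Prop)
    (hg : ∀ Λ k, ‖k‖ ≤ 2 * Λ → C Λ k → ‖g k‖ ≤ 2 * Λ) :
    LogBound K T N P₀ e r fun D Λ k => if C Λ k then X D Λ (g k) else 0 := by
  obtain ⟨M, hM⟩ := hX
  refine ⟨M, fun D Λ hΛ k hk => ?_⟩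
  dsimp only
  split_ifs with h
  · exact hM D Λ hΛ _ (hg Λ k hk h)
  · exact mul_nonneg (mul_nonneg (zpow_nonneg (FlowData.pos_of_mem hΛ).le _) (D.unit_pos r).le)
      (FlowData.envelope_nonneg hΛ M r)

end LogBound

end LogBound

variable {K : ℝ → ℝ} {T : TensorBases d} {N : (Coupling d →₀ ℕ) → ℕ}
  {P₀ : ℕ → ℕ → (Coupling d →₀ ℕ) → Polynomial ℝ}

/-! ### Calculus of bounded smooth functions of the momenta -/

section SmoothBound

variable (K T N P₀) in
/-- Smooth functions of the momenta whose `p`-th derivatives are bounded. -/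
def SmoothBound {n : ℕ} (e : ℤ) (r : Coupling d →₀ ℕ) (p : ℕ)
    (f : FlowData K T N P₀ → ℝ → Momenta n → ℂ) : Prop :=
  (∀ D : FlowData K T N P₀, ∀ Λ ∈ Set.Icc D.ΛR D.Λ0, ContDiff ℝ ∞ (f D Λ)) ∧
    LogBound K T N P₀ e r fun D Λ k => ‖iteratedFDeriv ℝ p (f D Λ) k‖

lemma SmoothBound.sum {n : ℕ} {e : ℤ} {r : Coupling d →₀ ℕ} {p : ℕ} {ι : Type*} {s : Finset ι}
    {f : ι → FlowData K T N P₀ → ℝ → Momenta n → ℂ}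
    (h : ∀ i ∈ s, SmoothBound K T N P₀ e r p (f i)) :
    SmoothBound K T N P₀ e r p fun D Λ k => ∑ i ∈ s, f i D Λ k := by
  refine ⟨fun D Λ hΛ => ContDiff.sum fun i hi => (h i hi).1 D Λ hΛ,
    (LogBound.sum s fun i hi => (h i hi).2).mono fun D Λ hΛ k _ => ?_⟩
  rw [iteratedFDeriv_sum fun i hi => ((h i hi).1 D Λ hΛ).of_le (by exact_mod_cast le_top),
    Finset.sum_apply]
  exact norm_sum_le _ _

lemma SmoothBound.const_mul {n : ℕ} {e : ℤ} {r : Coupling d →₀ ℕ} {p : ℕ}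
    {f : FlowData K T N P₀ → ℝ → Momenta n → ℂ} (h : SmoothBound K T N P₀ e r p f) (c : ℂ) :
    SmoothBound K T N P₀ e r p fun D Λ k => c * f D Λ k := by
  refine ⟨fun D Λ hΛ => contDiff_const.mul (h.1 D Λ hΛ),
    (h.2.const_mul ‖c‖ (norm_nonneg _)).mono fun D Λ hΛ k _ => le_of_eq ?_⟩
  rw [← norm_smul, ← iteratedFDeriv_const_smul_apply
    ((h.1 D Λ hΛ).of_le (by exact_mod_cast le_top)).contDiffAt]
  rfl

lemma norm_iteratedFDeriv_comp_clm_le {E G F : Type*} [NormedAddCommGroup E] [NormedSpace ℝ E]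
    [NormedAddCommGroup G] [NormedSpace ℝ G] [NormedAddCommGroup F] [NormedSpace ℝ F]
    {f : G → F} (hf : ContDiff ℝ ∞ f) (g : E →L[ℝ] G) {c : ℝ} (hg : ‖g‖ ≤ c) (p : ℕ) (x : E) :
    ‖iteratedFDeriv ℝ p (fun y => f (g y)) x‖ ≤ c ^ p * ‖iteratedFDeriv ℝ p f (g x)‖ := by
  have := ContinuousLinearMap.iteratedFDeriv_comp_right g hf x (i := p) (by exact_mod_cast le_top)
  rw [show (fun y => f (g y)) = f ∘ g from rfl, this]
  refine (ContinuousMultilinearMap.norm_compContinuousLinearMap_le _ _).trans ?_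
  rw [Finset.prod_const, Finset.card_univ, Fintype.card_fin, mul_comm]
  gcongr

end SmoothBound

/-! ### The tree term -/

lemma coeff_treeTerm (D : FlowData K T N P₀) (Λ : ℝ) (n : ℕ) (a : Fin n → FieldIndex)
    (r : Coupling d →₀ ℕ) (k : Momenta n) :
    MvPowerSeries.coeff r (treeTerm K D.B₁ D.B₂ D.L Λ n a k)
      = ∑ S : Finset (Fin n), ∑ b : FieldIndex, ∑ c : FieldIndex,
        ∑ x ∈ Finset.HasAntidiagonal.antidiagonal r, leibnizSign a S b *
          ((propagatorDot K D.B₁ D.B₂ Λ (lineMomentum S k) b c : ℂ) *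
          (D.vertex x.1 Λ (S.card + 1) (addLeg (sublegs S a) b) (subMomenta S k) *
            D.vertex x.2 Λ (Sᶜ.card + 1) (addLeg (sublegs Sᶜ a) c) (subMomenta Sᶜ k))) := by
  simp only [treeTerm, map_sum, map_smul, MvPowerSeries.coeff_mul, smul_eq_mul, Finset.mul_sum,
    lineMomentum_apply, subMomenta_apply, FlowData.vertex, mul_assoc]

-- Leibniz rule and power counting: the subvertices contribute `4 - (|S| + 1) - j` and `4 - (|Sᶜ| +
-- 1) - j'`, the propagator `-3 - i`, and with `i + j + j' = p` the sum is `3 - n - p`. The support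
-- of the propagator puts both subvertices into the region where their bounds hold.
open Classical in
lemma treeSummand_bound (hK : IsCutoff K) {n : ℕ} (p : ℕ) (S : Finset (Fin n)) (b c : FieldIndex)
    (a' : Fin (S.card + 1) → FieldIndex) (a'' : Fin (Sᶜ.card + 1) → FieldIndex)
    {r' r'' : Coupling d →₀ ℕ} (h' : ∀ j, VertexBound K T N P₀ (S.card + 1) j r')
    (h'' : ∀ j, VertexBound K T N P₀ (Sᶜ.card + 1) j r'') :
    SmoothBound K T N P₀ (3 - n - p) (r' + r'') p fun D Λ k =>
      (propagatorDot K D.B₁ D.B₂ Λ (lineMomentum S k) b c : ℂ) *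
        (D.vertex r' Λ (S.card + 1) a' (subMomenta S k) *
          D.vertex r'' Λ (Sᶜ.card + 1) a'' (subMomenta Sᶜ k)) := by
  have hsm : ∀ D : FlowData K T N P₀, ∀ Λ ∈ Set.Icc D.ΛR D.Λ0,
      ContDiff ℝ ∞ (fun q => (propagatorDot K D.B₁ D.B₂ Λ q b c : ℂ)) := fun D Λ hΛ =>
    contDiff_propagatorDot hK (FlowData.pos_of_mem hΛ) (FlowData.abs_B₁_le hΛ)
      (FlowData.abs_B₂_le hΛ) b c
  have hs0 : ∀ D : FlowData K T N P₀, ∀ Λ ∈ Set.Icc D.ΛR D.Λ0,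
      ContDiff ℝ ∞ (fun k => (propagatorDot K D.B₁ D.B₂ Λ (lineMomentum S k) b c : ℂ)) :=
    fun D Λ hΛ => (hsm D Λ hΛ).comp (lineMomentum S).contDiff
  have hs1 : ∀ D : FlowData K T N P₀, ∀ Λ ∈ Set.Icc D.ΛR D.Λ0,
      ContDiff ℝ ∞ (fun k => D.vertex r' Λ (S.card + 1) a' (subMomenta S k)) := fun D Λ hΛ =>
    (FlowData.contDiff_vertex hΛ r' (Nat.le_add_left _ _) a').comp (subMomenta S).contDiff
  have hs2 : ∀ D : FlowData K T N P₀, ∀ Λ ∈ Set.Icc D.ΛR D.Λ0,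
      ContDiff ℝ ∞ (fun k => D.vertex r'' Λ (Sᶜ.card + 1) a'' (subMomenta Sᶜ k)) := fun D Λ hΛ =>
    (FlowData.contDiff_vertex hΛ r'' (Nat.le_add_left _ _) a'').comp (subMomenta Sᶜ).contDiff
  refine ⟨fun D Λ hΛ => (hs0 D Λ hΛ).mul ((hs1 D Λ hΛ).mul (hs2 D Λ hΛ)), ?_⟩
  choose C hC0 hC using exists_propagatorDot_bound hK
  set inside : ℝ → Momenta n → Prop := fun Λ k => ‖lineMomentum S k‖ ≤ 2 * Λ
  have hin' : ∀ Λ k, ‖k‖ ≤ 2 * Λ → inside Λ k → ‖subMomenta S k‖ ≤ 2 * Λ := fun Λ k hk h =>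
    norm_attach_sublegs_le S hk (by simpa [inside] using h)
  have hin'' : ∀ Λ k, ‖k‖ ≤ 2 * Λ → inside Λ k → ‖subMomenta Sᶜ k‖ ≤ 2 * Λ := fun Λ k hk h =>
    norm_attach_sublegs_le Sᶜ hk (by simpa [inside, sum_compl_eq_neg] using h)
  set X : ℕ → FlowData K T N P₀ → ℝ → Momenta n → ℝ := fun j D Λ k =>
    if inside Λ k then ‖iteratedFDeriv ℝ j (D.vertex r' Λ (S.card + 1) a') (subMomenta S k)‖ else 0
  set Y : ℕ → FlowData K T N P₀ → ℝ → Momenta n → ℝ := fun j D Λ k =>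
    if inside Λ k then ‖iteratedFDeriv ℝ j (D.vertex r'' Λ (Sᶜ.card + 1) a'') (subMomenta Sᶜ k)‖
      else 0
  have hX0 : ∀ j D Λ k, 0 ≤ X j D Λ k := fun j D Λ k => by
    simp only [X]; split_ifs <;> positivity
  have hY0 : ∀ j D Λ k, 0 ≤ Y j D Λ k := fun j D Λ k => by
    simp only [Y]; split_ifs <;> positivity
  have hX : ∀ j : ℕ, LogBound K T N P₀ (4 - (S.card + 1 : ℕ) - j) r' (X j) := fun j =>
    LogBound.comp (h' j a') (subMomenta S) inside hin'
  have hY : ∀ j : ℕ, LogBound K T N P₀ (4 - (Sᶜ.card + 1 : ℕ) - j) r'' (Y j) := fun j =>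
    LogBound.comp (h'' j a'') (subMomenta Sᶜ) inside hin''
  have hcard : S.card + Sᶜ.card = n := by simp [S.card_add_card_compl]
  have hZ : LogBound K T N P₀ (3 - n - p) (r' + r'') fun D Λ k =>
      ∑ i ∈ Finset.range (p + 1), (p.choose i * (((n : ℝ) + 1) ^ i * C i)) *
        (|Λ ^ (-3 - i : ℤ)| * ∑ j ∈ Finset.range (p - i + 1),
          ((p - i).choose j * (((n : ℝ) + 1) ^ j * ((n : ℝ) + 1) ^ (p - i - j))) *
            (X j D Λ k * Y (p - i - j) D Λ k)) := by
    refine LogBound.sum _ fun i hi => LogBound.const_mul _ ?_ (by have := hC0 i; positivity)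
    have h1 : LogBound K T N P₀ (6 - n - (p - i : ℕ)) (r' + r'') fun D Λ k =>
        ∑ j ∈ Finset.range (p - i + 1),
          ((p - i).choose j * (((n : ℝ) + 1) ^ j * ((n : ℝ) + 1) ^ (p - i - j))) *
            (X j D Λ k * Y (p - i - j) D Λ k) := by
      refine LogBound.sum _ fun j hj => LogBound.const_mul _ ?_ (by positivity)
      have := (hX j).mul (hY (p - i - j)) (hX0 j) (hY0 _)
      convert this using 1
      have := Finset.mem_range.1 hj
      omega
    have h2 : LogBound K T N P₀ (-3 - i) 0 fun _ Λ (_ : Momenta n) => |Λ ^ (-3 - i : ℤ)| :=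
      (LogBound.zpow _).mono fun D Λ hΛ k _ =>
        (abs_of_nonneg (zpow_nonneg (FlowData.pos_of_mem hΛ).le _)).le
    have := h2.mul h1 (fun _ _ _ => abs_nonneg _) fun D Λ k => Finset.sum_nonneg fun j _ =>
      mul_nonneg (by positivity) (mul_nonneg (hX0 j D Λ k) (hY0 _ D Λ k))
    convert this using 1
    · have := Finset.mem_range.1 hi
      omega
    · rw [zero_add]
  refine hZ.mono fun D Λ hΛ k hk => ?_
  have hpos := FlowData.pos_of_mem hΛ
  by_cases hin : inside Λ k
  · have hle : ∀ m : ℕ, (m : WithTop ℕ∞) ≤ ∞ := fun m => by exact_mod_cast le_top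
    refine (norm_iteratedFDeriv_mul_le (hs0 D Λ hΛ) ((hs1 D Λ hΛ).mul (hs2 D Λ hΛ)) k (hle p)).trans ?_
    refine Finset.sum_le_sum fun i _ => ?_
    have e1 : ‖iteratedFDeriv ℝ i (fun k =>
        (propagatorDot K D.B₁ D.B₂ Λ (lineMomentum S k) b c : ℂ)) k‖
        ≤ ((n : ℝ) + 1) ^ i * (C i * |Λ ^ (-3 - i : ℤ)|) := by
      refine (norm_iteratedFDeriv_comp_clm_le (hsm D Λ hΛ) (lineMomentum S)
        (norm_lineMomentum_le S) i k).trans ?_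
      rw [abs_of_nonneg (zpow_nonneg hpos.le _)]
      gcongr
      exact hC i Λ D.B₁ D.B₂ hpos (FlowData.abs_B₁_le hΛ) (FlowData.abs_B₂_le hΛ) b c _
    have e2 : ‖iteratedFDeriv ℝ (p - i) (fun k =>
        D.vertex r' Λ (S.card + 1) a' (subMomenta S k) *
          D.vertex r'' Λ (Sᶜ.card + 1) a'' (subMomenta Sᶜ k)) k‖
        ≤ ∑ j ∈ Finset.range (p - i + 1),
          ((p - i).choose j * (((n : ℝ) + 1) ^ j * ((n : ℝ) + 1) ^ (p - i - j))) *
            (X j D Λ k * Y (p - i - j) D Λ k) := by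
      refine (norm_iteratedFDeriv_mul_le (hs1 D Λ hΛ) (hs2 D Λ hΛ) k (hle (p - i))).trans ?_
      refine Finset.sum_le_sum fun j _ => ?_
      have f1 := norm_iteratedFDeriv_comp_clm_le
        (FlowData.contDiff_vertex hΛ r' (Nat.le_add_left 1 S.card) a') (subMomenta S)
        (norm_subMomenta_le S) j k
      have f2 := norm_iteratedFDeriv_comp_clm_le
        (FlowData.contDiff_vertex hΛ r'' (Nat.le_add_left 1 Sᶜ.card) a'') (subMomenta Sᶜ)
        (norm_subMomenta_le Sᶜ) (p - i - j) k
      simp only [X, Y, if_pos hin]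
      rw [mul_assoc]
      refine (mul_le_mul_of_nonneg_left (mul_le_mul f1 f2 (norm_nonneg _) (by positivity))
        (Nat.cast_nonneg _)).trans (le_of_eq ?_)
      ring
    rw [mul_assoc]
    refine (mul_le_mul_of_nonneg_left (mul_le_mul e1 e2 (norm_nonneg _) ?_)
      (Nat.cast_nonneg _)).trans (le_of_eq ?_)
    · have := hC0 i; positivity
    · ring
  -- Off the closed support condition the summand vanishes on a neighbourhood of `k`, hence with all
  -- derivatives.
  · have hev : (fun k => (propagatorDot K D.B₁ D.B₂ Λ (lineMomentum S k) b c : ℂ) *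
        (D.vertex r' Λ (S.card + 1) a' (subMomenta S k) *
          D.vertex r'' Λ (Sᶜ.card + 1) a'' (subMomenta Sᶜ k))) =ᶠ[nhds k] fun _ => 0 := by
      have hopen : IsOpen {y : Momenta n | 2 * Λ < ‖lineMomentum S y‖} :=
        isOpen_lt continuous_const (lineMomentum S).continuous.norm
      filter_upwards [hopen.mem_nhds (show 2 * Λ < ‖lineMomentum S k‖ from not_le.1 hin)] with y hy
      rw [propagatorDot_eq_zero hK hpos _ _ (le_of_lt hy)]
      simp
    rw [(hev.iteratedFDeriv ℝ p).eq_of_nhds]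
    have : iteratedFDeriv ℝ p (fun _ : Momenta n => (0 : ℂ)) k = 0 := by simp
    rw [this, norm_zero]
    refine Finset.sum_nonneg fun i _ => mul_nonneg (by have := hC0 i; positivity)
      (mul_nonneg (abs_nonneg _) (Finset.sum_nonneg fun j _ =>
        mul_nonneg (by positivity) (mul_nonneg (hX0 j D Λ k) (hY0 _ D Λ k))))

lemma FlowData.vertex_zero {D : FlowData K T N P₀} {Λ : ℝ} (hΛ : Λ ∈ Set.Icc D.ΛR D.Λ0) {n : ℕ}
    (hn : 1 ≤ n) (a : Fin n → FieldIndex) (k : Momenta n) : D.vertex 0 Λ n a k = 0 :=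
  D.sol.zeroth Λ hΛ n hn a k

/-- The factors carry orders `r' + r'' = r`. If one of them is `0` the summand vanishes by `L^{(0)}
= 0`; otherwise both are strictly below `r`, and no restriction on the number of legs is needed. -/
lemma treeTerm_bound (hK : IsCutoff K) {n : ℕ} (p : ℕ) (a : Fin n → FieldIndex)
    {r : Coupling d →₀ ℕ} (h : ∀ r' < r, ∀ m j, 1 ≤ m → VertexBound K T N P₀ m j r') :
    SmoothBound K T N P₀ (3 - n - p) r p fun D Λ k =>
      MvPowerSeries.coeff r (treeTerm K D.B₁ D.B₂ D.L Λ n a k) := by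
  simp only [coeff_treeTerm]
  refine SmoothBound.sum fun S _ => SmoothBound.sum fun b _ => SmoothBound.sum fun c _ =>
    SmoothBound.sum fun x hx => SmoothBound.const_mul ?_ _
  obtain ⟨r', r''⟩ := x
  have hr : r' + r'' = r := Finset.HasAntidiagonal.mem_antidiagonal.1 hx
  have hzero : ∀ f : FlowData K T N P₀ → ℝ → Momenta n → ℂ,
      (∀ D : FlowData K T N P₀, ∀ Λ ∈ Set.Icc D.ΛR D.Λ0, ∀ k, f D Λ k = 0) →
      SmoothBound K T N P₀ (3 - n - p) r p f := by
    intro f hf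
    have h0 : ∀ D : FlowData K T N P₀, ∀ Λ ∈ Set.Icc D.ΛR D.Λ0, f D Λ = fun _ => 0 :=
      fun D Λ hΛ => funext (hf D Λ hΛ)
    refine ⟨fun D Λ hΛ => by rw [h0 D Λ hΛ]; exact contDiff_const,
      LogBound.of_nonpos fun D Λ hΛ k _ => ?_⟩
    rw [h0 D Λ hΛ]
    simp
  by_cases h1 : r' = 0
  · refine hzero _ fun D Λ hΛ k => ?_
    simp only [h1, FlowData.vertex_zero hΛ (Nat.le_add_left 1 _)]
    simp
  by_cases h2 : r'' = 0
  · refine hzero _ fun D Λ hΛ k => ?_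
    simp only [h2, FlowData.vertex_zero hΛ (Nat.le_add_left 1 _)]
    simp
  have hlt1 : r' < r := by
    rw [← hr]; exact lt_add_of_pos_right _ (pos_iff_ne_zero.2 h2)
  have hlt2 : r'' < r := by
    rw [← hr]; exact lt_add_of_pos_left _ (pos_iff_ne_zero.2 h1)
  subst hr
  exact treeSummand_bound hK p S b c _ _ (fun j => h r' hlt1 _ j (Nat.le_add_left _ _))
    (fun j => h r'' hlt2 _ j (Nat.le_add_left _ _))

lemma linearTerm_eq_zero (hK : IsCutoff K) {A B₁ B₂ Λ : ℝ} (hΛ : 0 < Λ) (L : Potential d) {n : ℕ}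
    (a : Fin n → FieldIndex) (k : Momenta n) : linearTerm K A B₁ B₂ L Λ n a k = 0 := by
  simp [linearTerm, propagatorDot_zero hK hΛ]

/-! ### The loop term -/

/-- The integrand of the loop term. -/
def loopIntegrand (D : FlowData K T N P₀) (Λ : ℝ) {n : ℕ} (a : Fin n → FieldIndex)
    (r : Coupling d →₀ ℕ) (q : E4) (k : Momenta n) : ℂ :=
  ∑ b : FieldIndex, ∑ c : FieldIndex, (propagatorDot K D.B₁ D.B₂ Λ q b c : ℂ) *
    D.vertex r Λ (n + 2) (addLeg (addLeg a b) c) (attach (Fin.snoc (α := fun _ => E4) k.1 q))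

lemma loopIntegrand_eq_zero (hK : IsCutoff K) {D : FlowData K T N P₀} {Λ : ℝ} (hΛ : 0 < Λ)
    {n : ℕ} (a : Fin n → FieldIndex) (r : Coupling d →₀ ℕ) {q : E4} (hq : 2 * Λ ≤ ‖q‖)
    (k : Momenta n) : loopIntegrand D Λ a r q k = 0 := by
  simp [loopIntegrand, propagatorDot_eq_zero hK hΛ _ _ hq]

lemma integrable_loopIntegrand (hK : IsCutoff K) {D : FlowData K T N P₀} {Λ : ℝ}
    (hΛ : Λ ∈ Set.Icc D.ΛR D.Λ0) {n : ℕ} (a : Fin n → FieldIndex) (r : Coupling d →₀ ℕ)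
    (k : Momenta n) : MeasureTheory.Integrable fun q => loopIntegrand D Λ a r q k := by
  have hpos := FlowData.pos_of_mem hΛ
  refine Continuous.integrable_of_hasCompactSupport ?_ ?_
  · refine continuous_finsetSum _ fun b _ => continuous_finsetSum _ fun c _ => ?_
    exact (contDiff_propagatorDot hK hpos (FlowData.abs_B₁_le hΛ)
      (FlowData.abs_B₂_le hΛ) b c).continuous.mul
      ((FlowData.contDiff_vertex hΛ r (by omega) _).continuous.comp (continuous_attach_snoc k))
  · refine HasCompactSupport.of_support_subset_isCompact (isCompact_closedBall (0 : E4) (2 * Λ))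
      fun q hq => ?_
    rw [mem_closedBall_zero_iff]
    by_contra h
    exact hq (loopIntegrand_eq_zero hK hpos a r (not_le.1 h).le k)

lemma contDiff_loopIntegrand {D : FlowData K T N P₀} {Λ : ℝ}
    (hΛ : Λ ∈ Set.Icc D.ΛR D.Λ0) {n : ℕ} (a : Fin n → FieldIndex) (r : Coupling d →₀ ℕ)
    (q : E4) : ContDiff ℝ ∞ (loopIntegrand D Λ a r q) := by
  refine ContDiff.sum fun b _ => ContDiff.sum fun c _ => contDiff_const.mul ?_
  simp only [attach_snoc_eq]
  exact (FlowData.contDiff_vertex hΛ r (by omega) _).comp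
    ((loopMomenta n).contDiff.add contDiff_const)

lemma norm_iteratedFDeriv_loopIntegrand_le {D : FlowData K T N P₀} {Λ : ℝ}
    (hΛ : Λ ∈ Set.Icc D.ΛR D.Λ0) {n : ℕ} (a : Fin n → FieldIndex) (r : Coupling d →₀ ℕ)
    (q : E4) (p : ℕ) (k : Momenta n) {c₀ : ℝ} (hc₀ : 0 ≤ c₀)
    (hc : ∀ b c, ‖(propagatorDot K D.B₁ D.B₂ Λ q b c : ℂ)‖ ≤ c₀) :
    ‖iteratedFDeriv ℝ p (loopIntegrand D Λ a r q) k‖ ≤ c₀ * ∑ b : FieldIndex, ∑ c : FieldIndex,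
      ‖iteratedFDeriv ℝ p (D.vertex r Λ (n + 2) (addLeg (addLeg a b) c))
        (attach (Fin.snoc (α := fun _ => E4) k.1 q))‖ := by
  have hle : ∀ m : ℕ, (m : WithTop ℕ∞) ≤ ∞ := fun m => by exact_mod_cast le_top
  have hv : ∀ b c, ContDiff ℝ ∞ fun k : Momenta n =>
      D.vertex r Λ (n + 2) (addLeg (addLeg a b) c) (attach (Fin.snoc (α := fun _ => E4) k.1 q)) := by
    intro b c
    simp only [attach_snoc_eq]
    exact (FlowData.contDiff_vertex hΛ r (by omega) _).comp
      ((loopMomenta n).contDiff.add contDiff_const)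
  have hs : ∀ b c, ContDiff ℝ ∞ fun k : Momenta n => (propagatorDot K D.B₁ D.B₂ Λ q b c : ℂ) *
      D.vertex r Λ (n + 2) (addLeg (addLeg a b) c) (attach (Fin.snoc (α := fun _ => E4) k.1 q)) :=
    fun b c => contDiff_const.mul (hv b c)
  have e : iteratedFDeriv ℝ p (loopIntegrand D Λ a r q) k = ∑ b : FieldIndex, ∑ c : FieldIndex,
      iteratedFDeriv ℝ p (fun k : Momenta n => (propagatorDot K D.B₁ D.B₂ Λ q b c : ℂ) *
        D.vertex r Λ (n + 2) (addLeg (addLeg a b) c)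
          (attach (Fin.snoc (α := fun _ => E4) k.1 q))) k := by
    have := iteratedFDeriv_sum (𝕜 := ℝ) (i := p) (u := (Finset.univ : Finset FieldIndex))
      (f := fun b k => ∑ c : FieldIndex, (propagatorDot K D.B₁ D.B₂ Λ q b c : ℂ) *
        D.vertex r Λ (n + 2) (addLeg (addLeg a b) c) (attach (Fin.snoc (α := fun _ => E4)
          (Subtype.val (p := (· ∈ Momenta n)) k) q)))
      fun b _ => (ContDiff.sum fun c _ => hs b c).of_le (hle p)
    refine (congrFun this k).trans ?_
    rw [Finset.sum_apply]
    refine Finset.sum_congr rfl fun b _ => ?_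
    rw [iteratedFDeriv_sum fun c _ => (hs b c).of_le (hle p), Finset.sum_apply]
  rw [e, Finset.mul_sum]
  refine norm_sum_le_of_le _ fun b _ => ?_
  rw [Finset.mul_sum]
  refine norm_sum_le_of_le _ fun c _ => ?_
  have e1 := iteratedFDeriv_const_smul_apply (𝕜 := ℝ)
    (a := (propagatorDot K D.B₁ D.B₂ Λ q b c : ℂ)) ((hv b c).of_le (hle p)).contDiffAt (x := k)
  have e2 : (fun k : Momenta n => (propagatorDot K D.B₁ D.B₂ Λ q b c : ℂ) *
      D.vertex r Λ (n + 2) (addLeg (addLeg a b) c) (attach (Fin.snoc (α := fun _ => E4) k.1 q)))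
      = (propagatorDot K D.B₁ D.B₂ Λ q b c : ℂ) • fun k : Momenta n =>
      D.vertex r Λ (n + 2) (addLeg (addLeg a b) c)
        (attach (Fin.snoc (α := fun _ => E4) k.1 q)) := rfl
  rw [e2, e1, norm_smul]
  refine mul_le_mul (hc b c) ?_ (norm_nonneg _) hc₀
  simp only [attach_snoc_eq]
  set w : Momenta (n + 2) := attach (Fin.snoc (α := fun _ => E4) 0 q)
  have hshift : ContDiff ℝ ∞ fun y => D.vertex r Λ (n + 2) (addLeg (addLeg a b) c) (y + w) :=
    (FlowData.contDiff_vertex hΛ r (by omega) _).comp (contDiff_id.add contDiff_const)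
  refine (norm_iteratedFDeriv_comp_clm_le hshift (loopMomenta n) (norm_loopMomenta_le n) p k).trans
    (le_of_eq ?_)
  rw [one_pow, one_mul, iteratedFDeriv_comp_add_right]

lemma loopTerm_eq (D : FlowData K T N P₀) (Λ : ℝ) {n : ℕ} (a : Fin n → FieldIndex)
    (r : Coupling d →₀ ℕ) (k : Momenta n) :
    loopTerm K D.B₁ D.B₂ D.L Λ n a k r
      = ContinuousLinearMap.mul ℝ ℂ ((((2 * Real.pi) ^ 4)⁻¹ : ℝ) : ℂ)
          (∫ q, loopIntegrand D Λ a r q k) := rfl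

/-- The loop momentum ranges over a ball of volume proportional to `Λ^4`, the propagator gives
`Λ^(-3)` and the vertex `Λ^(4-(n+2)-p)`: in total `Λ^(3-n-p)`. The condition on `x` and `v` keeps
all points of the finite difference inside the ball of radius `2Λ`. -/
lemma loopTerm_bound (hK : IsCutoff K) {n : ℕ} (p : ℕ) (a : Fin n → FieldIndex)
    {r : Coupling d →₀ ℕ} (h : VertexBound K T N P₀ (n + 2) p r) :
    ∃ M : ℕ, ∀ D : FlowData K T N P₀, ∀ Λ ∈ Set.Icc D.ΛR D.Λ0, ∀ (v : Fin p → Momenta n) x,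
      ‖x‖ + ∑ i, ‖v i‖ < 2 * Λ →
      ‖fdiff p v (fun k => loopTerm K D.B₁ D.B₂ D.L Λ n a k r) x‖
        ≤ Λ ^ (3 - n - p : ℤ) * D.unit r * D.envelope M r Λ * ∏ i, ‖v i‖ := by
  obtain ⟨C, hC0, hC⟩ := exists_propagatorDot_bound hK 0
  obtain ⟨M, hM⟩ := LogBound.sum (Finset.univ : Finset FieldIndex) fun b _ =>
    LogBound.sum (Finset.univ : Finset FieldIndex) fun c _ => h (addLeg (addLeg a b) c)
  set v₁ : ℝ := MeasureTheory.volume.real (Metric.ball (0 : E4) 1)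
  set κ : ℝ := ((2 * Real.pi) ^ 4)⁻¹ * (16 * v₁ * C)
  refine ⟨⌈κ⌉₊ * M + M, fun D Λ hΛ v x hx => ?_⟩
  have hpos := FlowData.pos_of_mem hΛ
  have hC' : ∀ q b c, ‖(propagatorDot K D.B₁ D.B₂ Λ q b c : ℂ)‖ ≤ C * Λ ^ (-3 : ℤ) := by
    intro q b c
    simpa using hC Λ D.B₁ D.B₂ hpos (FlowData.abs_B₁_le hΛ) (FlowData.abs_B₂_le hΛ) b c q
  have hb0 : 0 ≤ Λ ^ (4 - (n + 2 : ℕ) - p : ℤ) * D.unit r :=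
    mul_nonneg (zpow_nonneg hpos.le _) (D.unit_pos r).le
  have henv := FlowData.envelope_nonneg hΛ M r
  set bnd : ℝ := C * Λ ^ (-3 : ℤ) * (Λ ^ (4 - (n + 2 : ℕ) - p : ℤ) * D.unit r * D.envelope M r Λ)
    * ∏ i, ‖v i‖
  have hprod : 0 ≤ ∏ i, ‖v i‖ := Finset.prod_nonneg fun _ _ => norm_nonneg _
  have hCΛ : 0 ≤ C * Λ ^ (-3 : ℤ) := mul_nonneg hC0 (zpow_nonneg hpos.le _)
  have hbnd : 0 ≤ bnd := mul_nonneg (mul_nonneg hCΛ (mul_nonneg hb0 henv)) hprod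
  -- A bound uniform in `q` on the support of the propagator; the integral is then at most this
  -- bound times the volume of the ball.
  have hpt : ∀ q, ‖fdiff p v (loopIntegrand D Λ a r q) x‖
      ≤ (Metric.closedBall (0 : E4) (2 * Λ)).indicator (fun _ => bnd) q := by
    intro q
    by_cases hq : q ∈ Metric.closedBall (0 : E4) (2 * Λ)
    · rw [Set.indicator_of_mem hq]
      refine norm_fdiff_le (contDiff_loopIntegrand hΛ a r q) v x fun y hy => ?_
      have hy' : ‖y‖ ≤ 2 * Λ := by
        rw [mem_closedBall_iff_norm] at hy
        have := norm_add_le x (y - x)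
        rw [add_sub_cancel] at this
        linarith
      refine (norm_iteratedFDeriv_loopIntegrand_le hΛ a r q p y hCΛ (hC' q)).trans ?_
      exact mul_le_mul_of_nonneg_left (hM D Λ hΛ _ (norm_attach_snoc_le hy' (by simpa using hq))) hCΛ
    · rw [Set.indicator_of_notMem hq]
      have hq' : 2 * Λ ≤ ‖q‖ := by
        rw [mem_closedBall_zero_iff] at hq; linarith
      have : loopIntegrand D Λ a r q = fun _ => 0 :=
        funext fun k => loopIntegrand_eq_zero hK hpos a r hq' k
      rw [this]
      refine (norm_fdiff_le (c := 0) contDiff_const v x fun y _ => ?_).trans (by simp)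
      simp
  have hint : MeasureTheory.Integrable
      ((Metric.closedBall (0 : E4) (2 * Λ)).indicator fun _ => bnd) :=
    (MeasureTheory.integrable_indicator_iff measurableSet_closedBall).2
      (MeasureTheory.integrableOn_const (by exact (MeasureTheory.measure_closedBall_lt_top).ne))
  have hI := MeasureTheory.norm_integral_le_of_norm_le hint (Filter.Eventually.of_forall hpt)
  rw [MeasureTheory.integral_indicator measurableSet_closedBall, MeasureTheory.setIntegral_const,
    smul_eq_mul, MeasureTheory.Measure.addHaar_real_closedBall _ _ (by positivity)] at hI
  have hfin : Module.finrank ℝ E4 = 4 := by simp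
  rw [hfin] at hI
  simp only [loopTerm_eq]
  rw [fdiff_clm, fdiff_integral fun y => integrable_loopIntegrand hK hΛ a r y,
    ContinuousLinearMap.mul_apply', norm_mul, Complex.norm_real,
    Real.norm_of_nonneg (by positivity)]
  have e1 : Λ ^ 4 * (Λ ^ (-3 : ℤ) * Λ ^ (4 - (n + 2 : ℕ) - p : ℤ)) = Λ ^ (3 - n - p : ℤ) := by
    rw [← zpow_natCast, ← zpow_add₀ hpos.ne', ← zpow_add₀ hpos.ne']
    congr 1
    push_cast
    ring
  calc _ ≤ ((2 * Real.pi) ^ 4)⁻¹ * ((2 * Λ) ^ 4 * v₁ * bnd) := by gcongr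
    _ = Λ ^ (3 - n - p : ℤ) * D.unit r * (κ * D.envelope M r Λ) * ∏ i, ‖v i‖ := by
      rw [← e1]; simp only [bnd, κ]; ring
    _ ≤ _ := by
      refine mul_le_mul_of_nonneg_right (mul_le_mul_of_nonneg_left
        (FlowData.envelope_const_mul hΛ (Nat.le_ceil κ) M r) ?_) hprod
      exact mul_nonneg (zpow_nonneg hpos.le _) (D.unit_pos r).le

/-! ### The flow equation -/

/-- The right-hand side of the flow equation. -/
def FlowData.rhs (D : FlowData K T N P₀) (r : Coupling d →₀ ℕ) (Λ : ℝ) (n : ℕ)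
    (a : Fin n → FieldIndex) (k : Momenta n) : ℂ :=
  -(MvPowerSeries.coeff r (treeTerm K D.B₁ D.B₂ D.L Λ n a k)
    + loopTerm K D.B₁ D.B₂ D.L Λ n a k r)

lemma FlowData.hasDerivWithinAt (hK : IsCutoff K) {D : FlowData K T N P₀} {Λ : ℝ}
    (hΛ : Λ ∈ Set.Icc D.ΛR D.Λ0) (r : Coupling d →₀ ℕ) {n : ℕ} (hn : 1 ≤ n)
    (a : Fin n → FieldIndex) (k : Momenta n) :
    HasDerivWithinAt (fun s => D.vertex r s n a k) (D.rhs r Λ n a k) (Set.Icc D.ΛR D.Λ0) Λ := by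
  have := D.sol.flow Λ hΛ n hn a k r
  rw [linearTerm_eq_zero hK (pos_of_mem hΛ), map_zero, add_zero] at this
  exact this

lemma fdiff_neg {E F : Type*} [NormedAddCommGroup E] [NormedAddCommGroup F] [NormedSpace ℝ F]
    {p : ℕ} (f : E → F) (v : Fin p → E) (x : E) :
    fdiff p v (fun y => -f y) x = -fdiff p v f x :=
  fdiff_clm (-ContinuousLinearMap.id ℝ F) f v x

lemma rhs_bound (hK : IsCutoff K) {n : ℕ} (p : ℕ) {r : Coupling d →₀ ℕ}
    (ht : ∀ r' < r, ∀ m j, 1 ≤ m → VertexBound K T N P₀ m j r')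
    (hl : VertexBound K T N P₀ (n + 2) p r) (a : Fin n → FieldIndex) :
    ∃ M : ℕ, ∀ D : FlowData K T N P₀, ∀ Λ ∈ Set.Icc D.ΛR D.Λ0, ∀ (v : Fin p → Momenta n) x,
      ‖x‖ + ∑ i, ‖v i‖ < 2 * Λ → ‖fdiff p v (D.rhs r Λ n a) x‖
        ≤ Λ ^ (3 - n - p : ℤ) * D.unit r * D.envelope M r Λ * ∏ i, ‖v i‖ := by
  obtain ⟨hs, M₁, h₁⟩ := treeTerm_bound hK p a ht
  obtain ⟨M₂, h₂⟩ := loopTerm_bound hK p a hl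
  refine ⟨M₁ + M₂, fun D Λ hΛ v x hx => ?_⟩
  have b1 := norm_fdiff_le (hs D Λ hΛ) v x fun y hy => h₁ D Λ hΛ y <| by
    rw [mem_closedBall_iff_norm] at hy
    have := norm_add_le x (y - x)
    rw [add_sub_cancel] at this
    linarith
  have b2 := h₂ D Λ hΛ v x hx
  have hprod : 0 ≤ ∏ i, ‖v i‖ := Finset.prod_nonneg fun _ _ => norm_nonneg _
  have h0 : 0 ≤ Λ ^ (3 - n - p : ℤ) * D.unit r :=
    mul_nonneg (zpow_nonneg (FlowData.pos_of_mem hΛ).le _) (D.unit_pos r).le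
  unfold FlowData.rhs
  rw [fdiff_neg, norm_neg, fdiff_add]
  refine (norm_add_le _ _).trans ((add_le_add b1 b2).trans ?_)
  rw [← add_mul, ← mul_add]
  exact mul_le_mul_of_nonneg_right
    (mul_le_mul_of_nonneg_left (FlowData.envelope_add hΛ M₁ M₂ r) h0) hprod

/-- Each order is a polynomial in the fields of a degree that does not depend on the solution. -/
lemma exists_uniform_degree (hK : IsCutoff K) (r : Coupling d →₀ ℕ) :
    ∃ m, ∀ D : FlowData K T N P₀, ∀ Λ ∈ Set.Icc D.ΛR D.Λ0, ∀ n, 1 ≤ n → m < n → ∀ a k,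
      D.vertex r Λ n a k = 0 := by
  induction r using WellFoundedLT.induction with
  | ind r ih =>
  choose! m hm using ih
  -- A tree joining vertices of degrees at most `m x.1` and `m x.2` has at most `m x.1 + m x.2 - 2`
  -- external legs.
  set R := (Finset.HasAntidiagonal.antidiagonal r).sup fun x => m x.1 + m x.2
  refine ⟨max (N r) R, fun D => ?_⟩
  obtain ⟨m', hm'⟩ := D.sol.polynomial r
  -- The degree `m'` depends on the solution and only starts the downward induction. Above `max (N
  -- r) R` the right-hand side vanishes, so the vertex is constant in the scale and equals its bare
  -- value, zero.
  suffices H : ∀ j n, 1 ≤ n → max (N r) R < n → m' < n + j → ∀ Λ ∈ Set.Icc D.ΛR D.Λ0, ∀ a k,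
      D.vertex r Λ n a k = 0 from fun Λ hΛ n hn hlt a k =>
    H (m' + 1) n hn hlt (by omega) Λ hΛ a k
  intro j
  induction j with
  | zero => exact fun n hn _ hlt Λ hΛ a k => hm' Λ hΛ n hlt a k
  | succ j ihj =>
    intro n hn hlt hlt' Λ hΛ a k
    have hrhs : ∀ s ∈ Set.Icc D.ΛR D.Λ0, D.rhs r s n a k = 0 := by
      intro s hs
      have h1 : MvPowerSeries.coeff r (treeTerm K D.B₁ D.B₂ D.L s n a k) = 0 := by
        rw [coeff_treeTerm]
        refine Finset.sum_eq_zero fun S _ => Finset.sum_eq_zero fun b _ =>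
          Finset.sum_eq_zero fun c _ => Finset.sum_eq_zero fun x hx => ?_
        have hx' : x.1 + x.2 = r := Finset.HasAntidiagonal.mem_antidiagonal.1 hx
        have hR : m x.1 + m x.2 ≤ R :=
          Finset.le_sup (f := fun x : (Coupling d →₀ ℕ) × (Coupling d →₀ ℕ) => m x.1 + m x.2) hx
        have hcard : S.card + Sᶜ.card = n := by simp [S.card_add_card_compl]
        by_cases z1 : x.1 = 0
        · rw [z1, FlowData.vertex_zero hs (Nat.le_add_left 1 _)]; simp
        by_cases z2 : x.2 = 0
        · rw [z2, FlowData.vertex_zero hs (Nat.le_add_left 1 _)]; simp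
        have hlt1 : x.1 < r := by
          rw [← hx']; exact lt_add_of_pos_right _ (pos_iff_ne_zero.2 z2)
        have hlt2 : x.2 < r := by
          rw [← hx']; exact lt_add_of_pos_left _ (pos_iff_ne_zero.2 z1)
        have hRn : R < n := (le_max_right _ _).trans_lt hlt
        rcases Nat.lt_or_ge (m x.1) (S.card + 1) with h | h
        · rw [hm x.1 hlt1 D s hs _ (Nat.le_add_left 1 _) h]; simp
        · rw [hm x.2 hlt2 D s hs (Sᶜ.card + 1) (Nat.le_add_left 1 _) (by omega)]; simp
      have h2 : loopTerm K D.B₁ D.B₂ D.L s n a k r = 0 := by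
        rw [loopTerm_eq]
        have : ∀ q, loopIntegrand D s a r q k = 0 := fun q => by
          refine Finset.sum_eq_zero fun b _ => Finset.sum_eq_zero fun c _ => ?_
          rw [ihj (n + 2) (by omega) (by omega) (by omega) s hs]; simp
        simp [this]
      rw [FlowData.rhs, h1, h2]; simp
    have hb : D.vertex r D.Λ0 n a k = 0 :=
      D.degree r n ((le_max_left _ _).trans_lt hlt) a k
    have hsub : Set.Icc Λ D.Λ0 ⊆ Set.Icc D.ΛR D.Λ0 := Set.Icc_subset_Icc_left hΛ.1
    have := norm_sub_le_of_hasDerivWithinAt (f := fun s => D.vertex r s n a k)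
      (f' := fun s => D.rhs r s n a k) (B := fun _ => 0) (B' := fun _ => 0) hΛ.2
      (fun s hs => (FlowData.hasDerivWithinAt hK (hsub hs) r hn a k).mono hsub)
      (fun s _ => hasDerivWithinAt_const _ _ _) (fun s hs => by simp [hrhs s (hsub hs)])
    simpa [hb] using this

/-! ### Integration of the flow -/

lemma logEnvelope_mul_log {x l l₀ : ℝ} (hx : 0 ≤ x) (hl : 0 ≤ l) (hl' : l ≤ l₀) (M s : ℕ) :
    logEnvelope M s x l l₀ * l ≤ logEnvelope (M + 1) s x l l₀ := by
  have hl₀ : 0 ≤ l₀ := hl.trans hl'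
  unfold logEnvelope
  have h1 : (if s = 0 then (1 + l) ^ M else 0) * l ≤ (if s = 0 then (1 + l) ^ (M + 1) else 0) := by
    split_ifs
    · rw [pow_succ]; gcongr; linarith
    · simp
  have h2 : (1 + l₀) ^ M * l ≤ (1 + l₀) ^ (M + 1) := by
    rw [pow_succ]; gcongr; linarith
  have h3 : ((if s = 0 then (1 + l) ^ M else 0) + x * (1 + l₀) ^ M) * l
      ≤ (if s = 0 then (1 + l) ^ (M + 1) else 0) + x * (1 + l₀) ^ (M + 1) := by
    rw [add_mul, mul_assoc]
    exact add_le_add h1 (mul_le_mul_of_nonneg_left h2 hx)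
  have h0 : 0 ≤ (if s = 0 then (1 + l) ^ (M + 1) else 0) + x * (1 + l₀) ^ (M + 1) := by
    split_ifs <;> positivity
  rw [mul_assoc]
  refine mul_le_mul ?_ h3 ?_ (Nat.cast_nonneg _)
  · push_cast; linarith
  · split_ifs <;> positivity

lemma FlowData.envelope_mono_scale {D : FlowData K T N P₀} {s Λ : ℝ}
    (hs : s ∈ Set.Icc D.ΛR D.Λ0) (h : s ≤ Λ) (M : ℕ) (r : Coupling d →₀ ℕ) :
    D.envelope M r s ≤ D.envelope M r Λ := by
  have hl : Real.log (s / D.ΛR) ≤ Real.log (Λ / D.ΛR) :=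
    Real.log_le_log (div_pos (pos_of_mem hs) D.ΛR_pos) (div_le_div_of_nonneg_right h D.ΛR_pos.le)
  have hl0 := log_nonneg hs
  have hx : s / D.Λ0 ≤ Λ / D.Λ0 := div_le_div_of_nonneg_right h D.Λ0_pos.le
  have h0 : 0 ≤ (1 + Real.log (D.Λ0 / D.ΛR)) ^ M := by
    have := hl0.trans (log_le hs); positivity
  unfold envelope logEnvelope
  refine mul_le_mul_of_nonneg_left (add_le_add ?_ (mul_le_mul_of_nonneg_right hx h0))
    (Nat.cast_nonneg _)
  split_ifs
  · gcongr
  · exact le_rfl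

/-- A bound on the right-hand side of the flow equation. -/
def RhsBound (K : ℝ → ℝ) (T : TensorBases d) (N : (Coupling d →₀ ℕ) → ℕ)
    (P₀ : ℕ → ℕ → (Coupling d →₀ ℕ) → Polynomial ℝ) (n p : ℕ) (r : Coupling d →₀ ℕ)
    (a : Fin n → FieldIndex) (M : ℕ) : Prop :=
  ∀ D : FlowData K T N P₀, ∀ Λ ∈ Set.Icc D.ΛR D.Λ0, ∀ (v : Fin p → Momenta n) x,
    ‖x‖ + ∑ i, ‖v i‖ < 2 * Λ → ‖fdiff p v (D.rhs r Λ n a) x‖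
      ≤ Λ ^ (3 - n - p : ℤ) * D.unit r * D.envelope M r Λ * ∏ i, ‖v i‖

/-- For `n + p ≤ 4` both `s^(4-n-p)` and the envelope grow with `s` and can be frozen at `Λ`; the
remaining `∫ ds/s` gives one logarithm, absorbed in `M + 1`. -/
lemma flow_up (hK : IsCutoff K) {n p : ℕ} (hn : 1 ≤ n) (hnp : n + p ≤ 4) {r : Coupling d →₀ ℕ}
    {a : Fin n → FieldIndex} {M : ℕ} (h : RhsBound K T N P₀ n p r a M) (D : FlowData K T N P₀)
    {Λ : ℝ} (hΛ : Λ ∈ Set.Icc D.ΛR D.Λ0) :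
    ‖iteratedFDeriv ℝ p (D.vertex r Λ n a) 0 - iteratedFDeriv ℝ p (D.vertex r D.ΛR n a) 0‖
      ≤ Λ ^ (4 - n - p : ℤ) * D.unit r * D.envelope (M + 1) r Λ := by
  have hR := D.ΛR_pos
  have hpos := FlowData.pos_of_mem hΛ
  have hsub : Set.Icc D.ΛR Λ ⊆ Set.Icc D.ΛR D.Λ0 := Set.Icc_subset_Icc_right hΛ.2
  set c : ℝ := Λ ^ (4 - n - p : ℤ) * D.unit r * D.envelope M r Λ
  have hu := (D.unit_pos r).le
  have hc : 0 ≤ c := mul_nonneg (mul_nonneg (zpow_nonneg hpos.le _) hu)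
    (FlowData.envelope_nonneg hΛ M r)
  have key := norm_iteratedFDeriv_sub_le_of_flow (p := p) (f := fun s => D.vertex r s n a)
    (g := fun s => D.rhs r s n a) (B := fun s => c * Real.log s) (B' := fun s => c * s⁻¹)
    -- Only zero momentum is needed, so the smallest ball, contained in the allowed region at every
    -- scale, suffices.
    (R := 2 * D.ΛR) hΛ.1 (by positivity)
    (fun s hs => FlowData.contDiff_vertex (hsub hs) r hn a)
    (fun s hs x => (FlowData.hasDerivWithinAt hK (hsub hs) r hn a x).mono hsub)
    (fun s hs => ((Real.hasDerivAt_log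
      (FlowData.pos_of_mem (hsub hs)).ne').const_mul c).hasDerivWithinAt)
    (fun s hs => mul_nonneg hc (inv_nonneg.2 (FlowData.pos_of_mem (hsub hs)).le))
    (fun s hs v x hx => ?_) (x := 0) (by rw [norm_zero]; positivity)
  · refine key.trans ?_
    rw [← mul_sub, ← Real.log_div hpos.ne' hR.ne']
    simp only [c]
    rw [mul_assoc]
    refine mul_le_mul_of_nonneg_left ?_ (mul_nonneg (zpow_nonneg hpos.le _) hu)
    exact logEnvelope_mul_log (FlowData.ratio_nonneg hΛ) (FlowData.log_nonneg hΛ)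
      (FlowData.log_le hΛ) M _
  · have hspos := FlowData.pos_of_mem (hsub hs)
    have hx' : ‖x‖ + ∑ i, ‖v i‖ < 2 * s := hx.trans_le (by linarith [hs.1])
    refine (h D s (hsub hs) v x hx').trans (mul_le_mul_of_nonneg_right ?_
      (Finset.prod_nonneg fun _ _ => norm_nonneg _))
    have e1 : s ^ (3 - n - p : ℤ) = s ^ (4 - n - p : ℤ) * s⁻¹ := by
      rw [← zpow_sub_one₀ hspos.ne']; congr 1; ring
    have e2 : s ^ (4 - n - p : ℤ) ≤ Λ ^ (4 - n - p : ℤ) :=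
      zpow_le_zpow_left₀ (by omega) hspos.le hs.2
    have e3 := FlowData.envelope_mono_scale (hsub hs) hs.2 M r
    have e4 := FlowData.envelope_nonneg (hsub hs) M r
    rw [e1]
    calc _ = s ^ (4 - n - p : ℤ) * D.unit r * D.envelope M r s * s⁻¹ := by ring
      _ ≤ Λ ^ (4 - n - p : ℤ) * D.unit r * D.envelope M r Λ * s⁻¹ := by gcongr

lemma hasDerivAt_zpow_mul_log_pow {ΛR s : ℝ} (hR : 0 < ΛR) (hs : 0 < s) (e : ℤ) (c : ℝ) (m : ℕ) :
    HasDerivAt (fun s => s ^ (e + 1) * (c + Real.log (s / ΛR)) ^ (m + 1))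
      (s ^ e * (c + Real.log (s / ΛR)) ^ m
        * ((e + 1) * (c + Real.log (s / ΛR)) + (m + 1))) s := by
  have h1 : HasDerivAt (fun s => Real.log (s / ΛR)) s⁻¹ s := by
    have := ((hasDerivAt_id s).div_const ΛR).log (div_pos hs hR).ne'
    refine this.congr_deriv ?_
    simp only [id]
    field_simp
  have h2 := HasDerivAt.fun_pow (h1.const_add c) (m + 1)
  have h3 := hasDerivAt_zpow (e + 1) s (Or.inl hs.ne')
  refine (h3.mul h2).congr_deriv ?_
  rw [zpow_add_one₀ hs.ne', add_sub_cancel_right, Nat.add_sub_cancel, pow_succ]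
  push_cast
  field_simp

/-- With `e = 3 - n - p ≤ -2` the integral of `s^e` times a power of the logarithm is dominated by
its lower end. The part with `s/Λ_0` has integrand at most `Λ^(e+2) / (Λ_0 s)` and costs one
logarithm, genuinely so when `n + p = 5`. -/
lemma flow_down (hK : IsCutoff K) {n p : ℕ} (hn : 1 ≤ n) (hnp : 5 ≤ n + p) {r : Coupling d →₀ ℕ}
    {a : Fin n → FieldIndex} {M : ℕ} (h : RhsBound K T N P₀ n p r a M) :
    ∃ M' : ℕ, ∀ (D : FlowData K T N P₀), ∀ Λ ∈ Set.Icc D.ΛR D.Λ0, ∀ x : Momenta n, ‖x‖ ≤ 2 * Λ →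
      ‖iteratedFDeriv ℝ p (D.vertex r D.Λ0 n a) x - iteratedFDeriv ℝ p (D.vertex r Λ n a) x‖
        ≤ Λ ^ (4 - n - p : ℤ) * D.unit r * D.envelope M' r Λ := by
  -- `M'` dominates the prefactor `m (m+1)^(m+1)` and the exponent `m + 1` that the integration
  -- produces.
  set m := M + 1
  set M' := m * (m + 1) ^ (m + 1) + m + 1
  refine ⟨M', fun D Λ hΛ x hx => ?_⟩
  have hR := D.ΛR_pos
  have hpos := FlowData.pos_of_mem hΛ
  have h0pos := D.Λ0_pos
  have hsub : Set.Icc Λ D.Λ0 ⊆ Set.Icc D.ΛR D.Λ0 := Set.Icc_subset_Icc_left hΛ.1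
  have hu := (D.unit_pos r).le
  set e : ℤ := 3 - n - p
  have he : e ≤ -2 := by omega
  have he' : (4 - n - p : ℤ) = e + 1 := by omega
  set δ : ℝ := if orderNR r = 0 then 1 else 0
  have hδ : 0 ≤ δ := by simp only [δ]; split_ifs <;> norm_num
  set l₀ := Real.log (D.Λ0 / D.ΛR)
  have hl₀ : 0 ≤ l₀ := (FlowData.log_nonneg hΛ).trans (FlowData.log_le hΛ)
  set w := (1 + l₀) ^ m
  have hw : 0 ≤ w := by positivity
  have henv : ∀ k s, D.envelope k r s = k * (δ * (1 + Real.log (s / D.ΛR)) ^ k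
      + s / D.Λ0 * (1 + l₀) ^ k) := fun k s => by
    simp only [FlowData.envelope, logEnvelope, δ, ite_mul, one_mul, zero_mul, l₀]
  -- The logarithm is shifted by `m + 1` so that `-(m + 1)` times the derivative of `s^(e+1) y^m`
  -- dominates `s^e y^m`: this reduces to `(m + 1)(y - m) ≥ y`, which holds exactly when `y ≥ m + 1`
  -- (for `m > 0`).
  set y : ℝ → ℝ := fun s => (m + 1 : ℝ) + Real.log (s / D.ΛR)
  set g : ℝ → ℝ := fun s => s ^ e * y s ^ M * ((e + 1) * y s + (M + 1))
  have hy : ∀ s ∈ Set.Icc D.ΛR D.Λ0, (m + 1 : ℝ) ≤ y s := fun s hs => by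
    have := FlowData.log_nonneg hs
    simp only [y]; linarith
  set B : ℝ → ℝ := fun s => D.unit r * (m * (δ * (-(m + 1) * (s ^ (e + 1) * y s ^ (M + 1)))
    + Λ ^ (e + 2) * (w / D.Λ0) * Real.log s))
  set B' : ℝ → ℝ := fun s => D.unit r * (m * (δ * (-(m + 1) * g s)
    + Λ ^ (e + 2) * (w / D.Λ0) * s⁻¹))
  have hlow : ∀ s ∈ Set.Icc Λ D.Λ0, s ^ e * D.unit r * D.envelope m r s ≤ B' s := by
    intro s hs
    have hspos := FlowData.pos_of_mem (hsub hs)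
    have hys := hy s (hsub hs)
    have hys0 : 0 ≤ y s := by
      have : (0 : ℝ) ≤ (m : ℝ) + 1 := by positivity
      linarith
    have g1 : s ^ e * (1 + Real.log (s / D.ΛR)) ^ m ≤ -(m + 1) * g s := by
      have q1 : (1 + Real.log (s / D.ΛR)) ^ m ≤ y s ^ m := by
        have := FlowData.log_nonneg (hsub hs)
        have hm0 : (0 : ℝ) ≤ m := Nat.cast_nonneg m
        apply pow_le_pow_left₀ (by linarith)
        simp only [y]; linarith
      have hmM : (m : ℝ) = M + 1 := by simp [m]
      have he'' : ((e : ℝ) + 1) ≤ -1 := by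
        have : (e : ℝ) ≤ -2 := by exact_mod_cast he
        linarith
      have q2 : y s ≤ -(m + 1) * ((e + 1) * y s + (M + 1)) := by
        have hM0 : (0 : ℝ) ≤ M := Nat.cast_nonneg M
        have t1 : ((e : ℝ) + 1) * y s ≤ -1 * y s := mul_le_mul_of_nonneg_right he'' hys0
        rw [hmM] at hys ⊢
        nlinarith
      have hse : 0 ≤ s ^ e * y s ^ M := mul_nonneg (zpow_nonneg hspos.le _) (pow_nonneg hys0 _)
      calc s ^ e * (1 + Real.log (s / D.ΛR)) ^ m ≤ s ^ e * y s ^ m :=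
            mul_le_mul_of_nonneg_left q1 (zpow_nonneg hspos.le _)
        _ = s ^ e * y s ^ M * y s := by simp only [m]; ring
        _ ≤ s ^ e * y s ^ M * (-(m + 1) * ((e + 1) * y s + (M + 1))) :=
            mul_le_mul_of_nonneg_left q2 hse
        _ = -(m + 1) * g s := by simp only [g]; ring
    have g2 : s ^ e * (s / D.Λ0 * w) ≤ Λ ^ (e + 2) * (w / D.Λ0) * s⁻¹ := by
      have q1 : s ^ (e + 2) ≤ Λ ^ (e + 2) := by
        have := zpow_le_zpow_left₀ (n := -(e + 2)) (by omega) hpos.le hs.1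
        rw [zpow_neg, zpow_neg] at this
        exact (inv_le_inv₀ (zpow_pos hpos _) (zpow_pos hspos _)).1 this
      have q2 : s ^ e * (s / D.Λ0 * w) = s ^ (e + 2) * (w / D.Λ0) * s⁻¹ := by
        rw [zpow_add₀ hspos.ne', show s ^ (2 : ℤ) = s ^ 2 by norm_cast]
        field_simp
      rw [q2]
      gcongr
    rw [henv]
    calc _ = D.unit r * (m * (δ * (s ^ e * (1 + Real.log (s / D.ΛR)) ^ m)
          + s ^ e * (s / D.Λ0 * w))) := by simp only [w]; ring
      _ ≤ B' s := by simp only [B']; gcongr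
  have hnn : ∀ s ∈ Set.Icc Λ D.Λ0, 0 ≤ s ^ e * D.unit r * D.envelope m r s := fun s hs =>
    mul_nonneg (mul_nonneg (zpow_nonneg (FlowData.pos_of_mem (hsub hs)).le _) hu)
      (FlowData.envelope_nonneg (hsub hs) m r)
  have key := norm_iteratedFDeriv_sub_le_of_flow (p := p) (f := fun s => D.vertex r s n a)
    (g := fun s => D.rhs r s n a) (B := B) (B' := B')
    (R := 2 * Λ) hΛ.2 (by positivity)
    (fun s hs => FlowData.contDiff_vertex (hsub hs) r hn a)
    (fun s hs x => (FlowData.hasDerivWithinAt hK (hsub hs) r hn a x).mono hsub)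
    (fun s hs => ?_) (fun s hs => (hnn s hs).trans (hlow s hs)) (fun s hs v x hx => ?_) hx
  · refine key.trans ?_
    have hyΛ := hy Λ hΛ
    have hy0 := hy D.Λ0 (Set.right_mem_Icc.2 D.ΛR_le)
    have hm1 : (0 : ℝ) ≤ (m : ℝ) + 1 := by positivity
    have hlΛ := FlowData.log_nonneg hΛ
    set l := Real.log (Λ / D.ΛR)
    have b1 : y Λ ≤ (m + 1) * (1 + l) := by
      simp only [y]
      have : (0 : ℝ) ≤ m := Nat.cast_nonneg m
      nlinarith
    have b2 : y Λ ^ m ≤ (m + 1) ^ m * (1 + l) ^ m := by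
      rw [← mul_pow]; exact pow_le_pow_left₀ (hm1.trans hyΛ) b1 m
    have b3 : 0 ≤ D.Λ0 ^ (e + 1) * y D.Λ0 ^ (M + 1) :=
      mul_nonneg (zpow_nonneg h0pos.le _) (pow_nonneg (hm1.trans hy0) _)
    have b4 : Real.log D.Λ0 - Real.log Λ ≤ 1 + l₀ := by
      simp only [l₀]
      rw [Real.log_div h0pos.ne' hR.ne']
      linarith [Real.log_le_log hR hΛ.1]
    have e1 : Λ ^ (e + 2) * (w / D.Λ0) = Λ ^ (e + 1) * (Λ / D.Λ0 * w) := by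
      rw [show e + 2 = (e + 1) + 1 by ring, zpow_add_one₀ hpos.ne']; ring
    have hx0 := FlowData.ratio_nonneg hΛ
    have hz : 0 ≤ Λ ^ (e + 1) := zpow_nonneg hpos.le _
    have hmM' : (m : ℝ) * (m + 1) ^ (m + 1) ≤ M' := by
      simp only [M']; push_cast
      linarith [(Nat.cast_nonneg m : (0 : ℝ) ≤ m)]
    have hmM'' : (m : ℝ) ≤ M' := by
      simp only [M']; push_cast
      have : (0 : ℝ) ≤ (m : ℝ) * (m + 1) ^ (m + 1) := by positivity
      linarith
    have p1 : (1 + l) ^ m ≤ (1 + l) ^ M' :=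
      pow_le_pow_right₀ (by linarith) (by simp only [M']; omega)
    have p2 : w * (1 + l₀) ≤ (1 + l₀) ^ M' := by
      simp only [w]; rw [← pow_succ]
      exact pow_le_pow_right₀ (by linarith) (by simp only [M']; omega)
    have c1 : m * (δ * ((m + 1) * (Λ ^ (e + 1) * y Λ ^ m)))
        ≤ Λ ^ (e + 1) * (M' * (δ * (1 + l) ^ M')) := by
      calc m * (δ * ((m + 1) * (Λ ^ (e + 1) * y Λ ^ m)))
          ≤ m * (δ * ((m + 1) * (Λ ^ (e + 1) * ((m + 1) ^ m * (1 + l) ^ m)))) := by gcongr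
        _ = Λ ^ (e + 1) * ((m * (m + 1) ^ (m + 1)) * (δ * (1 + l) ^ m)) := by ring
        _ ≤ _ := by gcongr
    have c2 : m * (Λ ^ (e + 1) * (Λ / D.Λ0 * w) * (Real.log D.Λ0 - Real.log Λ))
        ≤ Λ ^ (e + 1) * (M' * (Λ / D.Λ0 * (1 + l₀) ^ M')) := by
      calc m * (Λ ^ (e + 1) * (Λ / D.Λ0 * w) * (Real.log D.Λ0 - Real.log Λ))
          ≤ m * (Λ ^ (e + 1) * (Λ / D.Λ0 * w) * (1 + l₀)) := by gcongr
        _ = Λ ^ (e + 1) * (m * (Λ / D.Λ0 * (w * (1 + l₀)))) := by ring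
        _ ≤ _ := by gcongr
    -- The contribution of the upper end `Λ_0` to the primitive has a favourable sign and is
    -- dropped.
    have c3 : 0 ≤ m * (δ * ((m + 1) * (D.Λ0 ^ (e + 1) * y D.Λ0 ^ (M + 1)))) := by positivity
    rw [he', henv]
    simp only [B]
    rw [e1]
    calc _ = D.unit r * (m * (δ * ((m + 1) * (Λ ^ (e + 1) * y Λ ^ m)))
          + m * (Λ ^ (e + 1) * (Λ / D.Λ0 * w) * (Real.log D.Λ0 - Real.log Λ))
          - m * (δ * ((m + 1) * (D.Λ0 ^ (e + 1) * y D.Λ0 ^ (M + 1))))) := by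
          simp only [m]; ring
      _ ≤ D.unit r * (Λ ^ (e + 1) * (M' * (δ * (1 + l) ^ M'))
          + Λ ^ (e + 1) * (M' * (Λ / D.Λ0 * (1 + l₀) ^ M'))) := by
          refine mul_le_mul_of_nonneg_left ?_ hu
          linarith
      _ = _ := by ring
  · have hspos := FlowData.pos_of_mem (hsub hs)
    have h1 := hasDerivAt_zpow_mul_log_pow hR hspos e ((m : ℝ) + 1) M
    have h2 := Real.hasDerivAt_log hspos.ne'
    exact ((((h1.const_mul (-((m : ℝ) + 1))).const_mul δ).add
      (h2.const_mul (Λ ^ (e + 2) * (w / D.Λ0)))).const_mul (m : ℝ)).const_mul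
        (D.unit r) |>.hasDerivWithinAt
  · have hx' : ‖x‖ + ∑ i, ‖v i‖ < 2 * s := hx.trans_le (by linarith [hs.1])
    refine (h D s (hsub hs) v x hx').trans (mul_le_mul_of_nonneg_right ?_
      (Finset.prod_nonneg fun _ _ => norm_nonneg _))
    refine le_trans ?_ (hlow s hs)
    exact mul_le_mul_of_nonneg_left (FlowData.envelope_mono (hsub hs) (by omega) r)
      (mul_nonneg (zpow_nonneg (FlowData.pos_of_mem (hsub hs)).le _) hu)

/-! ### Boundary conditions -/

lemma exists_polynomial_le (P : Polynomial ℝ) (hP : NonnegCoeffs P) :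
    ∃ m : ℕ, ∀ x, 0 ≤ x → P.eval x ≤ m * (1 + x) ^ m := by
  set C := ∑ i ∈ Finset.range (P.natDegree + 1), P.coeff i
  refine ⟨⌈C⌉₊ + P.natDegree, fun x hx => ?_⟩
  rw [Polynomial.eval_eq_sum_range]
  have h1 : ∑ i ∈ Finset.range (P.natDegree + 1), P.coeff i * x ^ i
      ≤ C * (1 + x) ^ (⌈C⌉₊ + P.natDegree) := by
    rw [Finset.sum_mul]
    refine Finset.sum_le_sum fun i hi => mul_le_mul_of_nonneg_left ?_ (hP i)
    refine (pow_le_pow_left₀ hx (by linarith : x ≤ 1 + x) i).trans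
      (pow_le_pow_right₀ (by linarith) ?_)
    have := Finset.mem_range.1 hi
    omega
  refine h1.trans (mul_le_mul_of_nonneg_right ?_ (by positivity))
  push_cast
  linarith [Nat.le_ceil C, (Nat.cast_nonneg P.natDegree : (0 : ℝ) ≤ P.natDegree)]

/-- Quantities that are small at the bare scale are small at all scales. -/
lemma bare_le {D : FlowData K T N P₀} {Λ : ℝ} (hΛ : Λ ∈ Set.Icc D.ΛR D.Λ0) {e : ℤ} (he : e ≤ -1)
    (m : ℕ) (r : Coupling d →₀ ℕ) :
    D.Λ0 ^ e * D.unit r * (m * (1 + Real.log (D.Λ0 / D.ΛR)) ^ m)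
      ≤ Λ ^ e * D.unit r * D.envelope m r Λ := by
  have hpos := FlowData.pos_of_mem hΛ
  have h0 := D.Λ0_pos
  have hu := (D.unit_pos r).le
  have hl := FlowData.log_nonneg hΛ
  have hl₀ := hl.trans (FlowData.log_le hΛ)
  -- The exponent `e ≤ -1` is what yields the gain `Λ/Λ_0`: the claim is that `s^(e+1)` does not
  -- increase with `s`.
  have h1 : D.Λ0 ^ e ≤ Λ ^ e * (Λ / D.Λ0) := by
    have h2 : D.Λ0 ^ (e + 1) ≤ Λ ^ (e + 1) := by
      have := zpow_le_zpow_left₀ (n := -(e + 1)) (by omega) hpos.le hΛ.2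
      rw [zpow_neg, zpow_neg] at this
      exact (inv_le_inv₀ (zpow_pos hpos _) (zpow_pos h0 _)).1 this
    rw [← mul_div_assoc, ← zpow_add_one₀ hpos.ne', le_div_iff₀ h0, ← zpow_add_one₀ h0.ne']
    exact h2
  set w := (1 + Real.log (D.Λ0 / D.ΛR)) ^ m
  have hw : 0 ≤ w := by positivity
  have h3 : m * (Λ / D.Λ0 * w) ≤ D.envelope m r Λ := by
    unfold FlowData.envelope logEnvelope
    refine mul_le_mul_of_nonneg_left (le_add_of_nonneg_left ?_) (Nat.cast_nonneg _)
    split_ifs <;> positivity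
  calc _ ≤ Λ ^ e * (Λ / D.Λ0) * D.unit r * (m * w) := by gcongr
    _ = Λ ^ e * D.unit r * (m * (Λ / D.Λ0 * w)) := by ring
    _ ≤ _ := mul_le_mul_of_nonneg_left h3 (mul_nonneg (zpow_nonneg hpos.le _) hu)

lemma dimlessVertex_eq (D : FlowData K T N P₀) (Λ : ℝ) (n : ℕ) (r : Coupling d →₀ ℕ)
    (a : Fin n → FieldIndex) :
    dimlessVertex D.L Λ n r a
      = ((Λ ^ ((n : ℤ) - 4 + tupleOrder 0 r - orderNR r) : ℝ) : ℂ) • D.vertex r Λ n a := rfl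

lemma norm_iteratedFDeriv_dimlessVertex {D : FlowData K T N P₀} {Λ : ℝ}
    (hΛ : Λ ∈ Set.Icc D.ΛR D.Λ0) {n : ℕ} (hn : 1 ≤ n) (p : ℕ) (r : Coupling d →₀ ℕ)
    (a : Fin n → FieldIndex) (k : Momenta n) :
    ‖iteratedFDeriv ℝ p (dimlessVertex D.L Λ n r a) k‖
      = Λ ^ ((n : ℤ) - 4 + tupleOrder 0 r - orderNR r) *
        ‖iteratedFDeriv ℝ p (D.vertex r Λ n a) k‖ := by
  have hz : 0 ≤ Λ ^ ((n : ℤ) - 4 + tupleOrder 0 r - orderNR r) :=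
    zpow_nonneg (FlowData.pos_of_mem hΛ).le _
  have h := iteratedFDeriv_const_smul_apply (𝕜 := ℝ)
    (a := ((Λ ^ ((n : ℤ) - 4 + tupleOrder 0 r - orderNR r) : ℝ) : ℂ)) (x := k)
    ((FlowData.contDiff_vertex hΛ r hn a).of_le
      (show (p : WithTop ℕ∞) ≤ ∞ by exact_mod_cast le_top)).contDiffAt
  rw [dimlessVertex_eq, h, norm_smul, Complex.norm_real, Real.norm_of_nonneg hz]

/-- The scaling factors in the dimensionless bounds. -/
lemma zpow_dimless_mul (D : FlowData K T N P₀) {Λ : ℝ} (hΛ : 0 < Λ) (n p : ℕ)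
    (r : Coupling d →₀ ℕ) :
    Λ ^ ((n : ℤ) - 4 + tupleOrder 0 r - orderNR r) * (Λ ^ (4 - n - p : ℤ) * D.unit r)
      = (Λ ^ p)⁻¹ * (Λ / D.ΛR) ^ tupleOrder 0 r * (D.Λ0 / Λ) ^ orderNR r := by
  have h : Λ ^ ((n : ℤ) - 4 + tupleOrder 0 r - orderNR r) * Λ ^ (4 - n - p : ℤ)
      = Λ ^ tupleOrder 0 r * (Λ ^ p)⁻¹ * (Λ ^ orderNR r)⁻¹ := by
    rw [← zpow_natCast, ← zpow_natCast, ← zpow_natCast, ← zpow_neg, ← zpow_neg, ← zpow_add₀ hΛ.ne',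
      ← zpow_add₀ hΛ.ne', ← zpow_add₀ hΛ.ne']
    congr 1
    ring
  rw [← mul_assoc, h, FlowData.unit, div_pow, div_pow]
  ring

/-- Transfers the smallness assumption from dimensionless functions tested in special directions to
operator norms of the dimensionful ones. -/
lemma bare_vertex_bound (hP₀ : ∀ n p r, NonnegCoeffs (P₀ n p r)) {n p : ℕ} (hn : 1 ≤ n)
    (hnp : 6 ≤ n + p) (r : Coupling d →₀ ℕ) :
    ∃ m : ℕ, ∀ (D : FlowData K T N P₀) (a : Fin n → FieldIndex) (k : Momenta n),
      ‖k‖ ≤ 2 * D.Λ0 → ‖iteratedFDeriv ℝ p (D.vertex r D.Λ0 n a) k‖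
        ≤ D.Λ0 ^ (4 - n - p : ℤ) * D.unit r * (m * (1 + Real.log (D.Λ0 / D.ΛR)) ^ m) := by
  obtain ⟨m, hm⟩ := exists_polynomial_le _ (hP₀ n p r)
  refine ⟨(4 * n) ^ p * m + m, fun D a k hk => ?_⟩
  have h0 := D.Λ0_pos
  have hR := D.ΛR_pos
  have hmem : D.Λ0 ∈ Set.Icc D.ΛR D.Λ0 := Set.right_mem_Icc.2 D.ΛR_le
  have hl₀ : 0 ≤ Real.log (D.Λ0 / D.ΛR) := FlowData.log_nonneg hmem
  set l₀ := Real.log (D.Λ0 / D.ΛR)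
  have hb := norm_le_of_directions ⟨0, hn⟩
    (iteratedFDeriv ℝ p (dimlessVertex D.L D.Λ0 n r a) k)
    (fun v => D.small r n p hn hnp a v k ((norm_momenta_le_iff_sq h0.le).1 hk))
  set z : ℝ := D.Λ0 ^ ((n : ℤ) - 4 + tupleOrder 0 r - orderNR r)
  have hz : 0 < z := zpow_pos h0 _
  have hzu := zpow_dimless_mul D h0 n p r
  rw [div_self h0.ne', one_pow, mul_one] at hzu
  rw [norm_iteratedFDeriv_dimlessVertex hmem hn, ← hzu] at hb
  have hb' : ‖iteratedFDeriv ℝ p (D.vertex r D.Λ0 n a) k‖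
      ≤ (4 * n) ^ p * (D.Λ0 ^ (4 - n - p : ℤ) * D.unit r * Pln (P₀ n p r) (D.Λ0 / D.ΛR)) := by
    refine le_of_mul_le_mul_left (hb.trans (le_of_eq ?_)) hz
    ring
  refine hb'.trans ?_
  have hu := (D.unit_pos r).le
  have hpow : (1 + l₀) ^ m ≤ (1 + l₀) ^ ((4 * n) ^ p * m + m) :=
    pow_le_pow_right₀ (by linarith) (by omega)
  have hc : ((4 * n : ℝ) ^ p) * m ≤ (((4 * n) ^ p * m + m : ℕ) : ℝ) := by
    push_cast; linarith [(Nat.cast_nonneg m : (0 : ℝ) ≤ m)]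
  calc _ ≤ (4 * n : ℝ) ^ p * (D.Λ0 ^ (4 - n - p : ℤ) * D.unit r * (m * (1 + l₀) ^ m)) := by
        gcongr
        exact hm l₀ hl₀
    _ = D.Λ0 ^ (4 - n - p : ℤ) * D.unit r * (((4 * n : ℝ) ^ p * m) * (1 + l₀) ^ m) := by ring
    _ ≤ _ := by gcongr

lemma norm_coeff_sum_smul_X_le {i : Fin 5} (t : Fin (d i) → ℂ) (r : Coupling d →₀ ℕ) :
    ‖MvPowerSeries.coeff r (∑ j, t j • (MvPowerSeries.X ⟨i, j⟩ : Series d))‖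
      ≤ if ∃ j, r = Finsupp.single ⟨i, j⟩ 1 then ∑ j, ‖t j‖ else 0 := by
  classical
  rw [map_sum]
  simp only [map_smul, MvPowerSeries.coeff_X, smul_eq_mul]
  split_ifs with h
  · refine norm_sum_le_of_le _ fun j _ => ?_
    split_ifs <;> simp
  · rw [Finset.sum_eq_zero, norm_zero]
    intro j _
    rw [if_neg fun hj => h ⟨j, hj⟩, mul_zero]

lemma tupleOrder_single (i i' : Fin 5) (j : Fin (d i)) :
    tupleOrder i' (Finsupp.single (⟨i, j⟩ : Coupling d) 1) = if i = i' then 1 else 0 := by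
  classical
  unfold tupleOrder
  split_ifs with h
  · subst h
    rw [Finset.sum_eq_single j]
    · simp
    · intro b _ hb
      rw [Finsupp.single_apply, if_neg]
      intro h'
      simp only [Sigma.mk.injEq, heq_eq_eq, true_and] at h'
      exact hb h'.symm
    · simp
  · refine Finset.sum_eq_zero fun b _ => ?_
    rw [Finsupp.single_apply, if_neg]
    intro h'
    exact h (congrArg Sigma.fst h')

lemma unit_single (D : FlowData K T N P₀) (i : Fin 5) (j : Fin (d i)) :
    D.unit (Finsupp.single ⟨i, j⟩ 1)
      = if i = 0 then D.ΛR⁻¹ else if i = 1 then 1 else D.Λ0 := by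
  simp only [FlowData.unit, orderNR, tupleOrder_single]
  fin_cases i <;> simp

lemma orderNR_single (i : Fin 5) (j : Fin (d i)) :
    orderNR (Finsupp.single (⟨i, j⟩ : Coupling d) 1) = if i = 0 ∨ i = 1 then 0 else 1 := by
  simp only [orderNR, tupleOrder_single]
  fin_cases i <;> simp

/-- The value at zero momentum of the `p`-th derivatives as a Taylor coefficient. -/
lemma iteratedFDeriv_zero_apply (D : FlowData K T N P₀) (r : Coupling d →₀ ℕ) (Λ : ℝ) (n p : ℕ)
    (a : Fin n → FieldIndex) (v : Fin p → Fin 4 × Fin n × Fin n) :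
    iteratedFDeriv ℝ p (D.vertex r Λ n a) 0 (fun q => direction (v q))
      = MvPowerSeries.coeff r (taylorCoeff D.L Λ n p a v) := rfl

lemma norm_sum_jet_le {ι : Type} [Fintype ι] {n p : ℕ} (t : ι → Jet n p) (a : Fin n → FieldIndex)
    (v : Fin p → Fin 4 × Fin n × Fin n) :
    ∑ j, ‖t j a v‖ ≤ ∑ a, ∑ v, ∑ j, ‖t j a v‖ := by
  refine le_trans ?_ (Finset.single_le_sum (f := fun a => ∑ v, ∑ j, ‖t j a v‖)
    (fun a _ => by positivity) (Finset.mem_univ a))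
  exact Finset.single_le_sum (f := fun v => ∑ j, ‖t j a v‖)
    (fun v _ => by positivity) (Finset.mem_univ v)

/-- Only `L₃` with two derivatives and `L₅` with none survive the symmetries. Their coefficients are
nonzero only at orders consisting of a single bare coupling, where `unit` equals `Λ_0` and cancels
`Λ_0^(-1)`. -/
lemma bare_zero_bound {n p : ℕ} (hn : 1 ≤ n) (hnp : n + p = 5) (r : Coupling d →₀ ℕ) :
    ∃ C : ℝ, 0 ≤ C ∧ ∀ (D : FlowData K T N P₀) (a : Fin n → FieldIndex),
      ‖iteratedFDeriv ℝ p (D.vertex r D.Λ0 n a) 0‖ ≤ C * (D.Λ0 ^ (4 - n - p : ℤ) * D.unit r) := by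
  have he : (4 - n - p : ℤ) = -1 := by omega
  have hmem : ∀ D : FlowData K T N P₀, D.Λ0 ∈ Set.Icc D.ΛR D.Λ0 := fun D =>
    Set.right_mem_Icc.2 D.ΛR_le
  have hsingle : ∀ (D : FlowData K T N P₀) (i : Fin 5), i ≠ 0 → i ≠ 1 →
      (∃ j, r = Finsupp.single ⟨i, j⟩ 1) → D.Λ0 ^ (4 - n - p : ℤ) * D.unit r = 1 := by
    rintro D i h0 h1 ⟨j, rfl⟩
    rw [he, unit_single, if_neg h0, if_neg h1, zpow_neg_one, inv_mul_cancel₀ D.Λ0_pos.ne']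
  have hnn : ∀ D : FlowData K T N P₀, 0 ≤ D.Λ0 ^ (4 - n - p : ℤ) * D.unit r := fun D =>
    mul_nonneg (zpow_nonneg D.Λ0_pos.le _) (D.unit_pos r).le
  have hif : ∀ (D : FlowData K T N P₀) (i : Fin 5), i ≠ 0 → i ≠ 1 → ∀ c, 0 ≤ c →
      (if ∃ j, r = Finsupp.single (⟨i, j⟩ : Coupling d) 1 then c else 0)
        ≤ c * (D.Λ0 ^ (4 - n - p : ℤ) * D.unit r) := by
    intro D i h0 h1 c hc
    split_ifs with h
    · rw [hsingle D i h0 h1 h, mul_one]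
    · exact mul_nonneg hc (hnn D)
  have h5 : n ≤ 5 := by omega
  interval_cases n
  · refine ⟨0, le_rfl, fun D a => ?_⟩
    rw [iteratedFDeriv_momenta_one _ (by omega)]; simp
  · refine ⟨0, le_rfl, fun D a => ?_⟩
    obtain rfl : p = 3 := by omega
    rw [(FlowData.isVertex (hmem D) r (by omega)).iteratedFDeriv_zero_of_odd a (by decide)]; simp
  · obtain rfl : p = 2 := by omega
    set C := ∑ a, ∑ v, ∑ j, ‖T.t67 j a v‖
    have hC : 0 ≤ C := by positivity
    refine ⟨(4 * (3 : ℕ)) ^ 2 * C, by positivity, fun D a => ?_⟩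
    rw [mul_assoc]
    refine norm_le_of_directions 0 _ fun v => ?_
    rw [iteratedFDeriv_zero_apply, D.bare.rho67, map_add]
    refine (norm_add_le _ _).trans ((add_le_add (norm_coeff_sum_smul_X_le _ _)
      (norm_coeff_sum_smul_X_le _ _)).trans ?_)
    refine (add_le_add (hif D 2 (by decide) (by decide) _ (by positivity))
      (hif D 3 (by decide) (by decide) _ (by positivity))).trans ?_
    rw [← add_mul, ← Fintype.sum_sum_type fun j => ‖T.t67 j a v‖]
    exact mul_le_mul_of_nonneg_right (norm_sum_jet_le T.t67 a v) (hnn D)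
  · refine ⟨0, le_rfl, fun D a => ?_⟩
    obtain rfl : p = 1 := by omega
    rw [(FlowData.isVertex (hmem D) r (by omega)).iteratedFDeriv_zero_of_odd a (by decide)]; simp
  · obtain rfl : p = 0 := by omega
    set C := ∑ a, ∑ v, ∑ j, ‖T.t8 j a v‖
    have hC : 0 ≤ C := by positivity
    refine ⟨(4 * (5 : ℕ)) ^ 0 * C, by positivity, fun D a => ?_⟩
    rw [mul_assoc]
    refine norm_le_of_directions 0 _ fun v => ?_
    rw [iteratedFDeriv_zero_apply, D.bare.rho8]
    refine (norm_coeff_sum_smul_X_le _ _).trans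
      ((hif D 4 (by decide) (by decide) _ (by positivity)).trans ?_)
    exact mul_le_mul_of_nonneg_right (norm_sum_jet_le T.t8 a v) (hnn D)

/-- The symmetries leave `(n, p) = (1,0), (2,0), (2,2), (3,0), (4,0)`, exactly the data fixed at
`Λ_R`. The nonzero values sit at a single `ρ₄^R` or `ρ₅^R`, hence at `r_NR = 0`; the dimension of
`L₃(0)` cancels against `Λ_R^(-1)` in `unit`. -/
lemma ren_zero_bound {n p : ℕ} (hn : 1 ≤ n) (hnp : n + p ≤ 4) (r : Coupling d →₀ ℕ) :
    ∃ C : ℝ, 0 ≤ C ∧ ∀ (D : FlowData K T N P₀) (a : Fin n → FieldIndex),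
      ‖iteratedFDeriv ℝ p (D.vertex r D.ΛR n a) 0‖
        ≤ C * (D.ΛR ^ (4 - n - p : ℤ) * D.unit r * if orderNR r = 0 then 1 else 0) := by
  have hmem : ∀ D : FlowData K T N P₀, D.ΛR ∈ Set.Icc D.ΛR D.Λ0 := fun D =>
    Set.left_mem_Icc.2 D.ΛR_le
  have hnn : ∀ D : FlowData K T N P₀,
      0 ≤ D.ΛR ^ (4 - n - p : ℤ) * D.unit r * if orderNR r = 0 then 1 else 0 := fun D =>
    mul_nonneg (mul_nonneg (zpow_nonneg D.ΛR_pos.le _) (D.unit_pos r).le)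
      (by split_ifs <;> norm_num)
  have hzero : (∀ (D : FlowData K T N P₀) (a : Fin n → FieldIndex),
      iteratedFDeriv ℝ p (D.vertex r D.ΛR n a) 0 = 0) →
      ∃ C : ℝ, 0 ≤ C ∧ ∀ (D : FlowData K T N P₀) (a : Fin n → FieldIndex),
      ‖iteratedFDeriv ℝ p (D.vertex r D.ΛR n a) 0‖
        ≤ C * (D.ΛR ^ (4 - n - p : ℤ) * D.unit r * if orderNR r = 0 then 1 else 0) :=
    fun h => ⟨0, le_rfl, fun D a => by rw [h D a]; simp⟩
  have htaylor : (∀ (D : FlowData K T N P₀) a v, taylorCoeff D.L D.ΛR n p a v = 0) →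
      ∀ (D : FlowData K T N P₀) (a : Fin n → FieldIndex),
      iteratedFDeriv ℝ p (D.vertex r D.ΛR n a) 0 = 0 := by
    intro h D a
    have := norm_le_of_directions (c := 0) ⟨0, hn⟩ (iteratedFDeriv ℝ p (D.vertex r D.ΛR n a) 0)
      fun v => by rw [iteratedFDeriv_zero_apply, h, map_zero, norm_zero]
    rw [mul_zero] at this
    exact norm_le_zero_iff.1 this
  by_cases hp1 : Odd p
  · exact hzero fun D a =>
      (FlowData.isVertex (hmem D) r hn).iteratedFDeriv_zero_of_odd a hp1
  by_cases hn1 : n = 1 ∧ p ≠ 0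
  · obtain ⟨rfl, hp⟩ := hn1
    exact hzero fun D a => iteratedFDeriv_momenta_one _ hp _
  have hp : p = 0 ∨ p = 2 := by
    rcases Nat.lt_or_ge p 4 with h | h
    · interval_cases p <;> simp_all (decide := true)
    · omega
  have hn4 : n ≤ 4 := by omega
  interval_cases n
  · obtain rfl : p = 0 := by omega
    exact hzero (htaylor fun D => D.ren.rho1)
  · rcases hp with rfl | rfl
    · exact hzero (htaylor fun D => D.ren.rho2)
    · exact hzero (htaylor fun D => D.ren.rho3)
  · obtain rfl : p = 0 := by omega
    set C := ∑ a, ∑ v, ∑ j, ‖T.t4 j a v‖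
    have hC : 0 ≤ C := by positivity
    refine ⟨(4 * (3 : ℕ)) ^ 0 * C, by positivity, fun D a => ?_⟩
    rw [mul_assoc]
    refine norm_le_of_directions 0 _ fun v => ?_
    rw [iteratedFDeriv_zero_apply, D.ren.rho4]
    refine (norm_coeff_sum_smul_X_le _ _).trans ?_
    split_ifs with h h'
    · obtain ⟨j, rfl⟩ := h
      have hR := D.ΛR_pos.ne'
      rw [unit_single]
      refine (norm_sum_jet_le T.t4 a v).trans (le_of_eq ?_)
      simp [hR, C]
    · obtain ⟨j, rfl⟩ := h
      exact absurd (by rw [orderNR_single]; simp) h'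
    · have := hnn D
      rename_i h'
      rw [if_pos h'] at this
      exact mul_nonneg hC this
    · simp
  · obtain rfl : p = 0 := by omega
    set C := ∑ a, ∑ v, ∑ j, ‖T.t5 j a v‖
    have hC : 0 ≤ C := by positivity
    refine ⟨(4 * (4 : ℕ)) ^ 0 * C, by positivity, fun D a => ?_⟩
    rw [mul_assoc]
    refine norm_le_of_directions 0 _ fun v => ?_
    rw [iteratedFDeriv_zero_apply, D.ren.rho5]
    refine (norm_coeff_sum_smul_X_le _ _).trans ?_
    split_ifs with h h'
    · obtain ⟨j, rfl⟩ := h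
      rw [unit_single]
      refine (norm_sum_jet_le T.t5 a v).trans (le_of_eq ?_)
      simp [C]
    · obtain ⟨j, rfl⟩ := h
      exact absurd (by rw [orderNR_single]; simp) h'
    · have := hnn D
      rename_i h'
      rw [if_pos h'] at this
      exact mul_nonneg hC this
    · simp

/-! ### Bounds on the vertex functions -/

lemma FlowData.add_envelope_le {D : FlowData K T N P₀} {Λ : ℝ} (hΛ : Λ ∈ Set.Icc D.ΛR D.Λ0)
    {r : Coupling d →₀ ℕ} {e : ℤ} {M M' : ℕ} {x y : ℝ}
    (hx : x ≤ Λ ^ e * D.unit r * D.envelope M r Λ)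
    (hy : y ≤ Λ ^ e * D.unit r * D.envelope M' r Λ) :
    x + y ≤ Λ ^ e * D.unit r * D.envelope (M + M') r Λ := by
  refine (add_le_add hx hy).trans ?_
  rw [← mul_add]
  exact mul_le_mul_of_nonneg_left (envelope_add hΛ M M' r)
    (mul_nonneg (zpow_nonneg (pos_of_mem hΛ).le _) (D.unit_pos r).le)

lemma vertexBound_of_irrelevant (hK : IsCutoff K) (hP₀ : ∀ n p r, NonnegCoeffs (P₀ n p r))
    {n p : ℕ} (hn : 1 ≤ n) (hnp : 6 ≤ n + p) {r : Coupling d →₀ ℕ}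
    (h : ∀ a, ∃ M, RhsBound K T N P₀ n p r a M) : VertexBound K T N P₀ n p r := by
  intro a
  obtain ⟨M, hM⟩ := h a
  obtain ⟨M₁, h₁⟩ := flow_down hK hn (by omega) hM
  obtain ⟨m, hm⟩ := bare_vertex_bound (K := K) (T := T) (N := N) hP₀ hn hnp r
  refine ⟨m + M₁, fun D Λ hΛ k hk => ?_⟩
  have b1 := (hm D a k (hk.trans (by linarith [hΛ.2]))).trans
    (bare_le hΛ (e := 4 - n - p) (by omega) m r)
  have b2 := h₁ D Λ hΛ k hk
  refine le_trans ?_ (FlowData.add_envelope_le hΛ b1 b2)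
  rw [norm_sub_rev]
  have := norm_sub_norm_le (iteratedFDeriv ℝ p (D.vertex r Λ n a) k)
    (iteratedFDeriv ℝ p (D.vertex r D.Λ0 n a) k)
  linarith

variable (K T N P₀) in
/-- The bound on the `p`-th derivatives of the `n`-point function at zero momentum. -/
def ZeroBound (n p : ℕ) (r : Coupling d →₀ ℕ) : Prop :=
  ∀ a : Fin n → FieldIndex, ∃ M : ℕ, ∀ D : FlowData K T N P₀, ∀ Λ ∈ Set.Icc D.ΛR D.Λ0,
    ‖iteratedFDeriv ℝ p (D.vertex r Λ n a) 0‖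
      ≤ Λ ^ (4 - n - p : ℤ) * D.unit r * D.envelope M r Λ

lemma zeroBound_of_marginal (hK : IsCutoff K) {n p : ℕ} (hn : 1 ≤ n) (hnp : n + p = 5)
    {r : Coupling d →₀ ℕ} (h : ∀ a, ∃ M, RhsBound K T N P₀ n p r a M) :
    ZeroBound K T N P₀ n p r := by
  intro a
  obtain ⟨M, hM⟩ := h a
  obtain ⟨M₁, h₁⟩ := flow_down hK hn (by omega) hM
  obtain ⟨C, hC, hb⟩ := bare_zero_bound (K := K) (T := T) (N := N) (P₀ := P₀) hn hnp r
  refine ⟨⌈C⌉₊ + M₁, fun D Λ hΛ => ?_⟩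
  have hl₀ := (FlowData.log_nonneg hΛ).trans (FlowData.log_le hΛ)
  have b1 : ‖iteratedFDeriv ℝ p (D.vertex r D.Λ0 n a) 0‖
      ≤ Λ ^ (4 - n - p : ℤ) * D.unit r * D.envelope ⌈C⌉₊ r Λ := by
    refine (hb D a).trans (le_trans ?_ (bare_le hΛ (e := 4 - n - p) (by omega) ⌈C⌉₊ r))
    rw [mul_comm C]
    refine mul_le_mul_of_nonneg_left ?_
      (mul_nonneg (zpow_nonneg D.Λ0_pos.le _) (D.unit_pos r).le)
    refine (Nat.le_ceil C).trans (le_mul_of_one_le_right (Nat.cast_nonneg _) ?_)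
    exact one_le_pow₀ (by linarith)
  have hpos := FlowData.pos_of_mem hΛ
  have b2 := h₁ D Λ hΛ 0 (by rw [norm_zero]; positivity)
  refine le_trans ?_ (FlowData.add_envelope_le hΛ b1 b2)
  rw [norm_sub_rev]
  have := norm_sub_norm_le (iteratedFDeriv ℝ p (D.vertex r Λ n a) 0)
    (iteratedFDeriv ℝ p (D.vertex r D.Λ0 n a) 0)
  linarith

lemma zeroBound_of_relevant (hK : IsCutoff K) {n p : ℕ} (hn : 1 ≤ n) (hnp : n + p ≤ 4)
    {r : Coupling d →₀ ℕ} (h : ∀ a, ∃ M, RhsBound K T N P₀ n p r a M) :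
    ZeroBound K T N P₀ n p r := by
  intro a
  obtain ⟨M, hM⟩ := h a
  obtain ⟨C, hC, hb⟩ := ren_zero_bound (K := K) (T := T) (N := N) (P₀ := P₀) hn hnp r
  refine ⟨⌈C⌉₊ + (M + 1), fun D Λ hΛ => ?_⟩
  have hpos := FlowData.pos_of_mem hΛ
  have hl := FlowData.log_nonneg hΛ
  have hl₀ := hl.trans (FlowData.log_le hΛ)
  have hx := FlowData.ratio_nonneg hΛ
  have hu := (D.unit_pos r).le
  have b1 : ‖iteratedFDeriv ℝ p (D.vertex r D.ΛR n a) 0‖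
      ≤ Λ ^ (4 - n - p : ℤ) * D.unit r * D.envelope ⌈C⌉₊ r Λ := by
    have e1 : D.ΛR ^ (4 - n - p : ℤ) ≤ Λ ^ (4 - n - p : ℤ) :=
      zpow_le_zpow_left₀ (by omega) D.ΛR_pos.le hΛ.1
    have e2 : C * (if orderNR r = 0 then 1 else 0) ≤ D.envelope ⌈C⌉₊ r Λ := by
      unfold FlowData.envelope logEnvelope
      refine mul_le_mul (Nat.le_ceil C) ?_ (by split_ifs <;> norm_num) (Nat.cast_nonneg _)
      refine le_add_of_le_of_nonneg ?_ (by positivity)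
      split_ifs
      · exact one_le_pow₀ (by linarith)
      · exact le_rfl
    have e3 : 0 ≤ C * (if orderNR r = 0 then 1 else 0) := by
      split_ifs <;> simp [hC]
    refine (hb D a).trans ?_
    calc _ = D.ΛR ^ (4 - n - p : ℤ) * D.unit r * (C * (if orderNR r = 0 then 1 else 0)) := by ring
      _ ≤ _ := mul_le_mul (mul_le_mul_of_nonneg_right e1 hu) e2 e3
        (mul_nonneg (zpow_nonneg hpos.le _) hu)
  have b2 := flow_up hK hn hnp hM D hΛ
  refine le_trans ?_ (FlowData.add_envelope_le hΛ b1 b2)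
  have := norm_sub_norm_le (iteratedFDeriv ℝ p (D.vertex r Λ n a) 0)
    (iteratedFDeriv ℝ p (D.vertex r D.ΛR n a) 0)
  linarith

/-- Taylor expansion around zero momentum. -/
lemma VertexBound.of_zeroBound {n p : ℕ} (hn : 1 ≤ n) {r : Coupling d →₀ ℕ}
    (h0 : ZeroBound K T N P₀ n p r) (h1 : VertexBound K T N P₀ n (p + 1) r) :
    VertexBound K T N P₀ n p r := by
  intro a
  obtain ⟨M₀, hM₀⟩ := h0 a
  obtain ⟨M₁, hM₁⟩ := h1 a
  refine ⟨M₀ + (2 * M₁ + M₁), fun D Λ hΛ k hk => ?_⟩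
  have hpos := FlowData.pos_of_mem hΛ
  have hu := (D.unit_pos r).le
  have hs := FlowData.contDiff_vertex hΛ r hn a
  set c := Λ ^ (4 - n - (p + 1 : ℕ) : ℤ) * D.unit r * D.envelope M₁ r Λ
  have hc : 0 ≤ c := mul_nonneg (mul_nonneg (zpow_nonneg hpos.le _) hu)
    (FlowData.envelope_nonneg hΛ M₁ r)
  have key := (convex_closedBall (0 : Momenta n) (2 * Λ)).norm_image_sub_le_of_norm_fderiv_le
    (𝕜 := ℝ) (f := iteratedFDeriv ℝ p (D.vertex r Λ n a)) (C := c) (x := 0) (y := k)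
    (fun z _ => (hs.differentiable_iteratedFDeriv (by exact_mod_cast ENat.natCast_lt_top p)) z)
    (fun z hz => by
      rw [norm_fderiv_iteratedFDeriv]
      exact hM₁ D Λ hΛ z (by simpa using hz))
    (by simp [hpos.le]) (by simpa using hk)
  rw [sub_zero] at key
  have b2 : ‖iteratedFDeriv ℝ p (D.vertex r Λ n a) k - iteratedFDeriv ℝ p (D.vertex r Λ n a) 0‖
      ≤ Λ ^ (4 - n - p : ℤ) * D.unit r * D.envelope (2 * M₁ + M₁) r Λ := by
    refine key.trans ((mul_le_mul_of_nonneg_left hk hc).trans ?_)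
    have e1 : Λ ^ (4 - n - (p + 1 : ℕ) : ℤ) * Λ = Λ ^ (4 - n - p : ℤ) := by
      rw [← zpow_add_one₀ hpos.ne']; congr 1; push_cast; ring
    calc c * (2 * Λ) = Λ ^ (4 - n - (p + 1 : ℕ) : ℤ) * Λ * D.unit r
          * (2 * D.envelope M₁ r Λ) := by simp only [c]; ring
      _ ≤ _ := by
        rw [e1]
        exact mul_le_mul_of_nonneg_left (FlowData.envelope_const_mul hΛ (by norm_num) M₁ r)
          (mul_nonneg (zpow_nonneg hpos.le _) hu)
  refine le_trans ?_ (FlowData.add_envelope_le hΛ (hM₀ D Λ hΛ) b2)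
  have := norm_sub_norm_le (iteratedFDeriv ℝ p (D.vertex r Λ n a) k)
    (iteratedFDeriv ℝ p (D.vertex r Λ n a) 0)
  linarith

/-- Downward induction on the number of derivatives at fixed `n`: direct integration settles `n + p
≥ 6`, and each lower `p` needs its value at zero momentum together with the bound for `p + 1`. -/
lemma vertexBound_of_rhsBound (hK : IsCutoff K) (hP₀ : ∀ n p r, NonnegCoeffs (P₀ n p r)) {n : ℕ}
    (hn : 1 ≤ n) {r : Coupling d →₀ ℕ} (h : ∀ p a, ∃ M, RhsBound K T N P₀ n p r a M) (p : ℕ) :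
    VertexBound K T N P₀ n p r := by
  suffices H : ∀ j p, 6 ≤ n + p + j → VertexBound K T N P₀ n p r from H 6 p (by omega)
  intro j
  induction j with
  | zero => exact fun p hp => vertexBound_of_irrelevant hK hP₀ hn (by omega) (h p)
  | succ j ih =>
    intro p hp
    rcases Nat.lt_or_ge (n + p) 6 with hlt | hge
    · refine VertexBound.of_zeroBound hn ?_ (ih (p + 1) (by omega))
      rcases Nat.lt_or_ge (n + p) 5 with h4 | h5
      · exact zeroBound_of_relevant hK hn (by omega) (h p)
      · exact zeroBound_of_marginal hK hn (by omega) (h p)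
    · exact vertexBound_of_irrelevant hK hP₀ hn hge (h p)

/-- The vertex functions are bounded, by induction on the order and downward induction on the
number of legs. -/
lemma vertexBound (hK : IsCutoff K) (hP₀ : ∀ n p r, NonnegCoeffs (P₀ n p r))
    (r : Coupling d →₀ ℕ) : ∀ n p, 1 ≤ n → VertexBound K T N P₀ n p r := by
  induction r using WellFoundedLT.induction with
  | ind r ih =>
  obtain ⟨m, hm⟩ := exists_uniform_degree (K := K) (T := T) (N := N) (P₀ := P₀) hK r
  suffices H : ∀ j n, m < n + j → 1 ≤ n → ∀ p, VertexBound K T N P₀ n p r from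
    fun n p hn => H (m + 1) n (by omega) hn p
  intro j
  induction j with
  | zero =>
    intro n hlt hn p a
    refine LogBound.of_nonpos fun D Λ hΛ k _ => ?_
    have : D.vertex r Λ n a = fun _ => 0 := funext fun k => hm D Λ hΛ n hn hlt a k
    rw [this]
    simp
  | succ j ihj =>
    intro n hlt hn p
    exact vertexBound_of_rhsBound hK hP₀ hn (fun p a =>
      rhs_bound hK p (fun r' hr' m' j' hm' => ih r' hr' m' j' hm')
        (ihj (n + 2) (by omega) (by omega) p) a) p

end EffGravity

end

/-! ### Return to the dimensionless vertex functions -/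

theorem mainTheorem9
    (K : ℝ → ℝ) (hK : EffGravity.IsCutoff K)
    (d : Fin 5 → ℕ) (T : EffGravity.TensorBases d)
    (N : (EffGravity.Coupling d →₀ ℕ) → ℕ)
    (P₀ : ℕ → ℕ → (EffGravity.Coupling d →₀ ℕ) → Polynomial ℝ)
    (hP₀ : ∀ n p r, EffGravity.NonnegCoeffs (P₀ n p r))
    (n p : ℕ) (hn : 1 ≤ n) (r : EffGravity.Coupling d →₀ ℕ) :
    ∃ P Q : Polynomial ℝ, EffGravity.NonnegCoeffs P ∧ EffGravity.NonnegCoeffs Q ∧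
      ∀ (ΛR Λ0 A B₁ B₂ : ℝ), 0 < ΛR → ΛR ≤ Λ0 →
        |A| ≤ ΛR ^ 3 → |B₁| ≤ ΛR ^ 2 → |B₂| ≤ ΛR ^ 2 →
      ∀ L : EffGravity.Potential d,
        EffGravity.IsSolution K A B₁ B₂ ΛR Λ0 L →
        EffGravity.RenormalizationConditions T ΛR L →
        EffGravity.BareConditions T Λ0 L →
        EffGravity.BareDegree N Λ0 L →
        EffGravity.SmallBare P₀ ΛR Λ0 L →
      ∀ Λ ∈ Set.Icc ΛR Λ0, ∀ a : Fin n → EffGravity.FieldIndex,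
        EffGravity.NormLE Λ p (EffGravity.dimlessVertex L Λ n r a)
          ((Λ ^ p)⁻¹ * (Λ / ΛR) ^ EffGravity.tupleOrder 0 r * (Λ0 / Λ) ^ EffGravity.orderNR r *
            ((if EffGravity.orderNR r = 0 then EffGravity.Pln P (Λ / ΛR) else 0)
              + Λ / Λ0 * EffGravity.Pln Q (Λ0 / ΛR))) := by
  -- Summing over the finitely many field components yields one `M` for all of them.
  obtain ⟨M, hM⟩ := EffGravity.LogBound.sum (Finset.univ : Finset (Fin n → EffGravity.FieldIndex))
    fun a _ => EffGravity.vertexBound (K := K) (T := T) (N := N) (P₀ := P₀) hK hP₀ r n p hn a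
  -- The envelope with parameter `M` as a polynomial in the logarithm; `2 ^ p` accounts for the `p`
  -- directions, each of norm at most `2`.
  set P : Polynomial ℝ := Polynomial.C (2 ^ p * M : ℝ) * (Polynomial.X + 1) ^ M
  have hP : EffGravity.NonnegCoeffs P := fun i => by
    simp only [P, Polynomial.coeff_C_mul, Polynomial.coeff_X_add_one_pow]
    positivity
  have heval : ∀ z, EffGravity.Pln P z = 2 ^ p * (M * (1 + Real.log z) ^ M) := fun z => by
    simp [EffGravity.Pln, P, add_comm, mul_assoc]
  refine ⟨P, P, hP, hP, ?_⟩
  intro ΛR Λ0 A B₁ B₂ hR hRΛ _ hB₁ hB₂ L hsol hren hbare hdeg hsmall Λ hΛ a v k hk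
  let D : EffGravity.FlowData K T N P₀ :=
    ⟨ΛR, Λ0, A, B₁, B₂, hR, hRΛ, hB₁, hB₂, L, hsol, hren, hbare, hdeg, hsmall⟩
  have hΛD : Λ ∈ Set.Icc D.ΛR D.Λ0 := hΛ
  have hpos : 0 < Λ := hR.trans_le hΛ.1
  have hk' := (EffGravity.norm_momenta_le_iff_sq hpos.le).2 hk
  have hop := (Finset.single_le_sum
    (f := fun a => ‖iteratedFDeriv ℝ p (D.vertex r Λ n a) k‖)
    (fun a _ => norm_nonneg _) (Finset.mem_univ a)).trans (hM D Λ hΛD k hk')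
  have hz : 0 ≤ Λ ^ ((n : ℤ) - 4 + EffGravity.tupleOrder 0 r - EffGravity.orderNR r) :=
    zpow_nonneg hpos.le _
  have hdim : ‖iteratedFDeriv ℝ p (EffGravity.dimlessVertex L Λ n r a) k‖
      ≤ (Λ ^ p)⁻¹ * (Λ / ΛR) ^ EffGravity.tupleOrder 0 r * (Λ0 / Λ) ^ EffGravity.orderNR r *
        D.envelope M r Λ := by
    refine (EffGravity.norm_iteratedFDeriv_dimlessVertex hΛD hn p r a k).le.trans
      ((mul_le_mul_of_nonneg_left hop hz).trans (le_of_eq ?_))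
    rw [← mul_assoc, EffGravity.zpow_dimless_mul D hpos n p r]
  have hdir : ‖EffGravity.momDeriv p (EffGravity.dimlessVertex L Λ n r a) v k‖
      ≤ ‖iteratedFDeriv ℝ p (EffGravity.dimlessVertex L Λ n r a) k‖ * 2 ^ p := by
    refine (ContinuousMultilinearMap.le_opNorm _ _).trans
      (mul_le_mul_of_nonneg_left ?_ (norm_nonneg _))
    refine (Finset.prod_le_prod (fun _ _ => norm_nonneg _)
      fun q _ => EffGravity.norm_direction_le (v q)).trans (le_of_eq ?_)
    simp
  refine hdir.trans ((mul_le_mul_of_nonneg_right hdim (by positivity)).trans (le_of_eq ?_))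
  rw [mul_assoc]
  congr 1
  simp only [heval, EffGravity.FlowData.envelope, EffGravity.logEnvelope, D]
  split_ifs <;> ring
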